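/- **Setting.** Let $H^4=\{x\in\mathbb R^5: x\circ x=-1,\ x_5>0\}$, where $x\circ y=x_1y_1+\cdots+x_4y_4-x_5y_5$, with isometry group $\mathrm O^+(4,1)$. Let $s_1,\dots,s_{24}$ be the vectors $\epsilon e_a+\delta e_b+e_5$ with $\epsilon,\delta=\pm1$ and $1\le a<b\le 4$, ordered by $(a,b)=(1,2),(1,3),(2,3),(1,4),(2,4),(3,4)$ and, for each $(a,b)$, by $(\epsilon,\delta)=(1,1),(-1,1),(1,-1),(-1,-1)$. Let $Q=\{x\in H^4: x\circ s_i\le 0,\ 1\le i\le 24\}$ be the ideal regular hyperbolic 24-cell, and let $S_i=\{x\in Q: x\circ s_i=0\}$ be its sides. Its ideal vertices are represented by $v_1,\dots,v_{16}=(\pm\frac12,\pm\frac12,\pm\frac12,\pm\frac12,1)$, in lexicographic order of the signs with $-$ before $+$, and $v_{17},\dots,v_{24}=e_1+e_5,-e_1+e_5,e_2+e_5,-e_2+e_5,\dots,e_4+e_5,-e_4+e_5$. A *side-pairing* of $Q$ assigns to each side $S_i$ another side $S_{i'}$ with $i'\neq i$, and an isometry $g_i$ of $H^4$, such that $g_i(S_i)=S_{i'}$,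 $g_{i'}=g_i^{-1}$ and $Q\cap g_iQ=S_{i'}$. Let $\Gamma$ be the group generated by the $g_i$. The side-pairing *yields the hyperbolic 24-cell manifold* $M=H^4/\Gamma$ if $\Gamma$ acts freely and properly discontinuously on $H^4$ and the inclusion $Q\subset H^4$ induces a bijection from $Q/{\sim}$ onto $H^4/\Gamma$, where $\sim$ is the equivalence relation generated by $x\sim g_ix$ for $x\in S_i$. A *cusp point* of $\Gamma$ is the fixed point at infinity of a parabolic element of $\Gamma$ (an element that fixes no point of $H^4$ and exactly one point at infinity). $M$ *has a single cusp* if the cusp points of $\Gamma$ form exactly one $\Gamma$-orbit. A *maximum cusp* of $M$ is the image in $M$ of an open horoball $B$ that is based at a cusp point of $\Gamma$, satisfies $\gamma B=B$ or $\gamma B\cap B=\emptyset$ for each $\gamma\in\Gamma$, and is maximal under inclusion among such horoballs. **Proposition.** Let $M$ be a hyperbolic 24-cell manifold, obtained from $Q$ by a side-pairing as above, with a single cusp. Then $M$ has a unique maximum cusp, and its hyperbolic volume is $8$. This applies in particular to the four manifolds 24c1.1, ..., 24c1.4: each of the following four tables is realized by a side-pairing of $Q$ that yields a hyperbolic 24-cell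 manifold with a single cusp, and so the volume of its maximum cusp is $8$. Here $i\to j:(b_1,\dots,b_6)$ means that $g_i$ maps $S_i$ onto $S_j$ with $g_iv_{a_k}=v_{b_k}$, where $a_1<\cdots<a_6$ are the indices of the ideal vertices of $S_i$; the maps $S_j\to S_i$ are the inverses. - **24c1.1**: $1\to5:(21,11,16,17,12,15)$; $2\to9:(21,15,8,19,7,16)$; $3\to12:(20,9,2,22,10,1)$; $4\to8:(18,1,6,22,5,2)$; $6\to21:(21,8,12,23,16,4)$; $7\to24:(24,5,9,22,1,13)$; $10\to18:(23,2,12,20,4,10)$; $11\to19:(19,5,15,24,13,7)$; $13\to17:(14,19,23,8,6,16)$; $14\to22:(6,23,22,10,14,2)$; $15\to23:(7,21,24,11,3,15)$; $16\to20:(9,24,20,3,11,1)$. - **24c1.2**: $1\to6:(18,4,7,21,8,3)$; $2\to10:(20,12,3,21,11,4)$; $3\to11:(22,14,5,19,6,13)$; $4\to7:(22,10,13,17,9,14)$; $5\to24:(9,24,22,5,13,1)$; $8\to21:(12,21,23,8,4,16)$; $9\to20:(9,20,24,3,1,11)$; $12\to17:(14,23,19,8,16,6)$; $13\to23:(21,11,7,24,15,3)$;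 $14\to19:(24,5,15,19,7,13)$; $15\to18:(20,2,12,23,10,4)$; $16\to22:(23,10,6,22,2,14)$. - **24c1.3**: $1\to5:(17,16,11,21,12,15)$; $2\to13:(23,12,14,17,16,10)$; $3\to16:(5,24,18,3,7,1)$; $4\to8:(6,22,18,1,2,5)$; $6\to21:(23,16,4,21,8,12)$; $7\to23:(21,3,15,24,11,7)$; $9\to18:(12,20,23,2,4,10)$; $10\to20:(20,3,9,24,11,1)$; $11\to24:(13,22,24,1,9,5)$; $12\to19:(5,13,7,15,24,19)$; $14\to15:(9,13,11,15,24,17)$; $17\to22:(10,22,23,6,14,2)$. - **24c1.4**: $1\to9:(21,15,8,19,16,7)$; $2\to19:(13,15,5,7,19,24)$; $3\to18:(10,12,2,4,20,23)$; $4\to12:(20,9,2,22,1,10)$; $5\to23:(3,7,11,15,21,24)$; $6\to7:(9,17,22,14,13,10)$; $8\to22:(2,6,10,14,22,23)$; $10\to21:(12,23,21,8,16,4)$; $11\to24:(9,22,24,5,1,13)$; $13\to16:(3,1,7,5,24,18)$; $14\to15:(13,15,9,11,24,17)$; $17\to20:(20,3,9,24,11,1)$. -/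

import Mathlib

noncomputable section

namespace Hyp24Cell

open scoped Pointwise ENNReal
open MeasureTheory Set

/-! Hyperbolic 4-space in the hyperboloid model; the coordinates are numbered `0, …, 4`,
and the last one is the time coordinate. -/

/-- The Lorentzian inner product of signature `(4, 1)` on `ℝ⁵`. -/
def lor (x y : Fin 5 → ℝ) : ℝ :=
  x 0 * y 0 + x 1 * y 1 + x 2 * y 2 + x 3 * y 3 - x 4 * y 4

/-- The hyperboloid model of hyperbolic 4-space. -/
def H4 : Type := {x : Fin 5 → ℝ // lor x x = -1 ∧ 0 < x 4}

instance : TopologicalSpace H4 :=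
  inferInstanceAs (TopologicalSpace {x : Fin 5 → ℝ // lor x x = -1 ∧ 0 < x 4})

instance : MeasurableSpace H4 :=
  inferInstanceAs (MeasurableSpace {x : Fin 5 → ℝ // lor x x = -1 ∧ 0 < x 4})

/-- The positive Lorentz group `O⁺(4,1)`, i.e. the group of isometries of `H⁴`: the linear
automorphisms of `ℝ⁵` that preserve the Lorentzian inner product and the upper sheet of the
hyperboloid. -/
def posLorentz : Subgroup ((Fin 5 → ℝ) ≃ₗ[ℝ] (Fin 5 → ℝ)) where
  carrier := {g | (∀ x y, lor (g x) (g y) = lor x y) ∧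
    ∀ x, lor x x = -1 → 0 < x 4 → 0 < (g x) 4}
  mul_mem' := by
    rintro a b ⟨ha, ha'⟩ ⟨hb, hb'⟩
    refine ⟨fun x y => ?_, fun x hx hx' => ?_⟩
    · simp only [LinearEquiv.mul_apply, ha, hb]
    · rw [LinearEquiv.mul_apply]
      exact ha' _ (by rw [hb, hx]) (hb' x hx hx')
  one_mem' := ⟨fun _ _ => rfl, fun _ _ h => h⟩
  inv_mem' := by
    rintro a ⟨ha, ha'⟩
    have key : ∀ x, a (a⁻¹ x) = x := fun x => a.apply_symm_apply x
    have hl : ∀ x y, lor (a⁻¹ x) (a⁻¹ y) = lor x y := fun x y => by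
      rw [← ha, key, key]
    refine ⟨hl, fun x hx hx' => ?_⟩
    have h1 : lor (a⁻¹ x) (a⁻¹ x) = -1 := by rw [hl, hx]
    by_contra hneg
    rcases lt_or_eq_of_le (not_lt.mp hneg) with h | h
    · have h2 : lor (-(a⁻¹ x)) (-(a⁻¹ x)) = -1 := by
        rw [← h1]; simp [lor]
      have h3 := ha' (-(a⁻¹ x)) h2 (by simpa using h)
      rw [map_neg, key] at h3
      simp only [Pi.neg_apply] at h3
      linarith
    · simp only [lor, h] at h1
      nlinarith [mul_self_nonneg ((a⁻¹ x) 0), mul_self_nonneg ((a⁻¹ x) 1),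
        mul_self_nonneg ((a⁻¹ x) 2), mul_self_nonneg ((a⁻¹ x) 3)]

instance : MulAction posLorentz H4 where
  smul g x := ⟨g.1 x.1, by rw [g.2.1]; exact x.2.1, g.2.2 _ x.2.1 x.2.2⟩
  one_smul _ := rfl
  mul_smul _ _ _ := rfl

/-- The chart of the hyperboloid given by its first four coordinates. -/
def chart (y : Fin 4 → ℝ) : H4 :=
  ⟨![y 0, y 1, y 2, y 3, √(1 + ∑ i, y i ^ 2)], by
    have h : 0 < 1 + ∑ i, y i ^ 2 := by positivity
    refine ⟨?_, by simpa using h⟩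
    have h2 := Real.mul_self_sqrt h.le
    simp only [Fin.sum_univ_four] at h2
    simp [lor, Fin.sum_univ_four]
    linarith⟩

theorem measurable_chart : Measurable chart := by
  refine Measurable.subtype_mk (measurable_pi_iff.mpr fun i => ?_)
  fin_cases i <;> simp <;> fun_prop

/-- The hyperbolic volume measure on `H⁴`: the Riemannian volume element of the hyperboloid is
`dy₁ dy₂ dy₃ dy₄ / √(1 + |y|²)` in the first four coordinates. -/
def hypVol : Measure H4 :=
  Measure.map chart
    ((volume : Measure (Fin 4 → ℝ)).withDensity
      fun y => ENNReal.ofReal (1 / √(1 + ∑ i, y i ^ 2)))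

/-! The ideal regular 24-cell. Sides and vertices are numbered `1, …, 24`; the index type is
`Fin 24`, where the numeral `24` denotes `0`, so the lists below begin with the 24th entry. -/

/-- Outward Lorentz normal vectors of the sides of the 24-cell. -/
def sideNormal : Fin 24 → Fin 5 → ℝ :=
  ![
    ![0, 0, -1, -1, 1],
    ![1, 1, 0, 0, 1], ![-1, 1, 0, 0, 1],
    ![1, -1, 0, 0, 1], ![-1, -1, 0, 0, 1],
    ![1, 0, 1, 0, 1], ![-1, 0, 1, 0, 1],
    ![1, 0, -1, 0, 1], ![-1, 0, -1, 0, 1],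
    ![0, 1, 1, 0, 1], ![0, -1, 1, 0, 1],
    ![0, 1, -1, 0, 1], ![0, -1, -1, 0, 1],
    ![1, 0, 0, 1, 1], ![-1, 0, 0, 1, 1],
    ![1, 0, 0, -1, 1], ![-1, 0, 0, -1, 1],
    ![0, 1, 0, 1, 1], ![0, -1, 0, 1, 1],
    ![0, 1, 0, -1, 1], ![0, -1, 0, -1, 1],
    ![0, 0, 1, 1, 1], ![0, 0, -1, 1, 1],
    ![0, 0, 1, -1, 1]]

/-- Light-like vectors that represent the ideal vertices of the 24-cell. -/
def idealVertex : Fin 24 → Fin 5 → ℝ :=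
  ![
    ![0, 0, 0, -1, 1],
    ![-1/2, -1/2, -1/2, -1/2, 1], ![-1/2, -1/2, -1/2, 1/2, 1],
    ![-1/2, -1/2, 1/2, -1/2, 1], ![-1/2, -1/2, 1/2, 1/2, 1],
    ![-1/2, 1/2, -1/2, -1/2, 1], ![-1/2, 1/2, -1/2, 1/2, 1],
    ![-1/2, 1/2, 1/2, -1/2, 1], ![-1/2, 1/2, 1/2, 1/2, 1],
    ![1/2, -1/2, -1/2, -1/2, 1], ![1/2, -1/2, -1/2, 1/2, 1],
    ![1/2, -1/2, 1/2, -1/2, 1], ![1/2, -1/2, 1/2, 1/2, 1],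
    ![1/2, 1/2, -1/2, -1/2, 1], ![1/2, 1/2, -1/2, 1/2, 1],
    ![1/2, 1/2, 1/2, -1/2, 1], ![1/2, 1/2, 1/2, 1/2, 1],
    ![1, 0, 0, 0, 1], ![-1, 0, 0, 0, 1],
    ![0, 1, 0, 0, 1], ![0, -1, 0, 0, 1],
    ![0, 0, 1, 0, 1], ![0, 0, -1, 0, 1],
    ![0, 0, 0, 1, 1]]

/-- The ideal regular 24-cell `Q` in `H⁴` centred at `(0, 0, 0, 0, 1)`. -/
def Q : Set H4 := {x | ∀ i, lor x.1 (sideNormal i) ≤ 0}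

/-- The `i`-th side of `Q`. -/
def side (i : Fin 24) : Set H4 := {x | x ∈ Q ∧ lor x.1 (sideNormal i) = 0}

/-- A side-pairing of `Q`: every side `S i` is carried by an isometry `g i` of `H⁴` onto another
side `S (partner i)`, in such a way that `Q` and `g i Q` lie on opposite sides of the latter. -/
structure SidePairing where
  partner : Fin 24 → Fin 24
  g : Fin 24 → posLorentz
  partner_ne : ∀ i, partner i ≠ i
  g_partner : ∀ i, g (partner i) = (g i)⁻¹
  smul_side : ∀ i, g i • side i = side (partner i)
  inter : ∀ i, Q ∩ g i • Q = side (partner i)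

namespace SidePairing

/-- The group generated by the side-pairing transformations. -/
def group (Φ : SidePairing) : Subgroup posLorentz := Subgroup.closure (range Φ.g)

/-- The identifications of points in the sides of `Q`. -/
def Paired (Φ : SidePairing) (x y : H4) : Prop := ∃ i, x ∈ side i ∧ y = Φ.g i • x

/-- Gluing the sides of `Q` by `Φ` yields the complete hyperbolic 4-manifold `H⁴/Γ`, where `Γ` is
the group generated by the side-pairing transformations: `Γ` acts freely and properly
discontinuously on `H⁴`, and the inclusion of `Q` in `H⁴` induces a bijection from the space
obtained by gluing, `Q` modulo the equivalence relation generated by the identifications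
`x ∼ g i x` for `x` in the side `S i`, onto `H⁴/Γ`. -/
structure YieldsManifold (Φ : SidePairing) : Prop where
  properlyDiscontinuous : ProperlyDiscontinuousSMul Φ.group H4
  free : ∀ γ ∈ Φ.group, ∀ x : H4, γ • x = x → γ = 1
  surjective : ∀ x : H4, ∃ γ ∈ Φ.group, γ • x ∈ Q
  injective : ∀ x ∈ Q, ∀ y ∈ Q, (∃ γ ∈ Φ.group, γ • x = y) → Relation.EqvGen Φ.Paired x y

end SidePairing

/-! Cusps of `H⁴/Γ`. -/

/-- The positive light cone; its rays are the points at infinity of `H⁴`. -/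
def lightCone : Set (Fin 5 → ℝ) := {u | lor u u = 0 ∧ 0 < u 4}

/-- The isometry `γ` fixes the point at infinity represented by `u`. -/
def FixesRay (γ : posLorentz) (u : Fin 5 → ℝ) : Prop := ∃ c : ℝ, γ.1 u = c • u

/-- `γ` is parabolic: it fixes no point of `H⁴` and exactly one point at infinity. -/
def IsParabolic (γ : posLorentz) : Prop :=
  (∀ x : H4, γ • x ≠ x) ∧
    ∃ u ∈ lightCone, FixesRay γ u ∧ ∀ w ∈ lightCone, FixesRay γ w → ∃ c : ℝ, w = c • u

/-- The vector `u` represents a cusp point of `Γ`, i.e. the fixed point at infinity of a parabolic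
element of `Γ`. -/
def IsCuspPoint (Γ : Subgroup posLorentz) (u : Fin 5 → ℝ) : Prop :=
  u ∈ lightCone ∧ ∃ γ ∈ Γ, IsParabolic γ ∧ FixesRay γ u

/-- `H⁴/Γ` has exactly one cusp: the cusp points of `Γ` form exactly one `Γ`-orbit. -/
def OneCusped (Γ : Subgroup posLorentz) : Prop :=
  (∃ u, IsCuspPoint Γ u) ∧
    ∀ u w, IsCuspPoint Γ u → IsCuspPoint Γ w → ∃ γ ∈ Γ, ∃ c : ℝ, γ.1 u = c • w

/-- The open horoball of `H⁴` that is based at the point at infinity represented by `u` and bounded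
by the horosphere `x ∘ u = -1`. -/
def horoball (u : Fin 5 → ℝ) : Set H4 := {x | -1 < lor x.1 u}

/-- `B` is an open horoball based at a cusp point of `Γ` and precisely invariant under `Γ`: each
`γ` in `Γ` leaves `B` invariant or moves it off itself. Such horoballs cover the (horo)cusps of
`H⁴/Γ`. -/
def IsCuspHoroball (Γ : Subgroup posLorentz) (B : Set H4) : Prop :=
  (∃ u, IsCuspPoint Γ u ∧ B = horoball u) ∧ ∀ γ ∈ Γ, γ • B = B ∨ Disjoint (γ • B) B

/-- The orbit space `H⁴/Γ`. -/
abbrev Orbits (Γ : Subgroup posLorentz) : Type := MulAction.orbitRel.Quotient Γ H4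

/-- The quotient map from `H⁴` onto `H⁴/Γ`. -/
def proj (Γ : Subgroup posLorentz) (x : H4) : Orbits Γ := Quotient.mk _ x

/-- `C` is a maximum cusp of `H⁴/Γ`: the image of a largest cusp horoball. -/
def IsMaximumCusp (Γ : Subgroup posLorentz) (C : Set (Orbits Γ)) : Prop :=
  ∃ B, Maximal (IsCuspHoroball Γ) B ∧ C = proj Γ '' B

/-- The hyperbolic volume of a subset `A` of the manifold `H⁴/Γ`: the supremum of the volumes of
the measurable subsets of `H⁴` that the quotient map sends injectively into `A`. -/
def quotientVol (Γ : Subgroup posLorentz) (A : Set (Orbits Γ)) : ℝ≥0∞ :=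
  ⨆ (E : Set H4) (_ : MeasurableSet E) (_ : InjOn (proj Γ) E) (_ : MapsTo (proj Γ) E A), hypVol E

/-! The four side-pairings. An entry `(i, j, [(a, b), …])` means that the `i`-th side is carried
onto the `j`-th side, with the `a`-th ideal vertex going to the `b`-th, and so on. The maps from
the `j`-th sides to the `i`-th sides are the inverses. -/

/-- The side-pairing table of the manifold 24c1.1. -/
def table1 : List (Fin 24 × Fin 24 × List (Fin 24 × Fin 24)) :=
  [
   (1, 5, [(13, 21), (14, 11), (15, 16), (16, 17), (17, 12), (19, 15)]),
   (2, 9, [(5, 21), (6, 15), (7, 8), (8, 19), (18, 7), (19, 16)]),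
   (3, 12, [(9, 20), (10, 9), (11, 2), (12, 22), (17, 10), (20, 1)]),
   (4, 8, [(1, 18), (2, 1), (3, 6), (4, 22), (18, 5), (20, 2)]),
   (6, 21, [(3, 21), (4, 8), (7, 12), (8, 23), (18, 16), (21, 4)]),
   (7, 24, [(9, 24), (10, 5), (13, 9), (14, 22), (17, 1), (22, 13)]),
   (10, 18, [(3, 23), (4, 2), (11, 12), (12, 20), (20, 4), (21, 10)]),
   (11, 19, [(5, 19), (6, 5), (13, 15), (14, 24), (19, 13), (22, 7)]),
   (13, 17, [(10, 14), (12, 19), (14, 23), (16, 8), (17, 6), (23, 16)]),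
   (14, 22, [(2, 6), (4, 23), (6, 22), (8, 10), (18, 14), (23, 2)]),
   (15, 23, [(9, 7), (11, 21), (13, 24), (15, 11), (17, 3), (24, 15)]),
   (16, 20, [(1, 9), (3, 24), (5, 20), (7, 3), (18, 11), (24, 1)])]

/-- The side-pairing table of the manifold 24c1.2. -/
def table2 : List (Fin 24 × Fin 24 × List (Fin 24 × Fin 24)) :=
  [
   (1, 6, [(13, 18), (14, 4), (15, 7), (16, 21), (17, 8), (19, 3)]),
   (2, 10, [(5, 20), (6, 12), (7, 3), (8, 21), (18, 11), (19, 4)]),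
   (3, 11, [(9, 22), (10, 14), (11, 5), (12, 19), (17, 6), (20, 13)]),
   (4, 7, [(1, 22), (2, 10), (3, 13), (4, 17), (18, 9), (20, 14)]),
   (5, 24, [(11, 9), (12, 24), (15, 22), (16, 5), (17, 13), (21, 1)]),
   (8, 21, [(1, 12), (2, 21), (5, 23), (6, 8), (18, 4), (22, 16)]),
   (9, 20, [(7, 9), (8, 20), (15, 24), (16, 3), (19, 1), (21, 11)]),
   (12, 17, [(1, 14), (2, 23), (9, 19), (10, 8), (20, 16), (22, 6)]),
   (13, 23, [(10, 21), (12, 11), (14, 7), (16, 24), (17, 15), (23, 3)]),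
   (14, 19, [(2, 24), (4, 5), (6, 15), (8, 19), (18, 7), (23, 13)]),
   (15, 18, [(9, 20), (11, 2), (13, 12), (15, 23), (17, 10), (24, 4)]),
   (16, 22, [(1, 23), (3, 10), (5, 6), (7, 22), (18, 2), (24, 14)])]

/-- The side-pairing table of the manifold 24c1.3. -/
def table3 : List (Fin 24 × Fin 24 × List (Fin 24 × Fin 24)) :=
  [
   (1, 5, [(13, 17), (14, 16), (15, 11), (16, 21), (17, 12), (19, 15)]),
   (2, 13, [(5, 23), (6, 12), (7, 14), (8, 17), (18, 16), (19, 10)]),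
   (3, 16, [(9, 5), (10, 24), (11, 18), (12, 3), (17, 7), (20, 1)]),
   (4, 8, [(1, 6), (2, 22), (3, 18), (4, 1), (18, 2), (20, 5)]),
   (6, 21, [(3, 23), (4, 16), (7, 4), (8, 21), (18, 8), (21, 12)]),
   (7, 23, [(9, 21), (10, 3), (13, 15), (14, 24), (17, 11), (22, 7)]),
   (9, 18, [(7, 12), (8, 20), (15, 23), (16, 2), (19, 4), (21, 10)]),
   (10, 20, [(3, 20), (4, 3), (11, 9), (12, 24), (20, 11), (21, 1)]),
   (11, 24, [(5, 13), (6, 22), (13, 24), (14, 1), (19, 9), (22, 5)]),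
   (12, 19, [(1, 5), (2, 13), (9, 7), (10, 15), (20, 24), (22, 19)]),
   (14, 15, [(2, 9), (4, 13), (6, 11), (8, 15), (18, 24), (23, 17)]),
   (17, 22, [(6, 10), (8, 22), (14, 23), (16, 6), (19, 14), (23, 2)])]

/-- The side-pairing table of the manifold 24c1.4. -/
def table4 : List (Fin 24 × Fin 24 × List (Fin 24 × Fin 24)) :=
  [
   (1, 9, [(13, 21), (14, 15), (15, 8), (16, 19), (17, 16), (19, 7)]),
   (2, 19, [(5, 13), (6, 15), (7, 5), (8, 7), (18, 19), (19, 24)]),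
   (3, 18, [(9, 10), (10, 12), (11, 2), (12, 4), (17, 20), (20, 23)]),
   (4, 12, [(1, 20), (2, 9), (3, 2), (4, 22), (18, 1), (20, 10)]),
   (5, 23, [(11, 3), (12, 7), (15, 11), (16, 15), (17, 21), (21, 24)]),
   (6, 7, [(3, 9), (4, 17), (7, 22), (8, 14), (18, 13), (21, 10)]),
   (8, 22, [(1, 2), (2, 6), (5, 10), (6, 14), (18, 22), (22, 23)]),
   (10, 21, [(3, 12), (4, 23), (11, 21), (12, 8), (20, 16), (21, 4)]),
   (11, 24, [(5, 9), (6, 22), (13, 24), (14, 5), (19, 1), (22, 13)]),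
   (13, 16, [(10, 3), (12, 1), (14, 7), (16, 5), (17, 24), (23, 18)]),
   (14, 15, [(2, 13), (4, 15), (6, 9), (8, 11), (18, 24), (23, 17)]),
   (17, 20, [(6, 20), (8, 3), (14, 9), (16, 24), (19, 11), (23, 1)])]

/-- The side-pairing tables of the manifolds 24c1.1, 24c1.2, 24c1.3, 24c1.4. -/
def table : Fin 4 → List (Fin 24 × Fin 24 × List (Fin 24 × Fin 24)) :=
  ![table1, table2, table3, table4]

/-- `Φ` is the side-pairing described by the table `T`. -/
def SidePairing.HasTable (Φ : SidePairing)
    (T : List (Fin 24 × Fin 24 × List (Fin 24 × Fin 24))) : Prop :=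
  ∀ e ∈ T, Φ.partner e.1 = e.2.1 ∧
    ∀ p ∈ e.2.2, (Φ.g e.1).1 (idealVertex p.1) = idealVertex p.2

/-- `H⁴/Γ` has a unique maximum cusp, and its volume is `r`. -/
def MaximumCuspHasVolume (Γ : Subgroup posLorentz) (r : ℝ≥0∞) : Prop :=
  ∃ C, IsMaximumCusp Γ C ∧ (∀ C', IsMaximumCusp Γ C' → C' = C) ∧ quotientVol Γ C = r

end Hyp24Cell

end

noncomputable section

namespace Hyp24Cell

open scoped Pointwise ENNReal
open MeasureTheory Set

/-! ### Lorentzian linear algebra -/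

/-! Scale the light-like vectors `v` of the ideal vertices so that their last coordinate is 1.
Distinct ones then satisfy `v ∘ v' ≤ -1/2`, with equality for adjacent vertices, so the horoballs
`-(x ∘ v) < 1/2` at the 24 ideal vertices are disjoint and adjacent ones are tangent. Each side is a
regular ideal octahedron, and the products of its vertices are so rigid that a side-pairing map
carries the scaled vertices of one side exactly to those of the other (`exists_map_vertex`). Hence
the horoballs at the `Γ`-images of the ideal vertices form an invariant disjoint family
(`vertexImage_unique`).

Every cusp point belongs to this family (`exists_smul_isVertexImage`): a ray running to a parabolic
fixed point is moved less and less by the parabolic, whereas displacement is bounded below on the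
compact part of `Q` outside the horoballs. So the ray is eventually covered by the horoballs, and by
connectedness it stays in one. With a single cusp the family is one orbit, and tangency at adjacent
vertices forbids any enlargement (`two_le_of_isCuspHoroball`). So the maximum cusp is unique and is
cut into the 24 pieces of `Q` inside the horoballs.

In horospherical coordinates at `e₁ + e₅`, with `n = -(x ∘ (e₁ + e₅))`, the volume element is `dn dy
/ n`, and the piece of `Q` at level `n < 1/2` is a cube of edge `2n`. A piece has volume `∫ (2n)³ dn
/ n = 1/3` over `0 < n < 1/2`, and 24 of them give 8. That the volume is isometry-invariant is
proved from the generators: similarities in horospherical coordinates and rotations about the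
centre.

For the four tables, each side-pairing map is a symmetry of `Q` followed by the reflection in the
target side, so it is encoded by a permutation of the sides, and the cycle condition at the
right-angled ridges is a finite check (`IsGluing`). In place of Poincaré's polyhedron theorem there
are two arguments. Proper discontinuity comes from the integral lattice spanned by the side normals
(`finite_near`). The tessellation comes from a rewriting system on `Γ`: cross a wall that separates
a tile from a generic point. Ridge cycles close its diamonds, so every element reduces to 1
(`reflTransGen_step`); this yields injectivity of the gluing, and, with the finite check `IsFree`,
freeness. -/

theorem lor_comm (x y : Fin 5 → ℝ) : lor x y = lor y x := by simp only [lor]; ring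

theorem lor_add_left (x y z : Fin 5 → ℝ) : lor (x + y) z = lor x z + lor y z := by
  simp only [lor, Pi.add_apply]; ring

theorem lor_add_right (x y z : Fin 5 → ℝ) : lor x (y + z) = lor x y + lor x z := by
  simp only [lor, Pi.add_apply]; ring

theorem lor_sub_left (x y z : Fin 5 → ℝ) : lor (x - y) z = lor x z - lor y z := by
  simp only [lor, Pi.sub_apply]; ring

theorem lor_sub_right (x y z : Fin 5 → ℝ) : lor x (y - z) = lor x y - lor x z := by
  simp only [lor, Pi.sub_apply]; ring

theorem lor_smul_left (c : ℝ) (x y : Fin 5 → ℝ) : lor (c • x) y = c * lor x y := by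
  simp only [lor, Pi.smul_apply, smul_eq_mul]; ring

theorem lor_smul_right (c : ℝ) (x y : Fin 5 → ℝ) : lor x (c • y) = c * lor x y := by
  simp only [lor, Pi.smul_apply, smul_eq_mul]; ring

theorem lor_neg_left (x y : Fin 5 → ℝ) : lor (-x) y = -lor x y := by
  simp only [lor, Pi.neg_apply]; ring

theorem lor_neg_right (x y : Fin 5 → ℝ) : lor x (-y) = -lor x y := by
  simp only [lor, Pi.neg_apply]; ring

theorem lor_zero_left (y : Fin 5 → ℝ) : lor 0 y = 0 := by simp [lor]

theorem lor_zero_right (y : Fin 5 → ℝ) : lor y 0 = 0 := by simp [lor]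

theorem eq_zero_of_lor_eq_zero {x : Fin 5 → ℝ} (h : ∀ y, lor x y = 0) : x = 0 := by
  ext i
  have := h (Pi.single i 1)
  fin_cases i <;> simpa [lor, Pi.single_apply] using this

/-- The centre of the 24-cell. -/
def e5 : Fin 5 → ℝ := ![0, 0, 0, 0, 1]

theorem lor_e5_right (x : Fin 5 → ℝ) : lor x e5 = -x 4 := by simp [lor, e5]

theorem lor_e5_left (x : Fin 5 → ℝ) : lor e5 x = -x 4 := by simp [lor, e5]

theorem lor_e5_e5 : lor e5 e5 = -1 := by simp [lor, e5]

theorem e5_four : e5 4 = 1 := by simp [e5]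

/-- The centre of the 24-cell as a point of `H⁴`. -/
def base : H4 := ⟨e5, lor_e5_e5, by simp [e5]⟩

theorem cauchy_four (x p : Fin 5 → ℝ) :
    (x 0 * p 0 + x 1 * p 1 + x 2 * p 2 + x 3 * p 3) ^ 2 ≤
      (x 0 ^ 2 + x 1 ^ 2 + x 2 ^ 2 + x 3 ^ 2) * (p 0 ^ 2 + p 1 ^ 2 + p 2 ^ 2 + p 3 ^ 2) := by
  have h1 := sq_nonneg (x 0 * p 1 - x 1 * p 0)
  have h2 := sq_nonneg (x 0 * p 2 - x 2 * p 0)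
  have h3 := sq_nonneg (x 0 * p 3 - x 3 * p 0)
  have h4 := sq_nonneg (x 1 * p 2 - x 2 * p 1)
  have h5 := sq_nonneg (x 1 * p 3 - x 3 * p 1)
  have h6 := sq_nonneg (x 2 * p 3 - x 3 * p 2)
  linarith

theorem lor_self (x : Fin 5 → ℝ) :
    lor x x = (x 0 ^ 2 + x 1 ^ 2 + x 2 ^ 2 + x 3 ^ 2) - x 4 ^ 2 := by simp only [lor]; ring

theorem eq_zero_of_four {p : Fin 5 → ℝ} (h : lor p p ≤ 0) (h4 : p 4 = 0) : p = 0 := by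
  rw [lor_self, h4] at h
  ext i
  have : p i ^ 2 ≤ 0 := by
    fin_cases i <;> simp only [Fin.mk_zero, Fin.mk_one, Fin.reduceFinMk, Fin.isValue]
      <;> nlinarith [sq_nonneg (p 0), sq_nonneg (p 1), sq_nonneg (p 2), sq_nonneg (p 3)]
  simpa using pow_eq_zero_iff (two_ne_zero) |>.mp (le_antisymm this (sq_nonneg _))

/-- The orthogonal complement of a timelike vector is positive definite. -/
theorem eq_zero_of_orth {x p : Fin 5 → ℝ} (hx : lor x x < 0) (h : lor x p = 0)
    (hp : lor p p ≤ 0) : p = 0 := by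
  apply eq_zero_of_four hp
  have hc := cauchy_four x p
  have h' : x 0 * p 0 + x 1 * p 1 + x 2 * p 2 + x 3 * p 3 = x 4 * p 4 := by
    simp only [lor] at h; linarith
  rw [h'] at hc
  rw [lor_self] at hx hp
  set X := x 0 ^ 2 + x 1 ^ 2 + x 2 ^ 2 + x 3 ^ 2 with hX
  have hX0 : 0 ≤ X := by positivity
  have h1 : X * (p 0 ^ 2 + p 1 ^ 2 + p 2 ^ 2 + p 3 ^ 2) ≤ X * p 4 ^ 2 :=
    mul_le_mul_of_nonneg_left (by linarith) hX0
  have h2 : (x 4 ^ 2 - X) * p 4 ^ 2 ≤ 0 := by nlinarith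
  by_contra h0
  have : 0 < p 4 ^ 2 := by positivity
  nlinarith

theorem lor_nonneg_of_orth {x p : Fin 5 → ℝ} (hx : lor x x < 0) (h : lor x p = 0) :
    0 ≤ lor p p := by
  by_contra hn
  have := eq_zero_of_orth hx h (not_le.mp hn).le
  rw [this, lor_zero_left] at hn
  exact hn le_rfl

theorem lor_neg_of_future {x u : Fin 5 → ℝ} (hx : lor x x < 0) (hx4 : 0 < x 4)
    (hu : lor u u ≤ 0) (hu4 : 0 < u 4) : lor x u < 0 := by
  have hc := cauchy_four x u
  rw [lor_self] at hx hu
  have h : (x 0 * u 0 + x 1 * u 1 + x 2 * u 2 + x 3 * u 3) ^ 2 < (x 4 * u 4) ^ 2 := by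
    refine hc.trans_lt ?_
    rw [mul_pow]
    have : 0 < u 4 ^ 2 := by positivity
    have h0 : 0 ≤ x 0 ^ 2 + x 1 ^ 2 + x 2 ^ 2 + x 3 ^ 2 := by positivity
    nlinarith
  have := (abs_lt_of_sq_lt_sq h (by positivity))
  simp only [lor]
  linarith [(abs_lt.mp this).2]

theorem future_of_lor_neg {x u : Fin 5 → ℝ} (hx : lor x x < 0) (hx4 : 0 < x 4)
    (hu : lor u u ≤ 0) (h : lor x u < 0) : 0 < u 4 := by
  by_contra hn
  rcases lt_or_eq_of_le (not_lt.mp hn) with h1 | h1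
  · have := lor_neg_of_future (u := -u) hx hx4 (by simpa [lor_neg_left, lor_neg_right] using hu)
      (by simpa using h1)
    rw [lor_neg_right] at this
    linarith
  · rw [eq_zero_of_four hu h1, lor_zero_right] at h
    exact lt_irrefl _ h

theorem H4.lor_self (x : H4) : lor x.1 x.1 = -1 := x.2.1

theorem H4.four_pos (x : H4) : 0 < x.1 4 := x.2.2

theorem H4.ext {x y : H4} (h : x.1 = y.1) : x = y := Subtype.ext h

theorem H4.timelike (x : H4) : lor x.1 x.1 < 0 := by rw [x.lor_self]; norm_num

theorem H4.lor_light_neg (x : H4) {u : Fin 5 → ℝ} (hu : u ∈ lightCone) : lor x.1 u < 0 :=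
  lor_neg_of_future x.timelike x.four_pos hu.1.le hu.2

/-- `-(x ∘ y)` is the hyperbolic cosine of the distance. The bound is the nonnegative norm of the
component of `y` orthogonal to `x`. -/
theorem H4.lor_le (x y : H4) : lor x.1 y.1 ≤ -1 := by
  have hneg : lor x.1 y.1 < 0 :=
    lor_neg_of_future x.timelike x.four_pos y.timelike.le y.four_pos
  have h0 := lor_nonneg_of_orth (p := y.1 + lor x.1 y.1 • x.1) x.timelike (by
    rw [lor_add_right, lor_smul_right, x.lor_self]; ring)
  simp only [lor_add_left, lor_add_right, lor_smul_left, lor_smul_right, x.lor_self, y.lor_self,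
    lor_comm y.1 x.1] at h0
  nlinarith

theorem H4.eq_of_lor (x y : H4) (h : lor x.1 y.1 = -1) : x = y := by
  have h0 := eq_zero_of_orth (p := y.1 + lor x.1 y.1 • x.1) x.timelike (by
    rw [lor_add_right, lor_smul_right, x.lor_self]; ring) (by
    simp only [lor_add_left, lor_add_right, lor_smul_left, lor_smul_right, x.lor_self, y.lor_self,
      lor_comm y.1 x.1, h]; norm_num)
  rw [h] at h0
  apply H4.ext
  have : y.1 - x.1 = 0 := by rw [← h0]; module
  exact (sub_eq_zero.mp this).symm

theorem lor_light_nonpos {u w : Fin 5 → ℝ} (hu : u ∈ lightCone) (hw : w ∈ lightCone) :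
    lor u w ≤ 0 := by
  have hc := cauchy_four u w
  have h1 := hu.1
  have h2 := hw.1
  rw [lor_self] at h1 h2
  have h : (u 0 * w 0 + u 1 * w 1 + u 2 * w 2 + u 3 * w 3) ^ 2 ≤ (u 4 * w 4) ^ 2 := by
    refine hc.trans_eq ?_
    rw [mul_pow, sub_eq_zero.mp h1, sub_eq_zero.mp h2]
  have := abs_le_of_sq_le_sq h (mul_pos hu.2 hw.2).le
  simp only [lor]
  linarith [(abs_le.mp this).2]

theorem lightCone_eq_smul {u w : Fin 5 → ℝ} (hu : u ∈ lightCone) (hw : w ∈ lightCone)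
    (h : lor u w = 0) : w = (w 4 / u 4) • u := by
  have h4 := hu.2.ne'
  have h0 := eq_zero_of_four (p := w - (w 4 / u 4) • u) (by
    simp only [lor_sub_left, lor_sub_right, lor_smul_left, lor_smul_right, hu.1, hw.1, h,
      lor_comm w u]; norm_num) (by simp [h4])
  exact sub_eq_zero.mp h0

theorem lightCone_smul {u : Fin 5 → ℝ} (hu : u ∈ lightCone) {c : ℝ} (hc : 0 < c) :
    c • u ∈ lightCone := by
  refine ⟨by simp [lor_smul_left, lor_smul_right, hu.1], ?_⟩
  simpa using mul_pos hc hu.2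

/-- Two horoballs whose base vectors are far apart do not meet deep down. -/
theorem H4.lor_light_mul (x : H4) {u w : Fin 5 → ℝ} (hu : u ∈ lightCone) (hw : w ∈ lightCone) :
    -lor u w ≤ 2 * (lor x.1 u * lor x.1 w) := by
  have h1 := x.lor_light_neg hu
  have h2 := x.lor_light_neg hw
  set a := lor x.1 u with ha
  set b := lor x.1 w with hb
  -- `u + a x` and `w + b x` are the components orthogonal to `x`, of lengths `|a|` and `|b|`. This
  -- combination is the Cauchy–Schwarz vector, which vanishes when they point in opposite
  -- directions.
  have h0 := lor_nonneg_of_orth (p := b • (u + a • x.1) + a • (w + b • x.1)) x.timelike (by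
    simp only [lor_add_right, lor_smul_right, x.lor_self, ← ha, ← hb]; ring)
  simp only [lor_add_left, lor_add_right, lor_smul_left, lor_smul_right, x.lor_self,
    lor_comm u x.1, lor_comm w x.1, lor_comm w u, hu.1, hw.1, ← ha, ← hb] at h0
  have h3 : 0 ≤ (a * b) * (2 * (a * b) + lor u w) := by nlinarith
  have h4 : 0 < a * b := mul_pos_of_neg_of_neg h1 h2
  have := nonneg_of_mul_nonneg_right h3 h4
  linarith

/-- The component of `w` orthogonal to both `x` and `s` is spacelike or zero. It shows that a point
of a wall cannot be deep in a horoball whose centre is off that wall. -/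
theorem H4.sq_lor_le (x : H4) {s w : Fin 5 → ℝ} (hs : lor s s = 1) (hxs : lor x.1 s = 0)
    (hw : lor w w = 0) : lor w s ^ 2 ≤ lor x.1 w ^ 2 := by
  set a := lor x.1 w with ha
  set c := lor w s with hc
  have h0 := lor_nonneg_of_orth (p := w + a • x.1 - c • s) x.timelike (by
    simp only [lor_add_right, lor_sub_right, lor_smul_right, x.lor_self, ← ha, hxs]; ring)
  simp only [lor_add_left, lor_add_right, lor_sub_left, lor_sub_right, lor_smul_left,
    lor_smul_right, x.lor_self, hs, hw, lor_comm w x.1, lor_comm s x.1, lor_comm s w, hxs, ← ha,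
    ← hc] at h0
  nlinarith

/-! ### The action of the positive Lorentz group -/

theorem lor_val (g : posLorentz) (x y : Fin 5 → ℝ) :
    lor (g.1 x) (g.1 y) = lor x y := g.2.1 x y

theorem coe_smul (g : posLorentz) (x : H4) : (g • x).1 = g.1 x.1 := rfl

theorem mul_val_apply (g h : posLorentz) (x : Fin 5 → ℝ) : (g * h).1 x = g.1 (h.1 x) := rfl

theorem one_val_apply (x : Fin 5 → ℝ) : (1 : posLorentz).1 x = x := rfl

theorem inv_val_apply_self (g : posLorentz) (x : Fin 5 → ℝ) : (g⁻¹).1 (g.1 x) = x :=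
  g.1.symm_apply_apply x

theorem val_apply_inv_self (g : posLorentz) (x : Fin 5 → ℝ) : g.1 ((g⁻¹).1 x) = x :=
  g.1.apply_symm_apply x

theorem lor_inv_left (g : posLorentz) (x y : Fin 5 → ℝ) : lor ((g⁻¹).1 x) y = lor x (g.1 y) := by
  rw [← lor_val g, val_apply_inv_self]

theorem lor_val_left (g : posLorentz) (x y : Fin 5 → ℝ) : lor (g.1 x) y = lor x ((g⁻¹).1 y) := by
  rw [← lor_val g x, val_apply_inv_self]

theorem posLorentz_ext {g h : posLorentz} (H : ∀ x, g.1 x = h.1 x) : g = h :=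
  Subtype.ext (LinearEquiv.ext H)

theorem val_future (g : posLorentz) {u : Fin 5 → ℝ} (hu : lor u u ≤ 0) (hu4 : 0 < u 4) :
    0 < (g.1 u) 4 := by
  refine future_of_lor_neg (x := g.1 base.1) ?_ (g • base).2.2 (by rwa [lor_val g]) ?_
  · rw [lor_val g]; exact base.timelike
  · rw [lor_val g]; exact lor_neg_of_future base.timelike base.four_pos hu hu4

theorem val_mem_lightCone (g : posLorentz) {u : Fin 5 → ℝ} (hu : u ∈ lightCone) :
    g.1 u ∈ lightCone :=
  ⟨by rw [lor_val g]; exact hu.1, val_future g hu.1.le hu.2⟩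

theorem smul_horoball (g : posLorentz) (u : Fin 5 → ℝ) :
    g • horoball u = horoball (g.1 u) := by
  ext x
  rw [Set.mem_smul_set_iff_inv_smul_mem]
  simp only [horoball, mem_ofPred_eq, coe_smul, lor_inv_left]

/-- The normalization of a timelike vector. -/
def normalize (z : Fin 5 → ℝ) (hz : lor z z < 0) (hz4 : 0 < z 4) : H4 :=
  ⟨(√(-lor z z))⁻¹ • z, by
    have h : 0 < -lor z z := by linarith
    have h2 := Real.mul_self_sqrt h.le
    have h3 : 0 < √(-lor z z) := Real.sqrt_pos.mpr h
    refine ⟨?_, ?_⟩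
    · rw [lor_smul_left, lor_smul_right, ← mul_assoc, ← mul_inv, h2]
      have := hz.ne
      field_simp
    · simpa using mul_pos (inv_pos.mpr h3) hz4⟩

theorem normalize_val {z : Fin 5 → ℝ} (hz : lor z z < 0) (hz4 : 0 < z 4) :
    (normalize z hz hz4).1 = (√(-lor z z))⁻¹ • z := rfl

theorem inv_sqrt_pos {z : Fin 5 → ℝ} (hz : lor z z < 0) : 0 < (√(-lor z z))⁻¹ :=
  inv_pos.mpr (Real.sqrt_pos.mpr (by linarith))

/-! ### The combinatorics of the 24-cell -/

/-- The Lorentzian inner product over the integers. -/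
def lorZ (x y : Fin 5 → ℤ) : ℤ :=
  x 0 * y 0 + x 1 * y 1 + x 2 * y 2 + x 3 * y 3 - x 4 * y 4

/-- The integral coordinates of the normal vectors of the sides, packed in base 4. -/
def sideInt (i : Fin 24) (k : Fin 5) : ℤ :=
  ((948352623804523630615187598499563827936011726796218469201933591592397317 >>>
    (2 * (5 * i.val + k.val)) % 4 : ℕ) : ℤ) - 1

/-- Twice the coordinates of the ideal vertices, packed in base 8. -/
def vertexInt (i : Fin 24) (k : Fin 5) : ℤ :=
  ((1331557406457168023890631610413437487309967552241729832158206828178505228826549252281719048552651916275138706 >>>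
    (3 * (5 * i.val + k.val)) % 8 : ℕ) : ℤ) - 2

/-- The coordinates `-1, 0, 1` are stored as the digits `0, 1, 2`, whence the shift by 1; for
`vertexInt` the shift is 2. -/
theorem sideInt_eq : sideInt = ![
    ![0, 0, -1, -1, 1], ![1, 1, 0, 0, 1], ![-1, 1, 0, 0, 1], ![1, -1, 0, 0, 1],
    ![-1, -1, 0, 0, 1], ![1, 0, 1, 0, 1], ![-1, 0, 1, 0, 1], ![1, 0, -1, 0, 1],
    ![-1, 0, -1, 0, 1], ![0, 1, 1, 0, 1], ![0, -1, 1, 0, 1], ![0, 1, -1, 0, 1],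
    ![0, -1, -1, 0, 1], ![1, 0, 0, 1, 1], ![-1, 0, 0, 1, 1], ![1, 0, 0, -1, 1],
    ![-1, 0, 0, -1, 1], ![0, 1, 0, 1, 1], ![0, -1, 0, 1, 1], ![0, 1, 0, -1, 1],
    ![0, -1, 0, -1, 1], ![0, 0, 1, 1, 1], ![0, 0, -1, 1, 1], ![0, 0, 1, -1, 1]] := by
  decide +kernel

theorem vertexInt_eq : vertexInt = ![
    ![0, 0, 0, -2, 2], ![-1, -1, -1, -1, 2], ![-1, -1, -1, 1, 2], ![-1, -1, 1, -1, 2],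
    ![-1, -1, 1, 1, 2], ![-1, 1, -1, -1, 2], ![-1, 1, -1, 1, 2], ![-1, 1, 1, -1, 2],
    ![-1, 1, 1, 1, 2], ![1, -1, -1, -1, 2], ![1, -1, -1, 1, 2], ![1, -1, 1, -1, 2],
    ![1, -1, 1, 1, 2], ![1, 1, -1, -1, 2], ![1, 1, -1, 1, 2], ![1, 1, 1, -1, 2],
    ![1, 1, 1, 1, 2], ![2, 0, 0, 0, 2], ![-2, 0, 0, 0, 2], ![0, 2, 0, 0, 2], ![0, -2, 0, 0, 2],
    ![0, 0, 2, 0, 2], ![0, 0, -2, 0, 2], ![0, 0, 0, 2, 2]] := by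
  decide +kernel

theorem sideNormal_apply (i : Fin 24) (k : Fin 5) : sideNormal i k = sideInt i k := by
  rw [sideInt_eq]
  fin_cases i <;> fin_cases k <;> simp [sideNormal]

theorem idealVertex_apply (i : Fin 24) (k : Fin 5) : idealVertex i k = vertexInt i k / 2 := by
  rw [vertexInt_eq]
  fin_cases i <;> fin_cases k <;> simp [idealVertex]

theorem lor_side_side (i j : Fin 24) :
    lor (sideNormal i) (sideNormal j) = (lorZ (sideInt i) (sideInt j) : ℤ) := by
  simp only [lor, lorZ, sideNormal_apply]; push_cast; ring

theorem lor_vertex_side (i j : Fin 24) :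
    lor (idealVertex i) (sideNormal j) = (lorZ (vertexInt i) (sideInt j) : ℤ) / 2 := by
  simp only [lor, lorZ, sideNormal_apply, idealVertex_apply]; push_cast; ring

theorem lor_vertex_vertex (i j : Fin 24) :
    lor (idealVertex i) (idealVertex j) = (lorZ (vertexInt i) (vertexInt j) : ℤ) / 4 := by
  simp only [lor, lorZ, idealVertex_apply]; push_cast; ring

theorem side_four (i : Fin 24) : sideNormal i 4 = 1 := by
  have : ∀ i, sideInt i 4 = 1 := by decide +kernel
  rw [sideNormal_apply, this]; norm_num

theorem vertex_four (i : Fin 24) : idealVertex i 4 = 1 := by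
  have : ∀ i, vertexInt i 4 = 2 := by decide +kernel
  rw [idealVertex_apply, this]; norm_num

theorem lor_side_self (i : Fin 24) : lor (sideNormal i) (sideNormal i) = 1 := by
  have : ∀ i, lorZ (sideInt i) (sideInt i) = 1 := by decide +kernel
  rw [lor_side_side, this]; norm_num

theorem lor_side_of_ne {i j : Fin 24} (h : i ≠ j) :
    lor (sideNormal i) (sideNormal j) = 0 ∨ lor (sideNormal i) (sideNormal j) ≤ -1 := by
  have H : ∀ i j, i ≠ j → lorZ (sideInt i) (sideInt j) = 0 ∨ lorZ (sideInt i) (sideInt j) ≤ -1 := by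
    decide +kernel
  rw [lor_side_side]
  exact_mod_cast H i j h

theorem lor_vertex_side_cases (i j : Fin 24) :
    lor (idealVertex i) (sideNormal j) = 0 ∨ lor (idealVertex i) (sideNormal j) ≤ -1 := by
  have H : ∀ i j, lorZ (vertexInt i) (sideInt j) = 0 ∨ lorZ (vertexInt i) (sideInt j) ≤ -2 := by
    decide +kernel
  rw [lor_vertex_side]
  rcases H i j with h | h
  · left; rw [h]; norm_num
  · right
    have : ((lorZ (vertexInt i) (sideInt j) : ℤ) : ℝ) ≤ -2 := by exact_mod_cast h
    linarith

theorem lor_vertex_side_nonpos (i j : Fin 24) : lor (idealVertex i) (sideNormal j) ≤ 0 := by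
  rcases lor_vertex_side_cases i j with h | h <;> linarith

theorem lor_vertex_of_ne {i j : Fin 24} (h : i ≠ j) :
    lor (idealVertex i) (idealVertex j) ≤ -1 / 2 := by
  have H : ∀ i j, i ≠ j → lorZ (vertexInt i) (vertexInt j) ≤ -2 := by decide +kernel
  rw [lor_vertex_vertex]
  have : ((lorZ (vertexInt i) (vertexInt j) : ℤ) : ℝ) ≤ -2 := by exact_mod_cast H i j h
  linarith

theorem vertex_mem_lightCone (i : Fin 24) : idealVertex i ∈ lightCone := by
  have : ∀ i, lorZ (vertexInt i) (vertexInt i) = 0 := by decide +kernel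
  refine ⟨?_, ?_⟩
  · rw [lor_vertex_vertex, this]; norm_num
  · rw [vertex_four]; norm_num

/-- The ideal vertices of a side are at mutual distance `-1/2` or `-1`; in the latter case they are
opposite vertices of the side. -/
theorem lor_vertex_in_side {i a b : Fin 24} (ha : lor (idealVertex a) (sideNormal i) = 0)
    (hb : lor (idealVertex b) (sideNormal i) = 0) (hab : a ≠ b) :
    lor (idealVertex a) (idealVertex b) = -1 / 2 ∨
      (lor (idealVertex a) (idealVertex b) = -1 ∧
        idealVertex a + idealVertex b = sideNormal i + e5) := by
  have H : ∀ i a b, lorZ (vertexInt a) (sideInt i) = 0 → lorZ (vertexInt b) (sideInt i) = 0 →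
      a ≠ b → lorZ (vertexInt a) (vertexInt b) = -2 ∨ (lorZ (vertexInt a) (vertexInt b) = -4 ∧
        ∀ k : Fin 5, vertexInt a k + vertexInt b k = 2 * sideInt i k + if k = 4 then 2 else 0) := by
    decide +kernel
  rw [lor_vertex_side, div_eq_zero_iff] at ha hb
  rcases H i a b (by exact_mod_cast ha.resolve_right (by norm_num))
    (by exact_mod_cast hb.resolve_right (by norm_num)) hab with h | ⟨h, h2⟩
  · left; rw [lor_vertex_vertex, h]; norm_num
  · right
    refine ⟨by rw [lor_vertex_vertex, h]; norm_num, ?_⟩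
    ext k
    have h3 : ((vertexInt a k + vertexInt b k : ℤ) : ℝ) =
      ((2 * sideInt i k + if k = 4 then 2 else 0 : ℤ) : ℝ) := by exact_mod_cast h2 k
    have h4 : e5 k = if k = 4 then 1 else 0 := by
      fin_cases k <;> simp [e5]
    simp only [Pi.add_apply, idealVertex_apply, sideNormal_apply, h4]
    push_cast at h3
    split_ifs at h3 ⊢ <;> linarith

/-- Each ideal vertex of a side belongs to a square of ideal vertices of the side. -/
theorem exists_square {i a : Fin 24} (ha : lor (idealVertex a) (sideNormal i) = 0) :
    ∃ a' b b' : Fin 24, lor (idealVertex a') (sideNormal i) = 0 ∧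
      lor (idealVertex b) (sideNormal i) = 0 ∧ lor (idealVertex b') (sideNormal i) = 0 ∧
      lor (idealVertex a) (idealVertex a') = -1 ∧ lor (idealVertex b) (idealVertex b') = -1 ∧
      lor (idealVertex a) (idealVertex b) = -1 / 2 ∧ lor (idealVertex a) (idealVertex b') = -1 / 2 ∧
      lor (idealVertex a') (idealVertex b) = -1 / 2 ∧
      lor (idealVertex a') (idealVertex b') = -1 / 2 := by
  have H : ∀ i a, lorZ (vertexInt a) (sideInt i) = 0 → ∃ a', lorZ (vertexInt a') (sideInt i) = 0 ∧
      lorZ (vertexInt a) (vertexInt a') = -4 ∧ ∃ b, lorZ (vertexInt b) (sideInt i) = 0 ∧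
      lorZ (vertexInt a) (vertexInt b) = -2 ∧ lorZ (vertexInt a') (vertexInt b) = -2 ∧
      ∃ b', lorZ (vertexInt b') (sideInt i) = 0 ∧ lorZ (vertexInt b) (vertexInt b') = -4 ∧
      lorZ (vertexInt a) (vertexInt b') = -2 ∧ lorZ (vertexInt a') (vertexInt b') = -2 := by
    decide +kernel
  rw [lor_vertex_side, div_eq_zero_iff] at ha
  obtain ⟨a', h1, h2, b, h3, h4, h5, b', h6, h7, h8, h9⟩ :=
    H i a (by exact_mod_cast ha.resolve_right (by norm_num))
  refine ⟨a', b, b', ?_⟩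
  simp only [lor_vertex_side, lor_vertex_vertex, h1, h2, h3, h4, h5, h6, h7, h8, h9]
  norm_num

theorem exists_vertex_of_side (i : Fin 24) : ∃ a, lor (idealVertex a) (sideNormal i) = 0 := by
  have H : ∀ i, ∃ a, lorZ (vertexInt a) (sideInt i) = 0 := by decide +kernel
  obtain ⟨a, h⟩ := H i
  exact ⟨a, by rw [lor_vertex_side, h]; norm_num⟩

theorem exists_adjacent_vertex (a : Fin 24) :
    ∃ b, lor (idealVertex a) (idealVertex b) = -1 / 2 := by
  have H : ∀ a, ∃ b, lorZ (vertexInt a) (vertexInt b) = -2 := by decide +kernel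
  obtain ⟨b, h⟩ := H a
  exact ⟨b, by rw [lor_vertex_vertex, h]; norm_num⟩

/-- The normal vectors of the sides span the whole space. -/
theorem eq_of_lor_side {x y : Fin 5 → ℝ}
    (h : ∀ i, lor x (sideNormal i) = lor y (sideNormal i)) : x = y := by
  have h1 := h 1
  have h2 := h 2
  have h3 := h 3
  have h4 := h 4
  have h5 := h 5
  have h7 := h 7
  have h13 := h 13
  have h15 := h 15
  simp [lor, sideNormal] at h1 h2 h3 h4 h5 h7 h13 h15
  ext k
  fin_cases k <;> simp only [Fin.mk_zero, Fin.mk_one, Fin.reduceFinMk, Fin.isValue]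
    <;> linarith

/-- The inequalities `±xₐ ± x_b ≤ x₅` that define the 24-cell. -/
theorem abs_add_abs_le {x : Fin 5 → ℝ} (h : ∀ i, lor x (sideNormal i) ≤ 0) :
    |x 0| + |x 1| ≤ x 4 ∧ |x 0| + |x 2| ≤ x 4 ∧ |x 1| + |x 2| ≤ x 4 ∧ |x 0| + |x 3| ≤ x 4 ∧
      |x 1| + |x 3| ≤ x 4 ∧ |x 2| + |x 3| ≤ x 4 := by
  have H : ∀ k, (sideNormal k 0 * x 0 + sideNormal k 1 * x 1 + sideNormal k 2 * x 2 +
      sideNormal k 3 * x 3) ≤ x 4 := by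
    intro k
    have := h k
    simp only [lor, side_four] at this
    linarith
  have key : ∀ a b c : ℝ, a + b ≤ c → -a + b ≤ c → a - b ≤ c → -a - b ≤ c → |a| + |b| ≤ c := by
    intro a b c h1 h2 h3 h4
    rcases abs_cases a with ⟨h, -⟩ | ⟨h, -⟩ <;> rcases abs_cases b with ⟨h', -⟩ | ⟨h', -⟩ <;>
      rw [h, h'] <;> linarith
  refine ⟨key _ _ _ ?_ ?_ ?_ ?_, key _ _ _ ?_ ?_ ?_ ?_, key _ _ _ ?_ ?_ ?_ ?_,
    key _ _ _ ?_ ?_ ?_ ?_, key _ _ _ ?_ ?_ ?_ ?_, key _ _ _ ?_ ?_ ?_ ?_⟩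
  · simpa [sideNormal] using H 1
  · simpa [sideNormal] using H 2
  · simpa [sideNormal, sub_eq_add_neg] using H 3
  · simpa [sideNormal, sub_eq_add_neg] using H 4
  · simpa [sideNormal] using H 5
  · simpa [sideNormal] using H 6
  · simpa [sideNormal, sub_eq_add_neg] using H 7
  · simpa [sideNormal, sub_eq_add_neg] using H 8
  · simpa [sideNormal] using H 9
  · simpa [sideNormal] using H 10
  · simpa [sideNormal, sub_eq_add_neg] using H 11
  · simpa [sideNormal, sub_eq_add_neg] using H 12
  · simpa [sideNormal] using H 13
  · simpa [sideNormal] using H 14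
  · simpa [sideNormal, sub_eq_add_neg] using H 15
  · simpa [sideNormal, sub_eq_add_neg] using H 16
  · simpa [sideNormal] using H 17
  · simpa [sideNormal] using H 18
  · simpa [sideNormal, sub_eq_add_neg] using H 19
  · simpa [sideNormal, sub_eq_add_neg] using H 20
  · simpa [sideNormal] using H 21
  · simpa [sideNormal] using H 22
  · simpa [sideNormal, sub_eq_add_neg] using H 23
  · simpa [sideNormal, sub_eq_add_neg] using H 0

/-- Since `r, s ≤ q`, the sum of squares is at most `(p - q) p + q (p + q + r + s)`, then at most
`(p - q) m + 2 q m = (p + q) m`. In the application `t` is the last coordinate and `m` is `t` minus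
the least height over the ideal vertices. -/
theorem sq_sum_le_of_sorted {p q r s t m : ℝ} (hs : 0 ≤ s) (hr : 0 ≤ r) (hrq : r ≤ q) (hsq : s ≤ q)
    (hqp : q ≤ p) (ht : p + q ≤ t) (hp : p ≤ m) (hm : p + q + r + s ≤ 2 * m) :
    p ^ 2 + q ^ 2 + r ^ 2 + s ^ 2 ≤ t * m := by
  have h1 : p ^ 2 + q ^ 2 + r ^ 2 + s ^ 2 ≤ (p - q) * p + q * (p + q + r + s) := by
    nlinarith [mul_nonneg hr (sub_nonneg.mpr hrq), mul_nonneg hs (sub_nonneg.mpr hsq)]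
  have h2 : (p - q) * p ≤ (p - q) * m := mul_le_mul_of_nonneg_left hp (by linarith)
  have h3 : q * (p + q + r + s) ≤ q * (2 * m) := mul_le_mul_of_nonneg_left hm (by linarith)
  have h4 : (p + q) * m ≤ t * m := mul_le_mul_of_nonneg_right ht (by linarith)
  linarith

theorem sq_sum_le_of_max {p q r s t m : ℝ} (hq : 0 ≤ q) (hs : 0 ≤ s) (hr : 0 ≤ r) (hqp : q ≤ p)
    (hrp : r ≤ p) (hsp : s ≤ p) (htq : p + q ≤ t) (htr : p + r ≤ t) (hts : p + s ≤ t) (hp : p ≤ m)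
    (hm : p + q + r + s ≤ 2 * m) :
    p ^ 2 + q ^ 2 + r ^ 2 + s ^ 2 ≤ t * m := by
  rcases le_total q r with h1 | h1 <;> rcases le_total q s with h2 | h2 <;>
    rcases le_total r s with h3 | h3
  · linarith [sq_sum_le_of_sorted (p := p) (q := s) (r := r) (s := q) (t := t) (m := m) hq hr h3 h2
      hsp hts hp (by linarith)]
  · linarith [sq_sum_le_of_sorted (p := p) (q := r) (r := s) (s := q) (t := t) (m := m) hq hs h3 h1
      hrp htr hp (by linarith)]
  · linarith [sq_sum_le_of_sorted (p := p) (q := r) (r := q) (s := s) (t := t) (m := m) hs hq h1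
      (h2.trans h1) hrp htr hp (by linarith)]
  · linarith [sq_sum_le_of_sorted (p := p) (q := r) (r := q) (s := s) (t := t) (m := m) hs hq h1
      h3 hrp htr hp (by linarith)]
  · linarith [sq_sum_le_of_sorted (p := p) (q := s) (r := r) (s := q) (t := t) (m := m) hq hr h3 h2
      hsp hts hp (by linarith)]
  · linarith [sq_sum_le_of_sorted (p := p) (q := s) (r := r) (s := q) (t := t) (m := m) hq hr
      (h1.trans h2) h2 hsp hts hp (by linarith)]
  · linarith [sq_sum_le_of_sorted (p := p) (q := q) (r := r) (s := s) (t := t) (m := m) hs hr h1 h2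
      hqp htq hp (by linarith)]
  · linarith [sq_sum_le_of_sorted (p := p) (q := q) (r := r) (s := s) (t := t) (m := m) hs hr h1 h2
      hqp htq hp (by linarith)]

/-- The vertex is the one whose signs agree with those of `x`. -/
theorem exists_half_vertex (x : Fin 5 → ℝ) :
    ∃ a, -lor x (idealVertex a) = x 4 - (|x 0| + |x 1| + |x 2| + |x 3|) / 2 := by
  rcases abs_cases (x 0) with ⟨h0, -⟩ | ⟨h0, -⟩ <;> rcases abs_cases (x 1) with ⟨h1, -⟩ | ⟨h1, -⟩ <;>
  rcases abs_cases (x 2) with ⟨h2, -⟩ | ⟨h2, -⟩ <;> rcases abs_cases (x 3) with ⟨h3, -⟩ | ⟨h3, -⟩ <;>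
  rw [h0, h1, h2, h3]
  · exact ⟨16, by simp [lor, idealVertex]; ring⟩
  · exact ⟨15, by simp [lor, idealVertex]; ring⟩
  · exact ⟨14, by simp [lor, idealVertex]; ring⟩
  · exact ⟨13, by simp [lor, idealVertex]; ring⟩
  · exact ⟨12, by simp [lor, idealVertex]; ring⟩
  · exact ⟨11, by simp [lor, idealVertex]; ring⟩
  · exact ⟨10, by simp [lor, idealVertex]; ring⟩
  · exact ⟨9, by simp [lor, idealVertex]; ring⟩
  · exact ⟨8, by simp [lor, idealVertex]; ring⟩
  · exact ⟨7, by simp [lor, idealVertex]; ring⟩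
  · exact ⟨6, by simp [lor, idealVertex]; ring⟩
  · exact ⟨5, by simp [lor, idealVertex]; ring⟩
  · exact ⟨4, by simp [lor, idealVertex]; ring⟩
  · exact ⟨3, by simp [lor, idealVertex]; ring⟩
  · exact ⟨2, by simp [lor, idealVertex]; ring⟩
  · exact ⟨1, by simp [lor, idealVertex]; ring⟩

theorem exists_axis_vertex (x : Fin 5 → ℝ) {k : Fin 5} (hk : k ≠ 4) :
    ∃ a, -lor x (idealVertex a) = x 4 - |x k| := by
  have : k = 0 ∨ k = 1 ∨ k = 2 ∨ k = 3 := by revert k; decide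
  rcases this with rfl | rfl | rfl | rfl
  · rcases abs_cases (x 0) with ⟨h, -⟩ | ⟨h, -⟩ <;> rw [h]
    · exact ⟨17, by simp [lor, idealVertex]⟩
    · exact ⟨18, by simp [lor, idealVertex]⟩
  · rcases abs_cases (x 1) with ⟨h, -⟩ | ⟨h, -⟩ <;> rw [h]
    · exact ⟨19, by simp [lor, idealVertex]⟩
    · exact ⟨20, by simp [lor, idealVertex]⟩
  · rcases abs_cases (x 2) with ⟨h, -⟩ | ⟨h, -⟩ <;> rw [h]
    · exact ⟨21, by simp [lor, idealVertex]⟩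
    · exact ⟨22, by simp [lor, idealVertex]⟩
  · rcases abs_cases (x 3) with ⟨h, -⟩ | ⟨h, -⟩ <;> rw [h]
    · exact ⟨23, by simp [lor, idealVertex]⟩
    · exact ⟨0, by simp [lor, idealVertex]⟩

/-- In the 24-cell, the spatial part of a vector is bounded in terms of the distances to the
ideal vertices. -/
theorem sq_sum_le_of_vertex {x : Fin 5 → ℝ} {d : ℝ} (h : ∀ i, lor x (sideNormal i) ≤ 0)
    (hd : ∀ a, d ≤ -lor x (idealVertex a)) :
    x 0 ^ 2 + x 1 ^ 2 + x 2 ^ 2 + x 3 ^ 2 ≤ x 4 * (x 4 - d) := by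
  obtain ⟨h01, h02, h12, h03, h13, h23⟩ := abs_add_abs_le h
  obtain ⟨a, ha⟩ := exists_half_vertex x
  have hs := hd a
  rw [ha] at hs
  have hk : ∀ k : Fin 5, k ≠ 4 → |x k| ≤ x 4 - d := by
    intro k hk
    obtain ⟨b, hb⟩ := exists_axis_vertex x hk
    have := hd b
    rw [hb] at this
    linarith
  have k0 := hk 0 (by decide)
  have k1 := hk 1 (by decide)
  have k2 := hk 2 (by decide)
  have k3 := hk 3 (by decide)
  rw [← sq_abs (x 0), ← sq_abs (x 1), ← sq_abs (x 2), ← sq_abs (x 3)]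
  have a0 := abs_nonneg (x 0)
  have a1 := abs_nonneg (x 1)
  have a2 := abs_nonneg (x 2)
  have a3 := abs_nonneg (x 3)
  by_cases c0 : |x 1| ≤ |x 0| ∧ |x 2| ≤ |x 0| ∧ |x 3| ≤ |x 0|
  · linarith [sq_sum_le_of_max a1 a3 a2 c0.1 c0.2.1 c0.2.2 h01 h02 h03 k0 (by linarith)]
  by_cases c1 : |x 0| ≤ |x 1| ∧ |x 2| ≤ |x 1| ∧ |x 3| ≤ |x 1|
  · linarith [sq_sum_le_of_max (p := |x 1|) (t := x 4) (m := x 4 - d) a0 a3 a2 c1.1 c1.2.1 c1.2.2 (by linarith) h12 h13 k1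
      (by linarith)]
  by_cases c2 : |x 0| ≤ |x 2| ∧ |x 1| ≤ |x 2| ∧ |x 3| ≤ |x 2|
  · linarith [sq_sum_le_of_max (p := |x 2|) (t := x 4) (m := x 4 - d) a0 a3 a1 c2.1 c2.2.1 c2.2.2 (by linarith) (by linarith)
      h23 k2 (by linarith)]
  have c3 : |x 0| ≤ |x 3| ∧ |x 1| ≤ |x 3| ∧ |x 2| ≤ |x 3| := by grind
  linarith [sq_sum_le_of_max (p := |x 3|) (t := x 4) (m := x 4 - d) a0 a2 a1 c3.1 c3.2.1 c3.2.2 (by linarith) (by linarith)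
      (by linarith) k3 (by linarith)]

/-- A light-like vector in the cone over the 24-cell is proportional to an ideal vertex. -/
theorem exists_eq_smul_vertex {u : Fin 5 → ℝ} (hu : u ∈ lightCone)
    (h : ∀ i, lor u (sideNormal i) ≤ 0) : ∃ a, u = u 4 • idealVertex a := by
  by_contra! hne
  have hpos : ∀ a, 0 < -lor u (idealVertex a) := by
    intro a
    have h1 := lor_light_nonpos (vertex_mem_lightCone a) hu
    rcases h1.lt_or_eq with h2 | h2
    · rw [lor_comm] at h2; linarith
    · have := lightCone_eq_smul (vertex_mem_lightCone a) hu h2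
      rw [vertex_four, div_one] at this
      exact absurd this (hne a)
  obtain ⟨a, -, ha⟩ := Finset.exists_min_image Finset.univ (fun a => -lor u (idealVertex a))
    ⟨0, Finset.mem_univ _⟩
  -- With `d > 0` the least of the finitely many products, this bounds the spatial square by `u₅ (u₅
  -- - d) < u₅²`, impossible for a light-like vector.
  have h1 := sq_sum_le_of_vertex h (fun b => ha b (Finset.mem_univ b))
  have h2 := hu.1
  rw [lor_self] at h2
  nlinarith [mul_pos hu.2 (hpos a)]

/-- The complement in `Q` of the horoballs of height `1/2` at the ideal vertices is bounded. -/
theorem four_le_two_of_core {x : H4} (hx : x ∈ Q)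
    (h : ∀ a, 1 / 2 ≤ -lor x.1 (idealVertex a)) : x.1 4 ≤ 2 := by
  have h1 := sq_sum_le_of_vertex hx h
  have h2 := x.lor_self
  rw [lor_self] at h2
  nlinarith

theorem base_mem_Q : base ∈ Q := by
  intro i
  simp only [base, lor_e5_left, side_four]
  norm_num

/-! ### The action of the side-pairing transformations on normal vectors and ideal vertices -/

/-- Multiplying `x d ≤ 1` and `x d' ≤ 1` and using `d d' ≥ 1` gives `x ≤ 1` for `x = c` and `x =
c'`; then `c c' ≥ 1` forces equality. The numbers are the scale factors by which a map stretches the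
four vertices of a square. -/
theorem eq_one_of_square {c c' d d' : ℝ} (hc : 0 < c) (hc' : 0 < c') (hd : 0 < d) (hd' : 0 < d')
    (h1 : 1 ≤ c * c') (h2 : 1 ≤ d * d') (h3 : c * d ≤ 1) (h4 : c * d' ≤ 1) (h5 : c' * d ≤ 1)
    (h6 : c' * d' ≤ 1) : c = 1 := by
  have key : ∀ {x : ℝ}, 0 < x → x * d ≤ 1 → x * d' ≤ 1 → x ≤ 1 := by
    intro x hx h h'
    have h7 := mul_le_one₀ h (mul_pos hx hd').le h'
    have h8 : x ^ 2 * 1 ≤ x ^ 2 * (d * d') := mul_le_mul_of_nonneg_left h2 (sq_nonneg x)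
    nlinarith
  have h7 := key hc h3 h4
  have h8 := key hc' h5 h6
  nlinarith

namespace SidePairing

variable (Φ : SidePairing)

/-- `g (partner i)` is inverse to `g i`, so the sides `i` and `partner (partner i)` coincide as
sets. A side determines its index, because its centre, the normalization of `sideNormal i + e5`,
lies on no other side. -/
theorem partner_partner (i : Fin 24) : Φ.partner (Φ.partner i) = i := by
  have h1 := Φ.smul_side (Φ.partner i)
  rw [Φ.g_partner, ← Φ.smul_side i, inv_smul_smul] at h1
  by_contra hne
  obtain ⟨a, ha⟩ : ∃ x : H4, x ∈ side i ∧ x ∉ side (Φ.partner (Φ.partner i)) := by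
    have hz : lor (sideNormal i + e5) (sideNormal i + e5) = -2 := by
      simp only [lor_add_left, lor_add_right, lor_side_self, lor_e5_left, lor_e5_right, side_four,
        Pi.add_apply, e5_four]
      norm_num
    have hz4 : (sideNormal i + e5) 4 = 2 := by
      simp only [Pi.add_apply, side_four, e5_four]; norm_num
    have hz' : lor (sideNormal i + e5) (sideNormal i + e5) < 0 := by rw [hz]; norm_num
    have hpos := inv_sqrt_pos hz'
    have hi : lor (sideNormal i + e5) (sideNormal i) = 0 := by
      rw [lor_add_left, lor_side_self, lor_e5_left, side_four]; norm_num
    have hk : ∀ k, i ≠ k → lor (sideNormal i + e5) (sideNormal k) ≤ -1 := by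
      intro k hk
      rw [lor_add_left, lor_e5_left, side_four]
      rcases lor_side_of_ne hk with h | h <;> linarith
    refine ⟨normalize (sideNormal i + e5) hz' (by rw [hz4]; norm_num), ⟨fun k => ?_, ?_⟩, ?_⟩
    · rw [normalize_val, lor_smul_left]
      by_cases h : i = k
      · subst h; rw [hi, mul_zero]
      · exact mul_nonpos_of_nonneg_of_nonpos hpos.le (by linarith [hk k h])
    · rw [normalize_val, lor_smul_left, hi, mul_zero]
    · rintro ⟨-, h⟩
      rw [normalize_val, lor_smul_left] at h
      have := hk _ (Ne.symm hne)
      rcases mul_eq_zero.mp h with h | h <;> linarith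
  exact ha.2 (h1 ▸ ha.1)

theorem g_inv_apply (i : Fin 24) (x : Fin 5 → ℝ) : ((Φ.g i)⁻¹).1 x = (Φ.g (Φ.partner i)).1 x := by
  rw [Φ.g_partner]

theorem g_mem (i : Fin 24) : Φ.g i ∈ Φ.group := Subgroup.subset_closure ⟨i, rfl⟩

theorem lor_map_cone {i : Fin 24} {z : Fin 5 → ℝ} (hz : lor z z < 0) (hz4 : 0 < z 4)
    (hQ : ∀ k, lor z (sideNormal k) ≤ 0) (hi : lor z (sideNormal i) = 0) :
    (∀ k, lor ((Φ.g i).1 z) (sideNormal k) ≤ 0) ∧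
      lor ((Φ.g i).1 z) (sideNormal (Φ.partner i)) = 0 := by
  have hpos := inv_sqrt_pos hz
  have hmem : normalize z hz hz4 ∈ side i := by
    refine ⟨fun k => ?_, ?_⟩
    · rw [normalize_val, lor_smul_left]
      exact mul_nonpos_of_nonneg_of_nonpos hpos.le (hQ k)
    · rw [normalize_val, lor_smul_left, hi, mul_zero]
  have h := Set.smul_mem_smul_set (a := Φ.g i) hmem
  rw [Φ.smul_side] at h
  obtain ⟨h1, h2⟩ := h
  rw [coe_smul, normalize_val, map_smul, lor_smul_left] at h2
  refine ⟨fun k => ?_, (mul_eq_zero.mp h2).resolve_left hpos.ne'⟩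
  have := h1 k
  rw [coe_smul, normalize_val, map_smul, lor_smul_left] at this
  exact nonpos_of_mul_nonpos_right this hpos

/-- The points `sideNormal i + e5 + t v` run inside the cone over the side towards `v`. Their images
stay in the cone over the partner side, so the image of `v` lies in the closed cone and is a
multiple of an ideal vertex. -/
theorem exists_map_vertex_smul {i a : Fin 24} (ha : lor (idealVertex a) (sideNormal i) = 0) :
    ∃ b, ∃ c : ℝ, 0 < c ∧ (Φ.g i).1 (idealVertex a) = c • idealVertex b ∧
      lor (idealVertex b) (sideNormal (Φ.partner i)) = 0 := by
  have hp : lor (sideNormal i + e5) (sideNormal i + e5) = -2 := by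
    simp only [lor_add_left, lor_add_right, lor_side_self, lor_e5_left, lor_e5_right, side_four,
      Pi.add_apply, e5_four]
    norm_num
  have hpa : lor (sideNormal i + e5) (idealVertex a) = -1 := by
    rw [lor_add_left, lor_comm, ha, lor_e5_left, vertex_four]; norm_num
  have hcone : ∀ t : ℝ, 0 < t → (∀ k, lor ((Φ.g i).1 (sideNormal i + e5 + t • idealVertex a))
      (sideNormal k) ≤ 0) ∧ lor ((Φ.g i).1 (sideNormal i + e5 + t • idealVertex a))
        (sideNormal (Φ.partner i)) = 0 := by
    intro t ht
    apply Φ.lor_map_cone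
    · rw [lor_add_left (sideNormal i + e5), lor_add_right (sideNormal i + e5),
        lor_add_right (_ • _), hp, lor_smul_left, lor_smul_right,
        lor_smul_right, lor_smul_left, lor_comm (idealVertex a), hpa, (vertex_mem_lightCone a).1]
      linarith
    · simp only [Pi.add_apply, Pi.smul_apply, side_four, e5_four, vertex_four, smul_eq_mul]
      linarith
    · intro k
      rw [lor_add_left, lor_add_left, lor_smul_left, lor_e5_left, side_four]
      have h1 := mul_nonpos_of_nonneg_of_nonpos ht.le (lor_vertex_side_nonpos a k)
      have h2 : lor (sideNormal i) (sideNormal k) ≤ 1 := by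
        by_cases h : i = k
        · rw [h, lor_side_self]
        · rcases lor_side_of_ne h with h | h <;> linarith
      linarith
    · rw [lor_add_left, lor_add_left, lor_smul_left, lor_e5_left, side_four, ha, lor_side_self]
      norm_num
  set u := (Φ.g i).1 (idealVertex a) with hu
  have huL : u ∈ lightCone := val_mem_lightCone _ (vertex_mem_lightCone a)
  simp only [map_add (Φ.g i).1 _ (_ • _), map_smul, ← hu, lor_add_left _ (_ • _), lor_smul_left]
    at hcone
  obtain ⟨b, hb⟩ := exists_eq_smul_vertex huL (by
    intro k
    by_contra! hk
    set A := lor ((Φ.g i).1 (sideNormal i + e5)) (sideNormal k)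
    set B := lor u (sideNormal k)
    -- This `t` makes `A + t B = A + |A| + 1 > 0`.
    have h1 := (hcone ((|A| + 1) / B) (by positivity)).1 k
    rw [div_mul_cancel₀ _ hk.ne'] at h1
    linarith [neg_abs_le A])
  have h0 : lor u (sideNormal (Φ.partner i)) = 0 := by
    have h1 := (hcone 1 one_pos).2
    have h2 := (hcone 2 two_pos).2
    linarith
  refine ⟨b, u 4, huL.2, hb, ?_⟩
  rw [hb, lor_smul_left] at h0
  exact (mul_eq_zero.mp h0).resolve_left huL.2.ne'

/-- The side-pairing transformation `g i` maps the ideal vertices of the `i`-th side, with their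
normalization, to ideal vertices of the partner side. -/
theorem exists_map_vertex {i a : Fin 24} (ha : lor (idealVertex a) (sideNormal i) = 0) :
    ∃ b, (Φ.g i).1 (idealVertex a) = idealVertex b ∧
      lor (idealVertex b) (sideNormal (Φ.partner i)) = 0 := by
  obtain ⟨a', b, b', ha', hb, hb', h1, h2, h3, h4, h5, h6⟩ := exists_square ha
  obtain ⟨p, c, hc, ep, hp⟩ := Φ.exists_map_vertex_smul ha
  obtain ⟨p', c', hc', ep', hp'⟩ := Φ.exists_map_vertex_smul ha'
  obtain ⟨q, d, hd, eq, hq⟩ := Φ.exists_map_vertex_smul hb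
  obtain ⟨q', d', hd', eq', hq'⟩ := Φ.exists_map_vertex_smul hb'
  -- Vertices of one side have product `-1/2` or `-1`. Whichever occurs for the images, opposite
  -- vertices get scale factors with product at least 1, and adjacent ones with product at most 1.
  have key : ∀ {x y : Fin 24} {s t : ℝ}, 0 < s → 0 < t →
      lor (idealVertex x) (sideNormal (Φ.partner i)) = 0 →
      lor (idealVertex y) (sideNormal (Φ.partner i)) = 0 →
      lor (s • idealVertex x) (t • idealVertex y) < 0 →
      1 / 2 * (s * t) ≤ -lor (s • idealVertex x) (t • idealVertex y) ∧
        -lor (s • idealVertex x) (t • idealVertex y) ≤ s * t := by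
    intro x y s t hs ht hx hy hneg
    have hst := mul_pos hs ht
    rw [lor_smul_left, lor_smul_right, ← mul_assoc] at hneg ⊢
    have hxy : x ≠ y := by
      rintro rfl
      rw [(vertex_mem_lightCone x).1, mul_zero] at hneg
      exact lt_irrefl _ hneg
    rcases lor_vertex_in_side hx hy hxy with h | ⟨h, -⟩ <;> rw [h] <;> constructor <;> linarith
  rw [← lor_val (Φ.g i), ep, ep'] at h1
  rw [← lor_val (Φ.g i), eq, eq'] at h2
  rw [← lor_val (Φ.g i), ep, eq] at h3
  rw [← lor_val (Φ.g i), ep, eq'] at h4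
  rw [← lor_val (Φ.g i), ep', eq] at h5
  rw [← lor_val (Φ.g i), ep', eq'] at h6
  have k1 := (key hc hc' hp hp' (by rw [h1]; norm_num)).2
  have k2 := (key hd hd' hq hq' (by rw [h2]; norm_num)).2
  have k3 := (key hc hd hp hq (by rw [h3]; norm_num)).1
  have k4 := (key hc hd' hp hq' (by rw [h4]; norm_num)).1
  have k5 := (key hc' hd hp' hq (by rw [h5]; norm_num)).1
  have k6 := (key hc' hd' hp' hq' (by rw [h6]; norm_num)).1
  rw [h1] at k1
  rw [h2] at k2
  rw [h3] at k3
  rw [h4] at k4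
  rw [h5] at k5
  rw [h6] at k6
  have e7 : c = 1 := eq_one_of_square hc hc' hd hd' (by linarith) (by linarith) (by linarith)
    (by linarith) (by linarith) (by linarith)
  exact ⟨p, by rw [ep, e7, one_smul], hp⟩

/-- `sideNormal i + e5` is the sum of two opposite vertices of the octahedral side, and opposite
vertices go to opposite vertices because their product `-1` is preserved. -/
theorem g_side_add_e5 (i : Fin 24) :
    (Φ.g i).1 (sideNormal i + e5) = sideNormal (Φ.partner i) + e5 := by
  obtain ⟨a, ha⟩ := exists_vertex_of_side i
  obtain ⟨a', b, b', ha', -, -, h1, -⟩ := exists_square ha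
  have hne : a ≠ a' := by
    rintro rfl
    rw [(vertex_mem_lightCone a).1] at h1
    norm_num at h1
  rcases lor_vertex_in_side ha ha' hne with h | ⟨-, h⟩
  · rw [h] at h1; norm_num at h1
  obtain ⟨p, hp, hpi⟩ := Φ.exists_map_vertex ha
  obtain ⟨p', hp', hpi'⟩ := Φ.exists_map_vertex ha'
  rw [← h, map_add, hp, hp']
  rw [← lor_val (Φ.g i), hp, hp'] at h1
  have hne' : p ≠ p' := by
    rintro rfl
    rw [(vertex_mem_lightCone p).1] at h1
    norm_num at h1
  rcases lor_vertex_in_side hpi hpi' hne' with h2 | ⟨-, h2⟩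
  · rw [h2] at h1; norm_num at h1
  · exact h2

/-- The image `w` of the normal is orthogonal to the centre direction `p` of the partner side.
Moving from `p` within that side and pulling back shows that the part `z` of `w` tangent to the side
is orthogonal to `w`, so `z = 0` and `w` is plus or minus the normal. The condition on `Q ∩ g i • Q`
selects the minus sign. -/
theorem g_side (i : Fin 24) : (Φ.g i).1 (sideNormal i) = -sideNormal (Φ.partner i) := by
  set j := Φ.partner i with hj
  set w := (Φ.g i).1 (sideNormal i) with hw
  have hpe := Φ.g_side_add_e5 i
  rw [← hj] at hpe
  set p := sideNormal j + e5 with hp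
  have hww : lor w w = 1 := by rw [hw, lor_val, lor_side_self]
  have hpp : lor p p = -2 := by
    simp only [hp, lor_add_left, lor_add_right, lor_side_self, lor_e5_left, lor_e5_right,
      side_four, Pi.add_apply, e5_four]
    norm_num
  have hpw : lor p w = 0 := by
    rw [← hpe, hw, lor_val, lor_add_left, lor_side_self, lor_e5_left, side_four]; norm_num
  have hps : lor p (sideNormal j) = 0 := by
    rw [hp, lor_add_left, lor_side_self, lor_e5_left, side_four]; norm_num
  have hpk : ∀ k, k ≠ j → lor p (sideNormal k) ≤ -1 := by
    intro k hk
    rw [hp, lor_add_left, lor_e5_left, side_four]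
    rcases lor_side_of_ne hk.symm with h | h <;> linarith
  set c := lor w (sideNormal j) with hc
  set z := w - c • sideNormal j with hz
  have hpz : lor p z = 0 := by rw [hz, lor_sub_right, lor_smul_right, hpw, hps]; ring
  have hzj : lor z (sideNormal j) = 0 := by
    rw [hz, lor_sub_left, lor_smul_left, lor_side_self, ← hc]; ring
  have hzz : lor z z = 1 - c ^ 2 := by
    simp only [hz, lor_sub_left, lor_sub_right, lor_smul_left, lor_smul_right, lor_side_self, hww,
      lor_comm _ w, ← hc]
    ring
  have hwz : lor w z = 0 := by
    -- Small enough for `p + ε z` to remain in the cone over the side: the other normals have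
    -- product at most `-1` with `p`.
    set ε : ℝ := 1 / (1 + ∑ k, |lor z (sideNormal k)|) with hε
    have hsum : 0 ≤ ∑ k, |lor z (sideNormal k)| := Finset.sum_nonneg fun _ _ => abs_nonneg _
    have hε0 : 0 < ε := by positivity
    have hε1 : ε ≤ 1 := by
      rw [hε, div_le_one (by positivity)]; linarith
    have hεk : ∀ k, ε * lor z (sideNormal k) ≤ 1 := by
      intro k
      rw [hε, one_div_mul_eq_div, div_le_one (by positivity)]
      have h1 := Finset.single_le_sum (f := fun k => |lor z (sideNormal k)|)
        (fun _ _ => abs_nonneg _) (Finset.mem_univ k)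
      have h2 := le_abs_self (lor z (sideNormal k))
      linarith
    have hn : lor (p + ε • z) (p + ε • z) < 0 := by
      simp only [lor_add_left, lor_add_right, lor_smul_left, lor_smul_right, hpp, hpz,
        lor_comm z p, hzz]
      have : ε * ε ≤ 1 := by nlinarith
      nlinarith [mul_nonneg (mul_nonneg hε0.le hε0.le) (sq_nonneg c)]
    have h4 : 0 < (p + ε • z) 4 := by
      refine future_of_lor_neg (x := p) (by rw [hpp]; norm_num) ?_ hn.le ?_
      · simp only [hp, Pi.add_apply, side_four, e5_four]; norm_num
      · rw [lor_add_right, lor_smul_right, hpp, hpz]; norm_num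
    have h := (Φ.lor_map_cone (i := j) hn h4 (by
      intro k
      rw [lor_add_left, lor_smul_left]
      by_cases hk : k = j
      · rw [hk, hps, hzj]; norm_num
      · linarith [hpk k hk, hεk k]) (by
      rw [lor_add_left, lor_smul_left, hps, hzj]; ring)).2
    rw [hj, Φ.partner_partner, Φ.g_partner, lor_inv_left, ← hw, lor_add_left, lor_smul_left, hpw,
      zero_add] at h
    rw [lor_comm]
    exact (mul_eq_zero.mp h).resolve_left hε0.ne'
  have hc2 : c ^ 2 = 1 := by
    rw [hz, lor_sub_right, lor_smul_right, hww, ← hc] at hwz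
    linarith
  have hz0 : z = 0 := eq_zero_of_orth (by rw [hpp]; norm_num) hpz (by rw [hzz, hc2]; norm_num)
  have hwc : w = c • sideNormal j := sub_eq_zero.mp (hz ▸ hz0)
  rcases sq_eq_one_iff.mp hc2 with h1 | h1
  -- With the plus sign the map would fix the centre of `Q`, which would then lie in `Q ∩ g i • Q`,
  -- hence on a side.
  · exfalso
    rw [h1, one_smul] at hwc
    have he : (Φ.g i).1 e5 = e5 := by
      rw [map_add, ← hw, hwc] at hpe
      exact add_left_cancel hpe
    have hmem : base ∈ Q ∩ Φ.g i • Q := by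
      refine ⟨base_mem_Q, ?_⟩
      have : Φ.g i • base = base := H4.ext he
      exact this ▸ Set.smul_mem_smul_set base_mem_Q
    rw [Φ.inter] at hmem
    have := hmem.2
    simp only [base, lor_e5_left, side_four] at this
    norm_num at this
  · rw [hwc, h1, neg_one_smul]

theorem g_e5 (i : Fin 24) : (Φ.g i).1 e5 = e5 + (2 : ℝ) • sideNormal (Φ.partner i) := by
  have h := Φ.g_side_add_e5 i
  rw [map_add, Φ.g_side] at h
  have : (Φ.g i).1 e5 = sideNormal (Φ.partner i) + e5 + sideNormal (Φ.partner i) := by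
    rw [← h]; abel
  rw [this]; module

/-- A side-pairing transformation moves the points beyond its side closer to the centre. -/
theorem g_four (i : Fin 24) (y : Fin 5 → ℝ) :
    ((Φ.g i).1 y) 4 = y 4 - 2 * lor y (sideNormal i) := by
  have h : ((Φ.g i).1 y) 4 = -lor ((Φ.g i).1 y) e5 := by rw [lor_e5_right, neg_neg]
  rw [h, lor_val_left, g_inv_apply, Φ.g_e5, Φ.partner_partner, lor_add_right, lor_smul_right,
    lor_e5_right]
  ring

end SidePairing

/-! ### Symmetries of the 24-cell and reflections in its sides -/

/-- A linear automorphism that preserves the Lorentzian inner product and keeps the centre of the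
24-cell in the future is a positive Lorentz transformation. -/
def mkLorentz (f : (Fin 5 → ℝ) ≃ₗ[ℝ] (Fin 5 → ℝ)) (h : ∀ x y, lor (f x) (f y) = lor x y)
    (h4 : 0 < f e5 4) : posLorentz :=
  ⟨f, h, fun x hx hx4 => by
    refine future_of_lor_neg (x := f e5) (by rw [h, lor_e5_e5]; norm_num) h4
      (by rw [h, hx]; norm_num) ?_
    rw [h, lor_e5_left]
    linarith⟩

/-- The reflection in the hyperplane of a side. -/
def reflLin (i : Fin 24) : (Fin 5 → ℝ) →ₗ[ℝ] (Fin 5 → ℝ) where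
  toFun x := x - (2 * lor x (sideNormal i)) • sideNormal i
  map_add' x y := by rw [lor_add_left]; module
  map_smul' c x := by rw [lor_smul_left, RingHom.id_apply]; module

theorem reflLin_apply (i : Fin 24) (x : Fin 5 → ℝ) :
    reflLin i x = x - (2 * lor x (sideNormal i)) • sideNormal i := rfl

theorem reflLin_involutive (i : Fin 24) : Function.Involutive (reflLin i) := by
  intro x
  simp only [reflLin_apply, lor_sub_left, lor_smul_left, lor_side_self]
  module

/-- The reflection in a side of the 24-cell. -/
def refl (i : Fin 24) : posLorentz :=
  mkLorentz (LinearEquiv.ofInvolutive (reflLin i) (reflLin_involutive i))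
    (fun x y => by
      simp only [LinearEquiv.coe_ofInvolutive, reflLin_apply, lor_sub_left, lor_sub_right,
        lor_smul_left, lor_smul_right, lor_side_self, lor_comm (sideNormal i)]
      ring)
    (by
      simp only [LinearEquiv.coe_ofInvolutive, reflLin_apply, lor_e5_left, side_four, Pi.sub_apply,
        Pi.smul_apply, e5_four, smul_eq_mul]
      norm_num)

theorem refl_apply (i : Fin 24) (x : Fin 5 → ℝ) :
    (refl i).1 x = x - (2 * lor x (sideNormal i)) • sideNormal i := rfl

theorem refl_mul_self (i : Fin 24) : refl i * refl i = 1 :=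
  posLorentz_ext fun x => reflLin_involutive i x

theorem refl_apply_of_orth {i : Fin 24} {x : Fin 5 → ℝ} (h : lor x (sideNormal i) = 0) :
    (refl i).1 x = x := by rw [refl_apply, h]; module

theorem refl_side (i : Fin 24) : (refl i).1 (sideNormal i) = -sideNormal i := by
  rw [refl_apply, lor_side_self]; module

/-- Twice the image of the basis vector `e_a` under the symmetry that induces the permutation `π`
of the sides. -/
def symCol (π : Fin 24 → Fin 24) (a : Fin 4) (k : Fin 5) : ℤ :=
  sideInt (π (if a = 0 then 1 else if a = 1 then 1 else if a = 2 then 5 else 13)) k -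
    sideInt (π (if a = 0 then 2 else if a = 1 then 3 else if a = 2 then 7 else 15)) k

/-- The permutation `π` of the sides is induced by a symmetry of the 24-cell. -/
def IsSym (π : Fin 24 → Fin 24) : Prop :=
  (∀ a b, lorZ (symCol π a) (symCol π b) = if a = b then 4 else 0) ∧ (∀ a, symCol π a 4 = 0) ∧
    ∀ j k, sideInt j 0 * symCol π 0 k + sideInt j 1 * symCol π 1 k + sideInt j 2 * symCol π 2 k +
      sideInt j 3 * symCol π 3 k + (if k = 4 then 2 else 0) = 2 * sideInt (π j) k

instance (π : Fin 24 → Fin 24) : Decidable (IsSym π) := by unfold IsSym; infer_instance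

/-- The linear map that induces the permutation `π` of the sides. -/
def symLin (π : Fin 24 → Fin 24) : (Fin 5 → ℝ) →ₗ[ℝ] (Fin 5 → ℝ) where
  toFun x k := (x 0 * symCol π 0 k + x 1 * symCol π 1 k + x 2 * symCol π 2 k +
    x 3 * symCol π 3 k) / 2 + (if k = 4 then x 4 else 0)
  map_add' x y := by
    ext k
    simp only [Pi.add_apply]
    split_ifs <;> ring
  map_smul' c x := by
    ext k
    simp only [Pi.smul_apply, smul_eq_mul, RingHom.id_apply]
    split_ifs <;> ring

theorem symLin_apply (π : Fin 24 → Fin 24) (x : Fin 5 → ℝ) (k : Fin 5) :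
    symLin π x k = (x 0 * symCol π 0 k + x 1 * symCol π 1 k + x 2 * symCol π 2 k +
    x 3 * symCol π 3 k) / 2 + (if k = 4 then x 4 else 0) := rfl

theorem symLin_lor {π : Fin 24 → Fin 24} (h : IsSym π) (x y : Fin 5 → ℝ) :
    lor (symLin π x) (symLin π y) = lor x y := by
  have H : ∀ a b, ((lorZ (symCol π a) (symCol π b) : ℤ) : ℝ) = if a = b then 4 else 0 := by
    intro a b
    rw [h.1 a b]; split_ifs <;> norm_num
  have H4 : ∀ a, (symCol π a 4 : ℝ) = 0 := fun a => by rw [h.2.1 a]; norm_num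
  have key : lor (symLin π x) (symLin π y) =
      (∑ a : Fin 4, ∑ b : Fin 4, x a.castSucc * y b.castSucc * (lorZ (symCol π a) (symCol π b) : ℤ)) / 4
        - x 4 * y 4 := by
    simp only [Fin.sum_univ_four, lor, lorZ, symLin_apply, H4, show (0 : Fin 5) ≠ 4 by decide,
      show (1 : Fin 5) ≠ 4 by decide, show (2 : Fin 5) ≠ 4 by decide, show (3 : Fin 5) ≠ 4 by decide,
      if_true, if_false]
    push_cast
    simp only [H4]
    ring
  rw [key]
  simp only [H, Fin.sum_univ_four, lor]
  simp [show Fin.castSucc (1 : Fin 4) = 1 by rfl,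
      show Fin.castSucc (2 : Fin 4) = 2 by rfl, show Fin.castSucc (3 : Fin 4) = 3 by rfl]
  ring

theorem symLin_side {π : Fin 24 → Fin 24} (h : IsSym π) (j : Fin 24) :
    symLin π (sideNormal j) = sideNormal (π j) := by
  ext k
  have := h.2.2 j k
  have h2 : ((sideInt j 0 * symCol π 0 k + sideInt j 1 * symCol π 1 k + sideInt j 2 * symCol π 2 k +
      sideInt j 3 * symCol π 3 k + (if k = 4 then 2 else 0) : ℤ) : ℝ) =
      ((2 * sideInt (π j) k : ℤ) : ℝ) := by rw [this]
  rw [symLin_apply, side_four]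
  simp only [sideNormal_apply]
  push_cast at h2
  split_ifs at h2 ⊢ <;> linarith

theorem symLin_e5 (π : Fin 24 → Fin 24) : symLin π e5 = e5 := by
  ext k
  rw [symLin_apply]
  fin_cases k <;> simp [e5]

theorem symLin_injective {π : Fin 24 → Fin 24} (h : IsSym π) : Function.Injective (symLin π) := by
  rw [← LinearMap.ker_eq_bot, LinearMap.ker_eq_bot']
  intro x hx
  apply eq_zero_of_lor_eq_zero
  intro y
  rw [← symLin_lor h, hx, lor_zero_left]

/-- The symmetry of the 24-cell that induces the permutation `π` of the sides. -/
def sym (π : Fin 24 → Fin 24) (h : IsSym π) : posLorentz :=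
  mkLorentz (LinearEquiv.ofInjectiveEndo (symLin π) (symLin_injective h))
    (fun x y => symLin_lor h x y)
    (by
      have : (LinearEquiv.ofInjectiveEndo (symLin π) (symLin_injective h)) e5 = e5 := symLin_e5 π
      rw [this, e5_four]; norm_num)

theorem sym_apply {π : Fin 24 → Fin 24} (h : IsSym π) (x : Fin 5 → ℝ) :
    (sym π h).1 x = symLin π x := rfl

theorem sym_side {π : Fin 24 → Fin 24} (h : IsSym π) (j : Fin 24) :
    (sym π h).1 (sideNormal j) = sideNormal (π j) := symLin_side h j

theorem sym_e5 {π : Fin 24 → Fin 24} (h : IsSym π) : (sym π h).1 e5 = e5 := symLin_e5 π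

theorem side_injective : Function.Injective sideNormal := by
  intro i j h
  by_contra hne
  have h1 := lor_side_self i
  rcases lor_side_of_ne hne with h2 | h2 <;> rw [← h, h1] at h2 <;> norm_num at h2

theorem IsSym.bijective {π : Fin 24 → Fin 24} (h : IsSym π) : Function.Bijective π := by
  rw [← Finite.injective_iff_bijective]
  intro i j hij
  apply side_injective
  apply symLin_injective h
  rw [symLin_side h, symLin_side h, hij]

theorem sym_smul_mem_Q {π : Fin 24 → Fin 24} (h : IsSym π) {x : H4} :
    sym π h • x ∈ Q ↔ x ∈ Q := by
  have key : ∀ i, lor (sym π h • x).1 (sideNormal (π i)) = lor x.1 (sideNormal i) := by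
    intro i
    rw [coe_smul, ← sym_side h, lor_val]
  constructor
  · intro hx i
    rw [← key]; exact hx _
  · intro hx i
    obtain ⟨j, rfl⟩ := h.bijective.2 i
    rw [key]; exact hx j

/-- A permutation-valued table, packed into a natural number in base 32. -/
def permCode (N : ℕ) (i j : Fin 24) : Fin 24 :=
  Fin.ofNat 24 (N >>> (5 * (24 * i.val + j.val)) % 32)

/-- Symmetries of the 24-cell that carry the ideal vertex `e₁ + e₅` to the given one. -/
def framePerm : Fin 24 → Fin 24 → Fin 24 := permCode
  327448527380164370399023851006344493942907865279458419573969667733750560877856938239076984375272030200818390543427002731071262189731107911568772692422511889230058633535080758540844916921319928081550817171412948986309950056412125367410965194414819908098407341829244927374998540502761605883506829600848001629204548131659834563226908643766165634079748116447752083196455013819697938841308164295520771008492895413674520673894909630598408644318591644583458035586778765481203030181574840569455520358309267851861749291369188362331974029880717030500329389416212270536548980012071730662575468299792751444394598901588811883182938391660518013894139328751809699129356626669209603711097948055854983031600094677413046564991050863921403691165556525605775925250589498575888196295762080289350085834876175372929560060319492621184498806560627283820382121629586037702694015561489235588588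

theorem framePerm_isSym (d : Fin 24) : IsSym (framePerm d) := by
  revert d; decide +kernel

/-- A symmetry of the 24-cell that carries the ideal vertex `e₁ + e₅` to the given one. -/
def frame (d : Fin 24) : posLorentz := sym (framePerm d) (framePerm_isSym d)

theorem frame_vertex (d : Fin 24) : (frame d).1 (idealVertex 17) = idealVertex d := by
  have H : ∀ d k, symCol (framePerm d) 0 k + (if k = 4 then 2 else 0) = vertexInt d k := by
    decide +kernel
  ext k
  have h := H d k
  have h2 : ((symCol (framePerm d) 0 k + (if k = 4 then 2 else 0) : ℤ) : ℝ) =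
      ((vertexInt d k : ℤ) : ℝ) := by rw [h]
  rw [idealVertex_apply, ← h2, frame, sym_apply, symLin_apply]
  simp only [idealVertex]
  simp
  split_ifs <;> ring

theorem frame_smul_mem_Q (d : Fin 24) {x : H4} : frame d • x ∈ Q ↔ x ∈ Q := sym_smul_mem_Q _

theorem frame_side (d j : Fin 24) : (frame d).1 (sideNormal j) = sideNormal (framePerm d j) :=
  sym_side _ j

/-! ### The 24-cell near an ideal vertex -/

/-- The six sides through `e₁ + e₅` cut out a cube of edge `2n` in the horosphere at level `n = y₅ -
y₁`. -/
theorem abs_le_of_sides {y : Fin 5 → ℝ}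
    (h : ∀ i, lor (idealVertex 17) (sideNormal i) = 0 → lor y (sideNormal i) ≤ 0) :
    |y 1| ≤ y 4 - y 0 ∧ |y 2| ≤ y 4 - y 0 ∧ |y 3| ≤ y 4 - y 0 := by
  have h1 := h 1 (by simp [lor, idealVertex, sideNormal])
  have h3 := h 3 (by simp [lor, idealVertex, sideNormal])
  have h5 := h 5 (by simp [lor, idealVertex, sideNormal])
  have h7 := h 7 (by simp [lor, idealVertex, sideNormal])
  have h13 := h 13 (by simp [lor, idealVertex, sideNormal])
  have h15 := h 15 (by simp [lor, idealVertex, sideNormal])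
  simp [lor, sideNormal] at h1 h3 h5 h7 h13 h15
  refine ⟨abs_le.mpr ⟨?_, ?_⟩, abs_le.mpr ⟨?_, ?_⟩, abs_le.mpr ⟨?_, ?_⟩⟩ <;> linarith

theorem neg_lor_vertex_17 (y : Fin 5 → ℝ) : -lor y (idealVertex 17) = y 4 - y 0 := by
  simp [lor, idealVertex]

theorem mul_eq_of_H4 (y : H4) :
    (y.1 4 - y.1 0) * (y.1 4 + y.1 0) = 1 + y.1 1 ^ 2 + y.1 2 ^ 2 + y.1 3 ^ 2 := by
  have := y.lor_self
  simp only [lor] at this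
  linarith

/-- The other eighteen sides impose nothing new deep in the horoball. With `n = y₅ - y₁ < 1/2` and
`m = y₅ + y₁`, the relation `n m ≥ 1` gives `m > 2 > 3n`, so `y₅ = (n + m)/2` exceeds `2n`, which
bounds the sum of two of the remaining coordinates. -/
theorem lor_neg_of_abs_lt {y : H4} (hn : y.1 4 - y.1 0 < 1 / 2)
    (h1 : |y.1 1| < y.1 4 - y.1 0) (h2 : |y.1 2| < y.1 4 - y.1 0) (h3 : |y.1 3| < y.1 4 - y.1 0)
    (i : Fin 24) : lor y.1 (sideNormal i) < 0 := by
  have h := mul_eq_of_H4 y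
  rw [abs_lt] at h1 h2 h3
  have hm : 3 * (y.1 4 - y.1 0) < y.1 4 + y.1 0 := by
    nlinarith [sq_nonneg (y.1 1), sq_nonneg (y.1 2), sq_nonneg (y.1 3)]
  fin_cases i <;> simp [lor, sideNormal] <;> linarith

theorem mem_Q_of_abs_le {y : H4} (hn : y.1 4 - y.1 0 < 1 / 2)
    (h1 : |y.1 1| ≤ y.1 4 - y.1 0) (h2 : |y.1 2| ≤ y.1 4 - y.1 0) (h3 : |y.1 3| ≤ y.1 4 - y.1 0) :
    y ∈ Q := by
  have h := mul_eq_of_H4 y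
  have hp : 0 < y.1 4 - y.1 0 := by
    have := y.lor_light_neg (vertex_mem_lightCone 17)
    rw [← neg_lor_vertex_17]; linarith
  rw [abs_le] at h1 h2 h3
  have hm : 3 * (y.1 4 - y.1 0) < y.1 4 + y.1 0 := by
    nlinarith [sq_nonneg (y.1 1), sq_nonneg (y.1 2), sq_nonneg (y.1 3)]
  intro i
  fin_cases i <;> simp [lor, sideNormal] <;> linarith

/-- Inside the horoball of height `1/2` at an ideal vertex, only the sides through that vertex
bound the 24-cell. -/
theorem mem_Q_of_vertex_sides {y : H4} {d : Fin 24} (hn : -lor y.1 (idealVertex d) < 1 / 2)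
    (h : ∀ i, lor (idealVertex d) (sideNormal i) = 0 → lor y.1 (sideNormal i) ≤ 0) : y ∈ Q := by
  set y' := (frame d)⁻¹ • y with hy'
  have hv : ∀ u, lor y'.1 u = lor y.1 ((frame d).1 u) := fun u => lor_inv_left _ _ _
  have hmem : y' ∈ Q := by
    obtain ⟨h1, h2, h3⟩ := abs_le_of_sides (y := y'.1) (by
      intro i hi
      rw [hv, frame_side]
      apply h
      rw [← frame_side, ← frame_vertex d, lor_val, hi])
    refine mem_Q_of_abs_le ?_ h1 h2 h3
    rw [← neg_lor_vertex_17, hv, frame_vertex]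
    exact hn
  rw [← smul_inv_smul (frame d) y, frame_smul_mem_Q]
  exact hmem

/-- At a fixed level the cross-section of `Q` is a compact cube; the bound comes from `n m = 1 +
|y|² ≤ 1 + 3n²`. -/
theorem four_le_of_mem_Q {y : H4} (hy : y ∈ Q) {d : Fin 24} {n : ℝ}
    (hn : -lor y.1 (idealVertex d) = n) : y.1 4 ≤ (n + (1 + 3 * n ^ 2) / n) / 2 := by
  set y' := (frame d)⁻¹ • y with hy'
  have hv : ∀ u, lor y'.1 u = lor y.1 ((frame d).1 u) := fun u => lor_inv_left _ _ _
  have h4 : y.1 4 = y'.1 4 := by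
    have := hv e5
    rw [lor_e5_right, frame, sym_e5, lor_e5_right] at this
    linarith
  have hQ : y' ∈ Q := by
    rw [← frame_smul_mem_Q d, smul_inv_smul]; exact hy
  rw [← frame_vertex, ← hv, neg_lor_vertex_17] at hn
  obtain ⟨h1, h2, h3⟩ := abs_le_of_sides (y := y'.1) fun i _ => hQ i
  have h := mul_eq_of_H4 y'
  have hp : 0 < y'.1 4 - y'.1 0 := by
    have := y'.lor_light_neg (vertex_mem_lightCone 17)
    rw [← neg_lor_vertex_17]; linarith
  rw [hn] at h1 h2 h3 h hp
  have e1 := sq_le_sq' (abs_le.mp h1).1 (abs_le.mp h1).2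
  have e2 := sq_le_sq' (abs_le.mp h2).1 (abs_le.mp h2).2
  have e3 := sq_le_sq' (abs_le.mp h3).1 (abs_le.mp h3).2
  have : y'.1 4 + y'.1 0 ≤ (1 + 3 * n ^ 2) / n := by
    rw [le_div_iff₀ hp]; linarith
  rw [h4]
  linarith

/-! ### Discrete groups of hyperbolic isometries -/

theorem chart_coords (y : H4) : chart (fun k => y.1 k.castSucc) = y := by
  apply H4.ext
  have h := y.lor_self
  rw [lor_self] at h
  have h4 : √(1 + ∑ i : Fin 4, y.1 i.castSucc ^ 2) = y.1 4 := by
    rw [Real.sqrt_eq_iff_mul_self_eq (by positivity) y.four_pos.le, Fin.sum_univ_four]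
    simp only [Fin.castSucc_zero, Fin.castSucc_one,
      show Fin.castSucc (2 : Fin 4) = 2 by rfl, show Fin.castSucc (3 : Fin 4) = 3 by rfl]
    linarith
  ext k
  simp only [chart, h4]
  fin_cases k <;> rfl

theorem continuous_chart : Continuous chart := by
  refine Continuous.subtype_mk (continuous_pi fun i => ?_) _
  fin_cases i <;> simp <;> fun_prop

theorem continuous_val : Continuous fun y : H4 => y.1 := continuous_subtype_val

theorem abs_le_four (y : H4) (k : Fin 5) : |y.1 k| ≤ y.1 4 := by
  have h := y.lor_self
  rw [lor_self] at h
  refine abs_le_of_sq_le_sq ?_ y.four_pos.le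
  fin_cases k <;> simp only [Fin.mk_zero, Fin.mk_one, Fin.reduceFinMk, Fin.isValue]
    <;> nlinarith [sq_nonneg (y.1 0), sq_nonneg (y.1 1), sq_nonneg (y.1 2), sq_nonneg (y.1 3)]

/-- Balls in `H⁴` are relatively compact. -/
theorem exists_compact_four_le (R : ℝ) :
    ∃ K : Set H4, IsCompact K ∧ ∀ y : H4, y.1 4 ≤ R → y ∈ K := by
  refine ⟨chart '' Metric.closedBall 0 R, (isCompact_closedBall 0 R).image continuous_chart, ?_⟩
  intro y hy
  refine ⟨_, ?_, chart_coords y⟩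
  rw [mem_closedBall_zero_iff, pi_norm_le_iff_of_nonneg (y.four_pos.le.trans hy)]
  intro k
  rw [Real.norm_eq_abs]
  exact (abs_le_four y _).trans hy

/-- This and `four_le_of_lor` are triangle inequalities through the centre, in the form `cosh (a +
b) ≤ 2 cosh a cosh b`; the last coordinate is the hyperbolic cosine of the distance from the centre.
-/
theorem neg_lor_le (x y : H4) : -lor x.1 y.1 ≤ 2 * (x.1 4 * y.1 4) := by
  have hc := cauchy_four x.1 y.1
  have h1 := x.lor_self
  have h2 := y.lor_self
  rw [lor_self] at h1 h2
  have h : (x.1 0 * y.1 0 + x.1 1 * y.1 1 + x.1 2 * y.1 2 + x.1 3 * y.1 3) ^ 2 ≤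
      (x.1 4 * y.1 4) ^ 2 := by
    refine hc.trans ?_
    rw [mul_pow]
    exact mul_le_mul (by linarith) (by linarith) (by positivity) (by positivity)
  have := abs_le_of_sq_le_sq h (mul_pos x.four_pos y.four_pos).le
  simp only [lor]
  linarith [(abs_le.mp this).1]

theorem four_le_of_lor (x y : H4) : x.1 4 ≤ 2 * (y.1 4 * (-lor x.1 y.1)) := by
  have h1 := x.lor_self
  have h2 := y.lor_self
  rw [lor_self] at h1 h2
  have hc := cauchy_four x.1 y.1
  set A := x.1 0 * y.1 0 + x.1 1 * y.1 1 + x.1 2 * y.1 2 + x.1 3 * y.1 3 with hA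
  have hl : lor x.1 y.1 = A - x.1 4 * y.1 4 := rfl
  have hle := x.lor_le y
  rw [hl] at hle ⊢
  have hx := x.four_pos
  have hy := y.four_pos
  have h3 : A ^ 2 ≤ (x.1 4) ^ 2 * ((y.1 4) ^ 2 - 1) := by
    refine hc.trans (mul_le_mul (by linarith) (by linarith) (by positivity) (by positivity))
  have h4 : (x.1 4) ^ 2 ≤ (x.1 4 * y.1 4 - A) * (x.1 4 * y.1 4 + A) := by nlinarith
  have h5 : x.1 4 * y.1 4 + A ≤ 2 * (x.1 4 * y.1 4) := by
    have : A ≤ x.1 4 * y.1 4 := by linarith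
    linarith
  have h6 : (x.1 4) ^ 2 ≤ (x.1 4 * y.1 4 - A) * (2 * (x.1 4 * y.1 4)) :=
    h4.trans (mul_le_mul_of_nonneg_left h5 (by linarith))
  have h7 : x.1 4 * x.1 4 ≤ x.1 4 * (2 * (y.1 4 * -(A - x.1 4 * y.1 4))) := by nlinarith
  exact le_of_mul_le_mul_left h7 hx

section Discrete

variable (Γ : Subgroup posLorentz)

theorem finite_smul_inter (hΓ : ProperlyDiscontinuousSMul Γ H4) (R S : ℝ) :
    {γ : posLorentz | γ ∈ Γ ∧ ∃ x : H4, x.1 4 ≤ R ∧ (γ • x).1 4 ≤ S}.Finite := by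
  obtain ⟨K, hK, hK'⟩ := exists_compact_four_le R
  obtain ⟨L, hL, hL'⟩ := exists_compact_four_le S
  have := (hΓ.finite_disjoint_inter_image hK hL).image (fun γ : Γ => (γ : posLorentz))
  refine this.subset ?_
  rintro γ ⟨hγ, x, hx, hx'⟩
  exact ⟨⟨γ, hγ⟩, ⟨γ • x, ⟨x, hK' x hx, rfl⟩, hL' _ hx'⟩, rfl⟩

theorem finite_orbit_le (hΓ : ProperlyDiscontinuousSMul Γ H4) (x : H4) (R : ℝ) :
    {γ : posLorentz | γ ∈ Γ ∧ (γ • x).1 4 ≤ R}.Finite :=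
  (finite_smul_inter Γ hΓ (x.1 4) R).subset fun _ h => ⟨h.1, x, le_rfl, h.2⟩

/-- Discreteness makes the minimum attained. Choosing the lowest image of a point is the reduction
into `Q`, which acts as the Dirichlet domain of the centre. -/
theorem exists_min_four (hΓ : ProperlyDiscontinuousSMul Γ H4) (x : H4) {S : Set posLorentz}
    (hS : S ⊆ Γ) (hne : S.Nonempty) :
    ∃ γ ∈ S, ∀ δ ∈ S, (γ • x).1 4 ≤ (δ • x).1 4 := by
  obtain ⟨γ₀, h₀⟩ := hne
  have hf : {γ | γ ∈ S ∧ (γ • x).1 4 ≤ (γ₀ • x).1 4}.Finite :=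
    (finite_orbit_le Γ hΓ x _).subset fun γ h => ⟨hS h.1, h.2⟩
  obtain ⟨γ, h1, h2⟩ := Set.exists_min_image _ (fun γ : posLorentz => (γ • x).1 4) hf
    ⟨γ₀, h₀, le_rfl⟩
  refine ⟨γ, h1.1, fun δ hδ => ?_⟩
  rcases le_total ((δ • x).1 4) ((γ₀ • x).1 4) with h | h
  · exact h2 δ ⟨hδ, h⟩
  · exact h1.2.trans h

theorem countable_of_properlyDiscontinuous (hΓ : ProperlyDiscontinuousSMul Γ H4) :
    (Γ : Set posLorentz).Countable := by
  have : (Γ : Set posLorentz) ⊆ ⋃ n : ℕ, {γ : posLorentz | γ ∈ Γ ∧ (γ • base).1 4 ≤ n} := by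
    intro γ hγ
    obtain ⟨n, hn⟩ := exists_nat_ge ((γ • base).1 4)
    exact mem_iUnion.mpr ⟨n, hγ, hn⟩
  exact (countable_iUnion fun n : ℕ => (finite_orbit_le Γ hΓ base n).countable).mono this

end Discrete

/-! ### Images of the ideal vertices and the disjointness of their horoballs. -/

/-- Every horoball contains points that are arbitrarily deep. -/
theorem exists_deep {u : Fin 5 → ℝ} (hu : u ∈ lightCone) {t : ℝ} (ht : 0 ≤ t) :
    ∃ x : H4, x.1 = (√(1 + 2 * t * u 4))⁻¹ • (e5 + t • u) := by
  have h : -lor (e5 + t • u) (e5 + t • u) = 1 + 2 * t * u 4 := by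
    simp only [lor_add_left, lor_add_right, lor_smul_left, lor_smul_right, hu.1, lor_e5_left,
      lor_e5_right, Pi.add_apply, Pi.smul_apply, e5_four, smul_eq_mul]
    ring
  have hpos : 0 ≤ t * u 4 := mul_nonneg ht hu.2.le
  refine ⟨normalize (e5 + t • u) (by linarith) ?_, ?_⟩
  · simp only [Pi.add_apply, Pi.smul_apply, e5_four, smul_eq_mul]; linarith
  · rw [normalize_val, h]

theorem exists_neg_lor_lt {u : Fin 5 → ℝ} (hu : u ∈ lightCone) {ε : ℝ} (hε : 0 < ε) :
    ∃ x : H4, -lor x.1 u < ε := by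
  have hu4 := hu.2
  -- On the ray from the centre to `u` the height is `u₅ / √(1 + 2 t u₅)`; this `t` turns it into
  -- `u₅ / √(1 + (u₅/ε)²) < ε`.
  obtain ⟨x, hx⟩ := exists_deep hu (t := u 4 / (2 * ε ^ 2)) (by positivity)
  refine ⟨x, ?_⟩
  have h : 1 + 2 * (u 4 / (2 * ε ^ 2)) * u 4 = 1 + (u 4 / ε) ^ 2 := by field_simp
  rw [h] at hx
  rw [hx, lor_smul_left, lor_add_left, lor_smul_left, hu.1, lor_e5_left, mul_zero, add_zero,
    mul_neg, neg_neg, inv_mul_lt_iff₀ (Real.sqrt_pos.mpr (by positivity))]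
  have h2 : u 4 / ε < √(1 + (u 4 / ε) ^ 2) := by
    apply Real.lt_sqrt_of_sq_lt; linarith
  rwa [div_lt_iff₀ hε] at h2

/-- The horoballs based at the `Γ`-images of the ideal vertices. -/
def IsVertexImage (Γ : Subgroup posLorentz) (w : Fin 5 → ℝ) : Prop :=
  ∃ γ ∈ Γ, ∃ a, γ.1 w = idealVertex a

theorem isVertexImage_vertex (Γ : Subgroup posLorentz) (a : Fin 24) :
    IsVertexImage Γ (idealVertex a) := ⟨1, Γ.one_mem, a, rfl⟩

theorem IsVertexImage.smul {Γ : Subgroup posLorentz} {w : Fin 5 → ℝ} (h : IsVertexImage Γ w)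
    {γ : posLorentz} (hγ : γ ∈ Γ) : IsVertexImage Γ (γ.1 w) := by
  obtain ⟨δ, hδ, a, ha⟩ := h
  exact ⟨δ * γ⁻¹, Γ.mul_mem hδ (Γ.inv_mem hγ), a, by
    rw [mul_val_apply, inv_val_apply_self, ha]⟩

theorem IsVertexImage.mem_lightCone {Γ : Subgroup posLorentz} {w : Fin 5 → ℝ}
    (h : IsVertexImage Γ w) : w ∈ lightCone := by
  obtain ⟨δ, -, a, ha⟩ := h
  rw [← inv_val_apply_self δ w, ha]
  exact val_mem_lightCone _ (vertex_mem_lightCone a)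

theorem vertex_eq_of_lt {x : H4} {a b : Fin 24} (ha : -lor x.1 (idealVertex a) < 1 / 2)
    (hb : -lor x.1 (idealVertex b) < 1 / 2) : a = b := by
  by_contra h
  have h1 := x.lor_light_mul (vertex_mem_lightCone a) (vertex_mem_lightCone b)
  have h2 := lor_vertex_of_ne h
  have h3 := x.lor_light_neg (vertex_mem_lightCone a)
  have h4 := x.lor_light_neg (vertex_mem_lightCone b)
  nlinarith

theorem vertex_mem_side_of_lt {x : H4} {i a : Fin 24} (hx : lor x.1 (sideNormal i) = 0)
    (ha : -lor x.1 (idealVertex a) < 1 / 2) : lor (idealVertex a) (sideNormal i) = 0 := by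
  rcases lor_vertex_side_cases a i with h | h
  · exact h
  · have h1 := x.sq_lor_le (lor_side_self i) hx (vertex_mem_lightCone a).1
    have h2 := x.lor_light_neg (vertex_mem_lightCone a)
    nlinarith

namespace SidePairing

variable {Φ : SidePairing}

/-- The part of the horoball at a vertex image is covered by copies of `Q` at that point. -/
theorem exists_smul_mem_Q_of_vertexImage (hΦ : ProperlyDiscontinuousSMul Φ.group H4)
    {w : Fin 5 → ℝ} (hw : IsVertexImage Φ.group w) {x : H4} (hx : -lor x.1 w < 1 / 2) :
    ∃ γ ∈ Φ.group, (∃ a, γ.1 w = idealVertex a) ∧ γ • x ∈ Q := by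
  -- Only elements sending `w` to an ideal vertex compete. Pairing maps of sides through that vertex
  -- stay in the competition, so minimality gives the inequalities of exactly those sides, which
  -- suffice inside the horoball.
  obtain ⟨γ, ⟨hγ, a, ha⟩, hmin⟩ := exists_min_four Φ.group hΦ x
    (S := {γ | γ ∈ Φ.group ∧ ∃ a, γ.1 w = idealVertex a}) (fun γ h => h.1) hw
  refine ⟨γ, hγ, ⟨a, ha⟩, mem_Q_of_vertex_sides (d := a) ?_ ?_⟩
  · rw [← ha, coe_smul, lor_val]; exact hx
  · intro i hi
    obtain ⟨b, hb, -⟩ := Φ.exists_map_vertex hi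
    have h := hmin (Φ.g i * γ) ⟨Φ.group.mul_mem (Φ.g_mem i) hγ, b, by
      rw [mul_val_apply, ha, hb]⟩
    rw [mul_smul, coe_smul (Φ.g i), Φ.g_four] at h
    linarith

/-- Identified points of `Q` are related by an element of `Γ` that respects the ideal vertices
nearby. -/
theorem exists_of_eqvGen {x y : H4} (h : Relation.EqvGen Φ.Paired x y) :
    ∃ γ ∈ Φ.group, γ • x = y ∧
      (∀ a, -lor x.1 (idealVertex a) < 1 / 2 → ∃ b, γ.1 (idealVertex a) = idealVertex b) ∧
      ∀ b, -lor y.1 (idealVertex b) < 1 / 2 → ∃ a, γ.1 (idealVertex a) = idealVertex b := by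
  induction h with
  | rel x y h =>
    obtain ⟨i, hx, rfl⟩ := h
    refine ⟨Φ.g i, Φ.g_mem i, rfl, fun a ha => ?_, fun b hb => ?_⟩
    · obtain ⟨b, hb, -⟩ := Φ.exists_map_vertex (vertex_mem_side_of_lt hx.2 ha)
      exact ⟨b, hb⟩
    · have h1 : Φ.g i • x ∈ side (Φ.partner i) := by
        rw [← Φ.smul_side]; exact Set.smul_mem_smul_set hx
      obtain ⟨a, ha, -⟩ := Φ.exists_map_vertex (vertex_mem_side_of_lt h1.2 hb)
      refine ⟨a, ?_⟩
      rw [← ha, Φ.g_partner, val_apply_inv_self]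
  | refl x =>
    exact ⟨1, Φ.group.one_mem, one_smul _ _, fun a _ => ⟨a, rfl⟩, fun b _ => ⟨b, rfl⟩⟩
  | symm x y _ ih =>
    obtain ⟨γ, hγ, rfl, h1, h2⟩ := ih
    refine ⟨γ⁻¹, Φ.group.inv_mem hγ, inv_smul_smul _ _, fun a ha => ?_, fun b hb => ?_⟩
    · obtain ⟨b, hb⟩ := h2 a ha
      exact ⟨b, by rw [← hb, inv_val_apply_self]⟩
    · obtain ⟨a, ha⟩ := h1 b hb
      exact ⟨a, by rw [← ha, inv_val_apply_self]⟩
  | trans x y z _ _ ih ih' =>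
    obtain ⟨γ, hγ, rfl, h1, h2⟩ := ih
    obtain ⟨δ, hδ, rfl, h3, h4⟩ := ih'
    refine ⟨δ * γ, Φ.group.mul_mem hδ hγ, mul_smul _ _ _, fun a ha => ?_, fun b hb => ?_⟩
    · obtain ⟨b, hb⟩ := h1 a ha
      obtain ⟨c, hc⟩ := h3 b (by rw [← hb, coe_smul, lor_val]; exact ha)
      exact ⟨c, by rw [mul_val_apply, hb, hc]⟩
    · obtain ⟨c, hc⟩ := h4 b hb
      obtain ⟨a, ha⟩ := h2 c (by rw [← hc, coe_smul δ, lor_val] at hb; exact hb)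
      exact ⟨a, by rw [mul_val_apply, ha, hc]⟩

/-- The horoballs of height `1/2` at the vertex images are disjoint. -/
theorem vertexImage_unique (hΦ : Φ.YieldsManifold) {w w' : Fin 5 → ℝ}
    (hw : IsVertexImage Φ.group w) (hw' : IsVertexImage Φ.group w') {x : H4}
    (hx : -lor x.1 w < 1 / 2) (hx' : -lor x.1 w' < 1 / 2) : w = w' := by
  obtain ⟨γ, hγ, ⟨a, ha⟩, h1⟩ :=
    exists_smul_mem_Q_of_vertexImage hΦ.properlyDiscontinuous hw hx
  obtain ⟨δ, hδ, ⟨b, hb⟩, h2⟩ :=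
    exists_smul_mem_Q_of_vertexImage hΦ.properlyDiscontinuous hw' hx'
  have h3 := hΦ.injective (γ • x) h1 (δ • x) h2 ⟨δ * γ⁻¹,
    Φ.group.mul_mem hδ (Φ.group.inv_mem hγ), by rw [mul_smul, inv_smul_smul]⟩
  obtain ⟨β, hβ, h4, h5, -⟩ := exists_of_eqvGen h3
  -- Freeness identifies `β` with `δ γ⁻¹`. Then `δ` sends both `w` and `w'` to ideal vertices whose
  -- horoballs contain `δ x`.
  have h6 : δ⁻¹ * β * γ = 1 := by
    refine hΦ.free _ (Φ.group.mul_mem (Φ.group.mul_mem (Φ.group.inv_mem hδ) hβ) hγ) x ?_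
    rw [mul_smul, mul_smul, h4, inv_smul_smul]
  have h7 : δ = β * γ := by
    rw [mul_assoc, inv_mul_eq_one] at h6; exact h6
  obtain ⟨c, hc⟩ := h5 a (by rw [← ha, coe_smul, lor_val]; exact hx)
  have h8 : δ.1 w = idealVertex c := by rw [h7, mul_val_apply, ha, hc]
  have h9 : c = b := by
    refine vertex_eq_of_lt (x := δ • x) ?_ ?_
    · rw [← h8, coe_smul, lor_val]; exact hx
    · rw [← hb, coe_smul, lor_val]; exact hx'
  apply δ.1.injective
  rw [h8, hb, h9]

/-- Two horoballs based at one point at infinity overlap deep down, so the family contains only one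
per base point. -/
theorem vertexImage_smul_eq (hΦ : Φ.YieldsManifold) {w : Fin 5 → ℝ} {c : ℝ} (hc : 0 < c)
    (hw : IsVertexImage Φ.group w) (hw' : IsVertexImage Φ.group (c • w)) : c • w = w := by
  obtain ⟨x, hx⟩ := exists_neg_lor_lt hw.mem_lightCone (ε := min (1 / 2) (1 / 2 / c))
    (by positivity)
  refine vertexImage_unique hΦ hw' hw (x := x) ?_ (hx.trans_le (min_le_left _ _))
  have := hx.trans_le (min_le_right _ _)
  rw [lt_div_iff₀ hc] at this
  rw [lor_smul_right]
  linarith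

/-! ### Cusp points -/

/-- A second fixed ray `w` would be fixed pointwise, since `u ∘ w ≠ 0` is preserved. Then the point
in the direction `u + w` would be fixed, against freeness. -/
theorem isParabolic_of_fixes (hΦ : Φ.YieldsManifold) {γ : posLorentz} (hγ : γ ∈ Φ.group)
    (hne : γ ≠ 1) {u : Fin 5 → ℝ} (hu : u ∈ lightCone) (h : γ.1 u = u) : IsParabolic γ := by
  have hfree : ∀ x : H4, γ • x ≠ x := fun x hx => hne (hΦ.free γ hγ x hx)
  refine ⟨hfree, u, hu, ⟨1, by rw [h, one_smul]⟩, ?_⟩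
  rintro w hw ⟨c, hc⟩
  by_cases h0 : lor u w = 0
  · exact ⟨_, lightCone_eq_smul hu hw h0⟩
  · exfalso
    have h1 : c = 1 := by
      have := lor_val γ u w
      rw [h, hc, lor_smul_right] at this
      exact (mul_eq_right₀ h0).mp this
    rw [h1, one_smul] at hc
    have hneg : lor u w < 0 := lt_of_le_of_ne (lor_light_nonpos hu hw) h0
    have hz : lor (u + w) (u + w) < 0 := by
      simp only [lor_add_left, lor_add_right, hu.1, hw.1, lor_comm w u]; linarith
    have hz4 : 0 < (u + w) 4 := add_pos hu.2 hw.2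
    apply hfree (normalize (u + w) hz hz4)
    apply H4.ext
    rw [coe_smul, normalize_val, map_smul, map_add, h, hc]

/-- The horosphere at level `1/4` is unbounded. At `e₁ + e₅` the point with second coordinate `R`
has `y₅ + y₁ = 4 (1 + R²)`, and a symmetry of `Q` transports it. -/
theorem exists_high_point (b : Fin 24) (R : ℝ) :
    ∃ x : H4, -lor x.1 (idealVertex b) = 1 / 4 ∧ R < x.1 4 := by
  have h0 : lor ![2 * R ^ 2 + 15 / 8, R, 0, 0, 2 * R ^ 2 + 17 / 8]
      ![2 * R ^ 2 + 15 / 8, R, 0, 0, 2 * R ^ 2 + 17 / 8] = -1 := by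
    simp [lor]; ring
  let y : H4 := ⟨![2 * R ^ 2 + 15 / 8, R, 0, 0, 2 * R ^ 2 + 17 / 8], h0, by
    simp; positivity⟩
  refine ⟨frame b • y, ?_, ?_⟩
  · rw [← frame_vertex b, coe_smul, lor_val, neg_lor_vertex_17]
    simp [y]; norm_num
  · have : (frame b • y).1 4 = y.1 4 := by
      have h1 : lor (frame b • y).1 e5 = lor y.1 e5 := by
        rw [coe_smul]
        conv_lhs => rw [← sym_e5 (framePerm_isSym b)]
        exact lor_val (frame b) _ _
      rw [lor_e5_right, lor_e5_right] at h1
      linarith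
    rw [this]
    simp only [y, Matrix.cons_val]
    nlinarith [sq_nonneg (R - 1)]

/-- With a trivial stabilizer only finitely many elements would send the vertex to an ideal vertex.
The horosphere at level `1/4` would then be covered by finitely many translates of compact cubes,
but it is unbounded. -/
theorem exists_ne_one_fixes (hΦ : Φ.YieldsManifold) (b : Fin 24) :
    ∃ γ ∈ Φ.group, γ ≠ 1 ∧ γ.1 (idealVertex b) = idealVertex b := by
  by_contra! hcon
  set T : Set posLorentz := {γ | γ ∈ Φ.group ∧ ∃ a, γ.1 (idealVertex b) = idealVertex a} with hT
  have hfin : T.Finite := by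
    refine Set.Finite.of_finite_image (f := fun γ => γ.1 (idealVertex b)) ?_ ?_
    · refine (Set.finite_range idealVertex).subset ?_
      rintro _ ⟨γ, ⟨-, a, ha⟩, rfl⟩
      exact ⟨a, ha.symm⟩
    · rintro γ ⟨hγ, -⟩ δ ⟨hδ, -⟩ h
      by_contra hne
      apply hcon (δ⁻¹ * γ) (Φ.group.mul_mem (Φ.group.inv_mem hδ) hγ)
      · rwa [Ne, inv_mul_eq_one, eq_comm]
      · simp only at h
        rw [mul_val_apply, h, inv_val_apply_self]
  obtain ⟨B, hB⟩ := (hfin.image fun γ => (γ • base).1 4).bddAbove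
  set C : ℝ := (1 / 4 + (1 + 3 * (1 / 4) ^ 2) / (1 / 4)) / 2 with hC
  obtain ⟨x, hx, hx4⟩ := exists_high_point b (2 * (B * C))
  obtain ⟨γ, hγ, ⟨a, ha⟩, hQ⟩ := exists_smul_mem_Q_of_vertexImage hΦ.properlyDiscontinuous
    (isVertexImage_vertex Φ.group b) (x := x) (by rw [hx]; norm_num)
  have h1 : (γ • x).1 4 ≤ C := four_le_of_mem_Q hQ (d := a) (by
    rw [← ha, coe_smul, lor_val, hx])
  have h2 : (γ • base).1 4 ≤ B := hB ⟨γ, ⟨hγ, a, ha⟩, rfl⟩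
  have h3 := neg_lor_le (γ • base) (γ • x)
  rw [coe_smul, coe_smul, lor_val, base, lor_e5_left, neg_neg] at h3
  have h4 := mul_le_mul h2 h1 (γ • x).four_pos.le ((γ • base).four_pos.le.trans h2)
  have h5 : x.1 4 ≤ 2 * ((γ • base).1 4 * (γ • x).1 4) := h3
  linarith

theorem isCuspPoint_vertex (hΦ : Φ.YieldsManifold) (b : Fin 24) :
    IsCuspPoint Φ.group (idealVertex b) := by
  obtain ⟨γ, hγ, hne, h⟩ := exists_ne_one_fixes hΦ b
  exact ⟨vertex_mem_lightCone b, γ, hγ,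
    isParabolic_of_fixes hΦ hγ hne (vertex_mem_lightCone b) h, 1, by rw [h, one_smul]⟩

end SidePairing

/-! ### Parabolic elements, displacement, and the location of the cusp points. -/

/-- A parabolic isometry fixes the light-like vectors of its fixed ray. -/
theorem IsParabolic.apply_eq {γ : posLorentz} (hγ : IsParabolic γ) {u : Fin 5 → ℝ}
    (hu : u ∈ lightCone) (h : FixesRay γ u) : γ.1 u = u := by
  obtain ⟨c, hc⟩ := h
  have hc0 : 0 < c := by
    have h1 := (val_mem_lightCone γ hu).2
    rw [hc, Pi.smul_apply, smul_eq_mul] at h1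
    exact pos_of_mul_pos_left h1 hu.2.le
  have huniq : ∀ w ∈ lightCone, FixesRay γ w → ∃ d : ℝ, w = d • u := by
    obtain ⟨-, v, hv, -, h2⟩ := hγ
    intro w hw hw'
    obtain ⟨p, hp⟩ := h2 w hw hw'
    obtain ⟨q, hq⟩ := h2 u hu ⟨c, hc⟩
    have hq0 : q ≠ 0 := by
      rintro rfl
      have := hu.2
      rw [hq, zero_smul] at this
      exact lt_irrefl _ this
    exact ⟨p / q, by rw [hp, hq, smul_smul, div_mul_cancel₀ _ hq0]⟩
  by_cases hc1 : c = 1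
  · rw [hc, hc1, one_smul]
  exfalso
  -- If `c ≠ 1`, then `γ⁻¹ - c⁻¹` kills `u` and is not onto. A vector orthogonal to its range is an
  -- eigenvector of `γ` for `c⁻¹`, and it is null because `c⁻² ≠ 1`. It spans a fixed ray, hence is
  -- parallel to `u`, so `c = c⁻¹`.
  set f : (Fin 5 → ℝ) →ₗ[ℝ] (Fin 5 → ℝ) := (γ⁻¹).1.toLinearMap - c⁻¹ • LinearMap.id with hf
  have hfu : f u = 0 := by
    simp only [hf, LinearMap.sub_apply, LinearMap.smul_apply, LinearMap.id_apply,
      LinearEquiv.coe_coe]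
    have : (γ⁻¹).1 u = c⁻¹ • u := by
      rw [← inv_val_apply_self γ (c⁻¹ • u), map_smul γ.1, hc, smul_smul, inv_mul_cancel₀ hc0.ne',
        one_smul]
    rw [this, sub_self]
  have hu0 : u ≠ 0 := by
    rintro rfl
    exact lt_irrefl _ hu.2
  have hns : ¬ Function.Surjective f := by
    intro hs
    exact hu0 (LinearMap.injective_iff_surjective.mpr hs (hfu.trans (map_zero f).symm))
  obtain ⟨w, hw0, hw⟩ : ∃ w : Fin 5 → ℝ, w ≠ 0 ∧ ∀ x, lor (f x) w = 0 := by
    have hlt : LinearMap.range f < ⊤ := lt_top_iff_ne_top.mpr fun h =>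
      hns (LinearMap.range_eq_top.mp h)
    obtain ⟨φ, hφ0, hφ⟩ := Submodule.exists_le_ker_of_lt_top _ hlt
    set w : Fin 5 → ℝ := fun k => if k = 4 then -φ (Pi.single k 1) else φ (Pi.single k 1) with hwd
    have hwφ : ∀ x, lor x w = φ x := by
      intro x
      have hx : x = ∑ k, x k • Pi.single k (1 : ℝ) := by
        ext j; simp [Pi.single_apply]
      conv_rhs => rw [hx, map_sum]
      simp only [map_smul, smul_eq_mul, Fin.sum_univ_five, lor, hwd]
      simp [show (0 : Fin 5) ≠ 4 by decide, show (1 : Fin 5) ≠ 4 by decide,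
        show (2 : Fin 5) ≠ 4 by decide, show (3 : Fin 5) ≠ 4 by decide]
    refine ⟨w, ?_, fun x => ?_⟩
    · intro hw
      apply hφ0
      ext x
      rw [LinearMap.comp_apply, ← hwφ, hw, lor_zero_right]; rfl
    · rw [hwφ]; exact hφ ⟨x, rfl⟩
  have hw2 : γ.1 w = c⁻¹ • w := by
    have : γ.1 w - c⁻¹ • w = 0 := by
      apply eq_zero_of_lor_eq_zero
      intro y
      have h1 := hw y
      simp only [hf, LinearMap.sub_apply, LinearMap.smul_apply, LinearMap.id_apply,
        LinearEquiv.coe_coe, lor_sub_left, lor_inv_left, lor_smul_left] at h1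
      rw [lor_comm, lor_sub_right, lor_smul_right, h1]
    exact sub_eq_zero.mp this
  have hww : lor w w = 0 := by
    have h1 := lor_val γ w w
    rw [hw2, lor_smul_left, lor_smul_right, ← mul_assoc] at h1
    have h2 : (c⁻¹ * c⁻¹ - 1) * lor w w = 0 := by linarith
    rcases mul_eq_zero.mp h2 with h3 | h3
    · exfalso
      apply hc1
      have h4 : c⁻¹ * c⁻¹ = 1 := by linarith
      have h5 : c⁻¹ = 1 := by nlinarith [inv_pos.mpr hc0]
      exact inv_eq_one.mp h5
    · exact h3
  obtain ⟨w', hw', hfix⟩ : ∃ w' ∈ lightCone, γ.1 w' = c⁻¹ • w' := by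
    rcases lt_trichotomy (w 4) 0 with h4 | h4 | h4
    · exact ⟨-w, ⟨by rw [lor_neg_left, lor_neg_right, hww]; norm_num, by simpa using h4⟩, by
        rw [map_neg, hw2, smul_neg]⟩
    · exact absurd (eq_zero_of_four hww.le h4) hw0
    · exact ⟨w, ⟨hww, h4⟩, hw2⟩
  obtain ⟨d, hd⟩ := huniq w' hw' ⟨_, hfix⟩
  rw [hd, map_smul, hc, smul_comm] at hfix
  have hd4 : (d • u) 4 ≠ 0 := by rw [← hd]; exact hw'.2.ne'
  have h6 := congrFun hfix 4
  rw [Pi.smul_apply, Pi.smul_apply c⁻¹, smul_eq_mul, smul_eq_mul] at h6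
  have h7 : c = c⁻¹ := mul_right_cancel₀ hd4 h6
  apply hc1
  have h8 : c * c = 1 := by
    nth_rewrite 1 [h7]
    exact inv_mul_cancel₀ hc0.ne'
  nlinarith

theorem continuous_smul_val (γ : posLorentz) : Continuous fun y : H4 => γ.1 y.1 :=
  (LinearMap.continuous_of_finiteDimensional γ.1.toLinearMap).comp continuous_val

theorem continuous_lor {X : Type*} [TopologicalSpace X] {f g : X → Fin 5 → ℝ} (hf : Continuous f)
    (hg : Continuous g) : Continuous fun x => lor (f x) (g x) := by
  have h1 := fun k => (continuous_apply k).comp hf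
  have h2 := fun k => (continuous_apply k).comp hg
  simp only [Function.comp_def] at h1 h2
  simp only [lor]
  exact (((((h1 0).mul (h2 0)).add ((h1 1).mul (h2 1))).add ((h1 2).mul (h2 2))).add
    ((h1 3).mul (h2 3))).sub ((h1 4).mul (h2 4))

namespace SidePairing

variable {Φ : SidePairing}

/-- On a bounded region, the displacement of the nontrivial elements of `Γ` is bounded below. -/
theorem exists_displacement (hΦ : Φ.YieldsManifold) (R : ℝ) :
    ∃ ε : ℝ, 0 < ε ∧ ∀ γ ∈ Φ.group, γ ≠ 1 → ∀ y : H4, y.1 4 ≤ R →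
      1 + ε ≤ -lor y.1 (γ.1 y.1) := by
  classical
  obtain ⟨K, hK, hKR⟩ := exists_compact_four_le R
  have hone : ∀ γ ∈ Φ.group, γ ≠ 1 → ∃ ε : ℝ, 0 < ε ∧ ∀ y ∈ K, 1 + ε ≤ -lor y.1 (γ.1 y.1) := by
    intro γ hγ hne
    rcases K.eq_empty_or_nonempty with rfl | hKne
    · exact ⟨1, one_pos, fun y hy => absurd hy (notMem_empty y)⟩
    obtain ⟨y₀, -, hmin⟩ := hK.exists_isMinOn hKne
      (f := fun y : H4 => -lor y.1 (γ.1 y.1))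
      (continuous_lor continuous_val (continuous_smul_val γ)).neg.continuousOn
    have h1 : -lor y₀.1 (γ.1 y₀.1) ≠ 1 := by
      intro h
      exact hne (hΦ.free γ hγ y₀ (H4.eq_of_lor _ (γ • y₀) (by rw [coe_smul]; linarith)).symm)
    have h2 := y₀.lor_le (γ • y₀)
    rw [coe_smul] at h2
    have h3 : 1 < -lor y₀.1 (γ.1 y₀.1) := lt_of_le_of_ne (by linarith) h1.symm
    refine ⟨-lor y₀.1 (γ.1 y₀.1) - 1, by linarith, fun y hy => ?_⟩
    have := hmin hy
    simp only [mem_ofPred_eq] at this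
    linarith
  -- If `-(y ∘ γ y) ≤ 2` and `y` has height at most `R`, then `four_le_of_lor` bounds the height of
  -- `γ y` by `2 (R · 2)`. So only finitely many elements matter; the others have displacement above
  -- 2.
  have hfin := finite_smul_inter Φ.group hΦ.properlyDiscontinuous R (2 * (R * 2))
  have : ∃ ε : ℝ, 0 < ε ∧ ∀ γ ∈ hfin.toFinset, γ ≠ 1 → ∀ y ∈ K, 1 + ε ≤ -lor y.1 (γ.1 y.1) := by
    have hsub : ∀ γ ∈ hfin.toFinset, γ ∈ Φ.group := fun γ h => (hfin.mem_toFinset.mp h).1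
    revert hsub
    induction hfin.toFinset using Finset.induction_on with
    | empty => exact fun _ => ⟨1, one_pos, fun γ h => absurd h (Finset.notMem_empty γ)⟩
    | insert δ s _ ih =>
      intro hsub
      obtain ⟨ε, hε, h⟩ := ih fun γ hγ => hsub γ (Finset.mem_insert_of_mem hγ)
      by_cases hδ : δ = 1
      · refine ⟨ε, hε, fun γ hγ hne => ?_⟩
        rcases Finset.mem_insert.mp hγ with rfl | hγ
        · exact absurd hδ hne
        · exact h γ hγ hne
      · obtain ⟨ε', hε', h'⟩ := hone δ (hsub δ (Finset.mem_insert_self _ _)) hδ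
        refine ⟨min ε ε', lt_min hε hε', fun γ hγ hne y hy => ?_⟩
        rcases Finset.mem_insert.mp hγ with rfl | hγ
        · linarith [h' y hy, min_le_right ε ε']
        · linarith [h γ hγ hne y hy, min_le_left ε ε']
  obtain ⟨ε, hε, h⟩ := this
  refine ⟨min ε 1, lt_min hε one_pos, fun γ hγ hne y hy => ?_⟩
  by_contra! hlt
  have h2 : -lor (γ • y).1 y.1 ≤ 2 := by
    rw [lor_comm, coe_smul]; linarith [min_le_right ε 1]
  have h3 := four_le_of_lor (γ • y) y
  have h4 : (γ • y).1 4 ≤ 2 * (R * 2) := by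
    have h5 := mul_le_mul hy h2 (by linarith [(γ • y).lor_le y])
      (y.four_pos.le.trans hy)
    linarith
  have := h γ (hfin.mem_toFinset.mpr ⟨hγ, y, hy, h4⟩) hne y (hKR y hy)
  linarith [min_le_left ε 1]

/-- Every cusp point is represented by an image of an ideal vertex. -/
theorem exists_smul_isVertexImage (hΦ : Φ.YieldsManifold) {u : Fin 5 → ℝ}
    (hu : IsCuspPoint Φ.group u) : ∃ c : ℝ, 0 < c ∧ IsVertexImage Φ.group (c • u) := by
  obtain ⟨huL, γ, hγ, hpar, hfix⟩ := hu
  have hγu := hpar.apply_eq huL hfix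
  have hγ1 : γ ≠ 1 := by
    rintro rfl
    exact hpar.1 base (one_smul _ _)
  have hu4 := huL.2
  -- By `four_le_two_of_core`, a point of `Q` of height above 2 lies in one of the horoballs.
  obtain ⟨ε, hε, hdisp⟩ := exists_displacement hΦ 2
  set C : ℝ := -lor e5 (γ.1 e5) with hC
  -- At parameter `t` of the ray the displacement is `(C + 2 t u₅) / (1 + 2 t u₅)`, which is below
  -- `1 + ε` once `t > T`.
  set T : ℝ := |C| / (2 * u 4 * ε) with hT
  have hT0 : 0 ≤ T := by positivity
  have hN : ∀ t, T < t → 0 < 1 + 2 * t * u 4 := fun t ht => by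
    have : 0 < t * u 4 := mul_pos (hT0.trans_lt ht) hu4
    linarith
  have hcover : ∀ t, T < t → ∃ w, IsVertexImage Φ.group w ∧
      -lor e5 w - t * lor u w < 1 / 2 * √(1 + 2 * t * u 4) := by
    intro t ht
    obtain ⟨x, hx⟩ := exists_deep huL (hT0.trans ht.le)
    set r := √(1 + 2 * t * u 4) with hr
    have hr0 : 0 < r := Real.sqrt_pos.mpr (hN t ht)
    have hrr : r * r = 1 + 2 * t * u 4 := Real.mul_self_sqrt (hN t ht).le
    have hd : -lor x.1 (γ.1 x.1) < 1 + ε := by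
      have h1 : lor u (γ.1 e5) = -u 4 := by
        conv_lhs => rw [← hγu]
        rw [lor_val, lor_e5_right]
      have h2 : -lor x.1 (γ.1 x.1) = (C + 2 * t * u 4) / (r * r) := by
        rw [hx, map_smul, map_add, map_smul, hγu]
        simp only [lor_smul_left, lor_smul_right, lor_add_left, lor_add_right, h1, huL.1,
          lor_e5_left, hC]
        field_simp
        ring
      rw [h2, hrr, div_lt_iff₀ (hN t ht)]
      have h3 : |C| < t * (2 * u 4 * ε) := by
        rw [← div_lt_iff₀ (by positivity)]; exact ht
      nlinarith [le_abs_self C]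
    obtain ⟨δ, hδ, hQ⟩ := hΦ.surjective x
    have h4 : 2 < (δ • x).1 4 := by
      by_contra! hle
      have := hdisp (δ * γ * δ⁻¹) (Φ.group.mul_mem (Φ.group.mul_mem hδ hγ) (Φ.group.inv_mem hδ))
        (by rwa [Ne, conj_eq_one_iff]) (δ • x) hle
      rw [coe_smul, mul_val_apply, mul_val_apply, inv_val_apply_self, lor_val] at this
      linarith
    obtain ⟨a, ha⟩ : ∃ a, -lor (δ • x).1 (idealVertex a) < 1 / 2 := by
      by_contra! hcon
      linarith [four_le_two_of_core hQ hcon]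
    refine ⟨(δ⁻¹).1 (idealVertex a), ⟨δ, hδ, a, val_apply_inv_self _ _⟩, ?_⟩
    rw [coe_smul, lor_val_left, hx, lor_smul_left, lor_add_left, lor_smul_left] at ha
    rw [← mul_neg, inv_mul_lt_iff₀ hr0] at ha
    linarith
  have hdisj : ∀ t, T < t → ∀ w w', IsVertexImage Φ.group w → IsVertexImage Φ.group w' →
      -lor e5 w - t * lor u w < 1 / 2 * √(1 + 2 * t * u 4) →
      -lor e5 w' - t * lor u w' < 1 / 2 * √(1 + 2 * t * u 4) → w = w' := by
    intro t ht w w' hw hw' h h'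
    obtain ⟨x, hx⟩ := exists_deep huL (hT0.trans ht.le)
    have hr0 : 0 < √(1 + 2 * t * u 4) := Real.sqrt_pos.mpr (hN t ht)
    refine vertexImage_unique hΦ hw hw' (x := x) ?_ ?_ <;>
      rw [hx, lor_smul_left, lor_add_left, lor_smul_left, ← mul_neg, inv_mul_lt_iff₀ hr0] <;>
      linarith
  obtain ⟨w, hw, hwt⟩ := hcover (T + 1) (by linarith)
  -- `U w` is the set of times that the ray spends in the horoball at `w`. These sets are open,
  -- disjoint and cover the half-line, so one of them is everything.
  set U : (Fin 5 → ℝ) → Set ℝ := fun w =>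
    Ioi T ∩ {t : ℝ | -lor e5 w - t * lor u w < 1 / 2 * √(1 + 2 * t * u 4)} with hU
  have hopen : ∀ w, IsOpen (U w) :=
    fun w => isOpen_Ioi.inter (isOpen_lt (by fun_prop) (by fun_prop))
  have hall : Ioi T ⊆ U w := by
    refine isPreconnected_Ioi.subset_left_of_subset_union (hopen w)
      (isOpen_iUnion fun w' : {w' // IsVertexImage Φ.group w' ∧ w' ≠ w} => hopen w'.1) ?_ ?_ ?_
    · rw [Set.disjoint_iUnion_right]
      rintro ⟨w', hw', hne⟩
      rw [Set.disjoint_left]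
      rintro t ⟨ht, h⟩ ⟨-, h'⟩
      exact hne (hdisj t ht w' w hw' hw h' h)
    · intro t ht
      obtain ⟨w', hw', h⟩ := hcover t ht
      by_cases hww : w' = w
      · left; rw [← hww]; exact ⟨ht, h⟩
      · right; exact mem_iUnion.mpr ⟨⟨w', hw', hww⟩, ht, h⟩
    · exact ⟨T + 1, by simp, by simp, hwt⟩
  have hwL := hw.mem_lightCone
  have h0 : lor u w = 0 := by
    by_contra hne
    set b := -lor u w with hb
    have hb0 : 0 < b := by
      have := lt_of_le_of_ne (lor_light_nonpos huL hwL) hne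
      linarith
    -- If `u ∘ w = -b ≠ 0`, the height over `w` grows at least like `b √t`. This `t` gives `t² b² ≥
    -- t (1 + 2 u₅)`, too much for the horoball.
    set t := T + 1 + (1 + 2 * u 4) / b ^ 2 with ht
    have hq : 0 < (1 + 2 * u 4) / b ^ 2 := by positivity
    have ht1 : 1 ≤ t := by linarith
    have h1 : -lor e5 w - t * lor u w < 1 / 2 * √(1 + 2 * t * u 4) :=
      (hall (show T < t by linarith)).2
    have h2 : (1 + 2 * u 4) / b ^ 2 ≤ t := by linarith
    rw [div_le_iff₀ (by positivity)] at h2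
    rw [lor_e5_left, neg_neg] at h1
    have h3 : t * b < 1 / 2 * √(1 + 2 * t * u 4) := by
      have := hwL.2
      have h4 : t * lor u w = -(t * b) := by rw [hb]; ring
      linarith
    have h4 := mul_self_lt_mul_self (by positivity) h3
    have h5 : 0 ≤ 1 + 2 * t * u 4 := by positivity
    have h6 : 1 / 2 * √(1 + 2 * t * u 4) * (1 / 2 * √(1 + 2 * t * u 4)) =
        (1 + 2 * t * u 4) / 4 := by
      rw [mul_mul_mul_comm, Real.mul_self_sqrt h5]; ring
    rw [h6] at h4
    have h7 : t * (1 + 2 * u 4) ≤ t * (t * b ^ 2) := mul_le_mul_of_nonneg_left h2 (by linarith)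
    nlinarith
  refine ⟨w 4 / u 4, div_pos hwL.2 hu4, ?_⟩
  rw [← lightCone_eq_smul huL hwL h0]
  exact hw

/-! ### Maximum cusps -/

theorem isCuspPoint_smul {Γ : Subgroup posLorentz} {u : Fin 5 → ℝ} (h : IsCuspPoint Γ u) {c : ℝ}
    (hc : 0 < c) : IsCuspPoint Γ (c • u) := by
  obtain ⟨hu, γ, hγ, hp, d, hd⟩ := h
  exact ⟨lightCone_smul hu hc, γ, hγ, hp, d, by rw [map_smul, hd, smul_comm]⟩

theorem isCuspPoint_map {Γ : Subgroup posLorentz} {u : Fin 5 → ℝ} (h : IsCuspPoint Γ u)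
    {δ : posLorentz} (hδ : δ ∈ Γ) : IsCuspPoint Γ (δ.1 u) := by
  obtain ⟨hu, γ, hγ, hp, hf⟩ := h
  have hγu := hp.apply_eq hu hf
  have hL := val_mem_lightCone δ hu
  refine ⟨hL, δ * γ * δ⁻¹, Γ.mul_mem (Γ.mul_mem hδ hγ) (Γ.inv_mem hδ), ⟨fun x hx => ?_, ?_⟩, 1, ?_⟩
  · apply hp.1 (δ⁻¹ • x)
    rw [mul_smul, mul_smul] at hx
    conv_rhs => rw [← hx, inv_smul_smul]
  · obtain ⟨-, v, hv, ⟨c, hc⟩, h2⟩ := hp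
    refine ⟨δ.1 v, val_mem_lightCone δ hv, ⟨c, ?_⟩, fun w hw hw' => ?_⟩
    · rw [mul_val_apply, mul_val_apply, inv_val_apply_self, hc, map_smul]
    · obtain ⟨d, hd⟩ := hw'
      obtain ⟨p, hp⟩ := h2 ((δ⁻¹).1 w) (val_mem_lightCone _ hw) ⟨d, by
        rw [← map_smul, ← hd, mul_val_apply, mul_val_apply, inv_val_apply_self]⟩
      exact ⟨p, by rw [← map_smul, ← hp, val_apply_inv_self]⟩
  · rw [mul_val_apply, mul_val_apply, inv_val_apply_self, hγu, one_smul]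

theorem isCuspPoint_of_vertexImage (hΦ : Φ.YieldsManifold) {w : Fin 5 → ℝ}
    (hw : IsVertexImage Φ.group w) : IsCuspPoint Φ.group w := by
  obtain ⟨γ, hγ, a, ha⟩ := hw
  rw [← inv_val_apply_self γ w, ha]
  exact isCuspPoint_map (isCuspPoint_vertex hΦ a) (Φ.group.inv_mem hγ)

theorem mem_horoball_smul {w : Fin 5 → ℝ} {t : ℝ} (x : H4) :
    x ∈ horoball (t • w) ↔ t * -lor x.1 w < 1 := by
  rw [horoball, mem_ofPred_eq, lor_smul_right]
  constructor <;> intro h <;> linarith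

theorem horoball_smul_subset {w : Fin 5 → ℝ} (hw : w ∈ lightCone) {s t : ℝ} (hst : s ≤ t) :
    horoball (t • w) ⊆ horoball (s • w) := by
  intro x hx
  rw [mem_horoball_smul] at hx ⊢
  have := x.lor_light_neg hw
  nlinarith

theorem mem_horoball_two {w : Fin 5 → ℝ} (x : H4) :
    x ∈ horoball ((2 : ℝ) • w) ↔ -lor x.1 w < 1 / 2 := by
  rw [mem_horoball_smul]
  constructor <;> intro h <;> linarith

/-- The horoballs of height `1/2` are precisely invariant. -/
theorem isCuspHoroball_two (hΦ : Φ.YieldsManifold) {w : Fin 5 → ℝ}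
    (hw : IsVertexImage Φ.group w) : IsCuspHoroball Φ.group (horoball ((2 : ℝ) • w)) := by
  refine ⟨⟨_, isCuspPoint_smul (isCuspPoint_of_vertexImage hΦ hw) two_pos, rfl⟩, fun γ hγ => ?_⟩
  rw [or_iff_not_imp_right, Set.not_disjoint_iff]
  rintro ⟨x, h1, h2⟩
  rw [smul_horoball, map_smul] at h1 ⊢
  rw [mem_horoball_two] at h1 h2
  rw [vertexImage_unique hΦ (hw.smul hγ) hw h1 h2]

/-- The point is `r v_a + r⁻¹ v_b` on the geodesic joining the two vertices; `r = 1` is the point of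
tangency of the horoballs of height `1/2`. -/
theorem exists_between_vertices {a b : Fin 24}
    (hab : lor (idealVertex a) (idealVertex b) = -1 / 2) {r : ℝ} (hr : 0 < r) :
    ∃ x : H4, -lor x.1 (idealVertex a) = r⁻¹ / 2 ∧ -lor x.1 (idealVertex b) = r / 2 := by
  have ha := (vertex_mem_lightCone a).1
  have hb := (vertex_mem_lightCone b).1
  refine ⟨⟨r • idealVertex a + r⁻¹ • idealVertex b, ?_, ?_⟩, ?_, ?_⟩
  · simp only [lor_add_left, lor_add_right, lor_smul_left, lor_smul_right, ha, hb, hab,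
      lor_comm (idealVertex b) (idealVertex a)]
    field_simp
    ring
  · simp only [Pi.add_apply, Pi.smul_apply, vertex_four, smul_eq_mul]; positivity
  · simp only [lor_add_left, lor_smul_left, ha, hab, lor_comm (idealVertex b) (idealVertex a)]
    ring
  · simp only [lor_add_left, lor_smul_left, hb, hab]
    ring

/-- Under the hypothesis that there is one cusp, all ideal vertices are equivalent. -/
theorem exists_map_vertex_vertex (hΦ : Φ.YieldsManifold) (h1 : OneCusped Φ.group) {w w' : Fin 5 → ℝ}
    (hw : IsVertexImage Φ.group w) (hw' : IsVertexImage Φ.group w') :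
    ∃ γ ∈ Φ.group, γ.1 w = w' := by
  obtain ⟨γ, hγ, c, hc⟩ := h1.2 w w' (isCuspPoint_of_vertexImage hΦ hw)
    (isCuspPoint_of_vertexImage hΦ hw')
  have hL := (val_mem_lightCone γ hw.mem_lightCone).2
  rw [hc, Pi.smul_apply, smul_eq_mul] at hL
  have hc0 : 0 < c := pos_of_mul_pos_left hL hw'.mem_lightCone.2.le
  -- Matching rays already match the scaled vectors, since a ray carries only one vertex image.
  exact ⟨γ, hγ, hc.trans (vertexImage_smul_eq hΦ hc0 hw' (hc ▸ hw.smul hγ))⟩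

/-- A precisely invariant cusp horoball has height at most `1/2`. -/
theorem two_le_of_isCuspHoroball (hΦ : Φ.YieldsManifold) (h1 : OneCusped Φ.group)
    {w : Fin 5 → ℝ} (hw : IsVertexImage Φ.group w) {t : ℝ} (ht0 : 0 < t)
    (h : ∀ γ ∈ Φ.group, γ • horoball (t • w) = horoball (t • w) ∨
      Disjoint (γ • horoball (t • w)) (horoball (t • w))) : 2 ≤ t := by
  by_contra! ht
  obtain ⟨γ, hγ, a, ha⟩ := hw
  obtain ⟨b, hab⟩ := exists_adjacent_vertex a
  -- An element moving a vertex to an adjacent one carries the horoball to one that overlaps it if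
  -- `t < 2`. It is conjugated by `γ` to act on the given horoball.
  obtain ⟨δ, hδ, hδab⟩ := exists_map_vertex_vertex hΦ h1 (isVertexImage_vertex Φ.group a)
    (isVertexImage_vertex Φ.group b)
  have hβ : (γ⁻¹ * δ * γ) ∈ Φ.group := Φ.group.mul_mem (Φ.group.mul_mem (Φ.group.inv_mem hγ) hδ) hγ
  have h2 : γ • (γ⁻¹ * δ * γ) • horoball (t • w) = horoball (t • idealVertex b) := by
    rw [smul_smul, mul_assoc, mul_inv_cancel_left, mul_smul, smul_horoball, smul_horoball, map_smul,
      map_smul, ha, hδab]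
  have h3 : γ • horoball (t • w) = horoball (t • idealVertex a) := by
    rw [smul_horoball, map_smul, ha]
  rcases h _ hβ with h4 | h4
  · rw [h4, h3] at h2
    -- Equal horoballs at different vertices are excluded by a point close to `a`: with this `r` the
    -- values of `t · height` are below `1` at `a` and `1 + t²/2` at `b`.
    obtain ⟨x, hx, hx'⟩ := exists_between_vertices hab (r := 2 / t + t) (by positivity)
    have h5 : x ∈ horoball (t • idealVertex a) := by
      rw [mem_horoball_smul, hx]
      have : (2 / t + t)⁻¹ < t⁻¹ := by
        apply inv_strictAnti₀ ht0
        have : 0 < 2 / t := by positivity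
        linarith
      have h6 : t * t⁻¹ = 1 := mul_inv_cancel₀ ht0.ne'
      nlinarith
    rw [h2, mem_horoball_smul, hx'] at h5
    have h7 : t * ((2 / t + t) / 2) = 1 + t ^ 2 / 2 := by field_simp
    rw [h7] at h5
    nlinarith [sq_nonneg t]
  · have h5 := (Set.disjoint_smul_set (a := γ)).mpr h4
    rw [h2, h3, Set.disjoint_left] at h5
    obtain ⟨x, hx, hx'⟩ := exists_between_vertices hab one_pos
    refine h5 (a := x) ?_ ?_ <;> rw [mem_horoball_smul]
    · rw [hx']; linarith
    · rw [hx]; norm_num; linarith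

/-- The maximal cusp horoballs are the horoballs of height `1/2` at the vertex images. -/
theorem maximal_isCuspHoroball (hΦ : Φ.YieldsManifold) (h1 : OneCusped Φ.group) {B : Set H4} :
    Maximal (IsCuspHoroball Φ.group) B ↔
      ∃ w, IsVertexImage Φ.group w ∧ B = horoball ((2 : ℝ) • w) := by
  have key : ∀ B, IsCuspHoroball Φ.group B →
      ∃ w, IsVertexImage Φ.group w ∧ B ⊆ horoball ((2 : ℝ) • w) ∧ B.Nonempty := by
    rintro B ⟨⟨u, hu, rfl⟩, hB⟩
    obtain ⟨c, hc, hw⟩ := exists_smul_isVertexImage hΦ hu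
    have hu' : u = c⁻¹ • c • u := by rw [smul_smul, inv_mul_cancel₀ hc.ne', one_smul]
    have hne : (horoball u).Nonempty := by
      obtain ⟨x, hx⟩ := exists_neg_lor_lt hu.1 one_pos
      exact ⟨x, by rw [horoball, mem_ofPred_eq]; linarith⟩
    rw [hu'] at hB
    refine ⟨_, hw, ?_, hne⟩
    have h2 := two_le_of_isCuspHoroball hΦ h1 hw (inv_pos.mpr hc) hB
    conv_lhs => rw [hu']
    exact horoball_smul_subset hw.mem_lightCone h2
  constructor
  · intro hB
    obtain ⟨w, hw, hsub, -⟩ := key B hB.prop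
    exact ⟨w, hw, hB.eq_of_subset (isCuspHoroball_two hΦ hw) hsub⟩
  · rintro ⟨w, hw, rfl⟩
    refine ⟨isCuspHoroball_two hΦ hw, fun B' hB' hsub => ?_⟩
    obtain ⟨w', hw', hsub', -⟩ := key B' hB'
    obtain ⟨x, hx⟩ := exists_neg_lor_lt hw.mem_lightCone (ε := 1 / 2) (by norm_num)
    have h2 := hsub' (hsub ((mem_horoball_two x).mpr hx))
    rw [vertexImage_unique hΦ hw hw' hx ((mem_horoball_two x).mp h2)]
    exact hsub'

theorem proj_smul {Γ : Subgroup posLorentz} {γ : posLorentz} (hγ : γ ∈ Γ) (x : H4) :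
    proj Γ (γ • x) = proj Γ x :=
  Quotient.sound (s := MulAction.orbitRel Γ H4) ⟨⟨γ, hγ⟩, rfl⟩

theorem proj_eq_iff {Γ : Subgroup posLorentz} {x y : H4} :
    proj Γ x = proj Γ y ↔ ∃ γ ∈ Γ, γ • x = y := by
  constructor
  · intro h
    obtain ⟨γ, hγ⟩ := Quotient.exact h.symm
    exact ⟨γ.1, γ.2, hγ⟩
  · rintro ⟨γ, hγ, rfl⟩
    exact (proj_smul hγ x).symm

/-- All maximal cusp horoballs are translates of one another, so they have the same image. This is
the uniqueness of the maximum cusp. -/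
theorem isMaximumCusp_iff (hΦ : Φ.YieldsManifold) (h1 : OneCusped Φ.group)
    {C : Set (Orbits Φ.group)} : IsMaximumCusp Φ.group C ↔
      C = proj Φ.group '' horoball ((2 : ℝ) • idealVertex 17) := by
  have key : ∀ w, IsVertexImage Φ.group w → proj Φ.group '' horoball ((2 : ℝ) • w) =
      proj Φ.group '' horoball ((2 : ℝ) • idealVertex 17) := by
    intro w hw
    obtain ⟨γ, hγ, h⟩ := exists_map_vertex_vertex hΦ h1 hw (isVertexImage_vertex Φ.group 17)
    rw [← h, ← map_smul, ← smul_horoball]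
    ext y
    constructor
    · rintro ⟨x, hx, rfl⟩
      exact ⟨γ • x, Set.smul_mem_smul_set hx, proj_smul hγ x⟩
    · rintro ⟨_, ⟨x, hx, rfl⟩, rfl⟩
      exact ⟨x, hx, (proj_smul hγ x).symm⟩
  constructor
  · rintro ⟨B, hB, rfl⟩
    obtain ⟨w, hw, rfl⟩ := (maximal_isCuspHoroball hΦ h1).mp hB
    exact key w hw
  · rintro rfl
    exact ⟨_, (maximal_isCuspHoroball hΦ h1).mpr ⟨_, isVertexImage_vertex Φ.group 17, rfl⟩, rfl⟩

end SidePairing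

/-! ### Horospherical coordinates and the invariance of the hyperbolic volume -/

/-- Horospherical coordinates of `H⁴` at the ideal point `e₁ + e₅`. -/
def horoChart (n : ℝ) (y : Fin 3 → ℝ) : H4 :=
  chart (Fin.cons ((1 + ∑ i, y i ^ 2 - n ^ 2) / (2 * n)) y)

theorem one_add_sum_cons (n : ℝ) (hn : 0 < n) (y : Fin 3 → ℝ) :
    √(1 + ∑ i, (Fin.cons ((1 + ∑ i, y i ^ 2 - n ^ 2) / (2 * n)) y : Fin 4 → ℝ) i ^ 2) =
      (1 + ∑ i, y i ^ 2 + n ^ 2) / (2 * n) := by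
  rw [Real.sqrt_eq_iff_mul_self_eq (by positivity) (by positivity), Fin.sum_univ_succ]
  simp only [Fin.cons_zero, Fin.cons_succ]
  field_simp
  ring

theorem measurable_horoChart : Measurable fun p : ℝ × (Fin 3 → ℝ) => horoChart p.1 p.2 := by
  refine measurable_chart.comp (measurable_pi_iff.mpr fun i => ?_)
  refine Fin.cases ?_ (fun j => ?_) i
  · simp only [Fin.cons_zero]; fun_prop
  · simp only [Fin.cons_succ]; fun_prop

theorem horoChart_val {n : ℝ} (hn : 0 < n) (y : Fin 3 → ℝ) :
    (horoChart n y).1 = ![(1 + ∑ i, y i ^ 2 - n ^ 2) / (2 * n), y 0, y 1, y 2,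
      (1 + ∑ i, y i ^ 2 + n ^ 2) / (2 * n)] := by
  simp only [horoChart, chart]
  rw [one_add_sum_cons n hn]
  rfl

theorem hypVol_apply {S : Set H4} (hS : MeasurableSet S) :
    hypVol S = ∫⁻ y, S.indicator 1 (chart y) * ENNReal.ofReal (1 / √(1 + ∑ i, y i ^ 2)) := by
  rw [hypVol, Measure.map_apply measurable_chart hS, withDensity_apply _ (measurable_chart hS),
    ← lintegral_indicator (measurable_chart hS)]
  congr 1
  ext y
  by_cases hy : chart y ∈ S
  · rw [indicator_of_mem (s := chart ⁻¹' S) hy, indicator_of_mem hy]; simp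
  · rw [indicator_of_notMem (s := chart ⁻¹' S) hy, indicator_of_notMem hy, zero_mul]

theorem measurable_indicator_chart {S : Set H4} (hS : MeasurableSet S) :
    Measurable fun y => S.indicator (1 : H4 → ℝ≥0∞) (chart y) :=
  (measurable_one.indicator hS).comp measurable_chart

theorem measurable_density :
    Measurable fun y : Fin 4 → ℝ => ENNReal.ofReal (1 / √(1 + ∑ i, y i ^ 2)) := by
  fun_prop

theorem image_horo (k : ℝ) (hk : 0 < k) :
    (fun n : ℝ => (k - n ^ 2) / (2 * n)) '' Ioi 0 = univ := by
  rw [eq_univ_iff_forall]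
  intro x
  have h : |x| < √(x ^ 2 + k) := by
    rw [← Real.sqrt_sq_eq_abs]
    exact Real.sqrt_lt_sqrt (sq_nonneg x) (by linarith)
  have h2 : √(x ^ 2 + k) * √(x ^ 2 + k) = x ^ 2 + k := Real.mul_self_sqrt (by positivity)
  have hn : 0 < √(x ^ 2 + k) - x := by linarith [le_abs_self x]
  -- In the hyperboloid this is `n = x₅ - x₁`, with `x₅² = x₁² + k`.
  refine ⟨√(x ^ 2 + k) - x, hn, ?_⟩
  simp only
  rw [div_eq_iff (by positivity)]
  nlinarith

theorem injOn_horo (k : ℝ) (hk : 0 < k) : InjOn (fun n : ℝ => (k - n ^ 2) / (2 * n)) (Ioi 0) := by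
  intro a ha b hb h
  have ha : 0 < a := ha
  have hb : 0 < b := hb
  simp only at h
  rw [div_eq_div_iff (by positivity) (by positivity)] at h
  have : (b - a) * (k + a * b) = 0 := by nlinarith
  rcases mul_eq_zero.mp this with h1 | h1
  · linarith
  · nlinarith [mul_pos ha hb]

theorem hasDerivAt_horo (k : ℝ) {n : ℝ} (hn : n ≠ 0) :
    HasDerivAt (fun n : ℝ => (k - n ^ 2) / (2 * n)) (-((k + n ^ 2) / (2 * n ^ 2))) n := by
  refine (((hasDerivAt_pow 2 n).const_sub k).div ((hasDerivAt_id n).const_mul 2)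
    (by simpa using hn)).congr_deriv ?_
  simp only [id_eq]
  field_simp
  norm_num
  ring

theorem measurable_indicator_horoChart {S : Set H4} (hS : MeasurableSet S) :
    Measurable fun p : ℝ × (Fin 3 → ℝ) => S.indicator (1 : H4 → ℝ≥0∞) (horoChart p.1 p.2) :=
  (measurable_one.indicator hS).comp measurable_horoChart

theorem measurable_cons :
    Measurable fun p : ℝ × (Fin 3 → ℝ) => (Fin.cons p.1 p.2 : Fin 4 → ℝ) := by
  refine measurable_pi_iff.mpr fun i => ?_
  refine Fin.cases ?_ (fun j => ?_) i
  · simp only [Fin.cons_zero]; fun_prop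
  · simp only [Fin.cons_succ]; fun_prop

theorem lintegral_eq_lintegral_cons {F : (Fin 4 → ℝ) → ℝ≥0∞} (hF : Measurable F) :
    ∫⁻ y, F y = ∫⁻ y : Fin 3 → ℝ, ∫⁻ x : ℝ, F (Fin.cons x y) := by
  have h := (volume_preserving_piFinSuccAbove (fun _ : Fin 4 => ℝ) 0).symm.lintegral_comp hF
  have h2 : ∫⁻ p : ℝ × (Fin 3 → ℝ), F (Fin.cons p.1 p.2) = ∫⁻ y, F y := by
    rw [← h]
    refine lintegral_congr fun p => ?_
    congr 1
    ext i
    refine Fin.cases ?_ (fun j => ?_) i <;> rfl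
  rw [← h2, Measure.volume_eq_prod]
  exact lintegral_prod_symm _ (hF.comp measurable_cons).aemeasurable

theorem lintegral_horo_subst {k : ℝ} (hk : 0 < k) (f : ℝ → ℝ≥0∞) :
    ∫⁻ x, f x = ∫⁻ n in Ioi (0 : ℝ),
      ENNReal.ofReal ((k + n ^ 2) / (2 * n ^ 2)) * f ((k - n ^ 2) / (2 * n)) := by
  rw [← setLIntegral_univ, ← image_horo k hk,
    lintegral_image_eq_lintegral_abs_deriv_mul measurableSet_Ioi
      (fun n hn => (hasDerivAt_horo k (ne_of_gt hn)).hasDerivWithinAt) (injOn_horo k hk)]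
  refine setLIntegral_congr_fun measurableSet_Ioi fun n hn => ?_
  have hn : 0 < n := hn
  rw [abs_neg, abs_of_pos (by positivity)]

/-- For fixed `y` and `k = 1 + |y|²`, the Jacobian `(k + n²)/(2n²)` divided by `x₅ = (k + n²)/(2n)`
is `1/n`. -/
theorem lintegral_cons_horo (S : Set H4) (y : Fin 3 → ℝ) :
    ∫⁻ x : ℝ, S.indicator 1 (chart (Fin.cons x y)) * ENNReal.ofReal
        (1 / √(1 + ∑ i, (Fin.cons x y : Fin 4 → ℝ) i ^ 2)) =
      ∫⁻ n in Ioi (0 : ℝ), ENNReal.ofReal (1 / n) * S.indicator 1 (horoChart n y) := by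
  have hk0 : 0 < 1 + ∑ i, y i ^ 2 := by positivity
  rw [lintegral_horo_subst hk0]
  refine setLIntegral_congr_fun measurableSet_Ioi fun n hn => ?_
  have hn : 0 < n := hn
  rw [one_add_sum_cons n hn, mul_left_comm, ← ENNReal.ofReal_mul (by positivity), mul_comm]
  have e : (1 + ∑ i, y i ^ 2 + n ^ 2) / (2 * n ^ 2) * (1 / ((1 + ∑ i, y i ^ 2 + n ^ 2) / (2 * n))) =
      1 / n := by
    have : 0 < 1 + ∑ i, y i ^ 2 + n ^ 2 := by positivity
    generalize 1 + ∑ i, y i ^ 2 + n ^ 2 = A at this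
    field_simp
  rw [e]
  rfl

theorem lintegral_horo_swap {G : ℝ → (Fin 3 → ℝ) → ℝ≥0∞} (hG : Measurable G.uncurry)
    {w : ℝ → ℝ≥0∞} (hw : Measurable w) :
    ∫⁻ y, ∫⁻ n in Ioi (0 : ℝ), w n * G n y = ∫⁻ n in Ioi (0 : ℝ), w n * ∫⁻ y, G n y := by
  have h : Measurable fun p : (Fin 3 → ℝ) × ℝ => w p.2 * G.uncurry (p.2, p.1) :=
    (hw.comp measurable_snd).mul (hG.comp (measurable_snd.prodMk measurable_fst))
  refine (lintegral_lintegral_swap (f := fun y n => w n * G n y) h.aemeasurable).trans ?_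
  refine lintegral_congr fun n => ?_
  exact lintegral_const_mul _ (hG.comp (measurable_const.prodMk measurable_id))

/-- The hyperbolic volume in horospherical coordinates. -/
theorem hypVol_eq_horo {S : Set H4} (hS : MeasurableSet S) :
    hypVol S = ∫⁻ n in Ioi (0 : ℝ), ENNReal.ofReal (1 / n) *
      ∫⁻ y : Fin 3 → ℝ, S.indicator 1 (horoChart n y) := by
  have h0 : Measurable fun y : Fin 4 → ℝ => S.indicator (1 : H4 → ℝ≥0∞) (chart y) *
      ENNReal.ofReal (1 / √(1 + ∑ i, y i ^ 2)) :=
    (measurable_indicator_chart hS).mul measurable_density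
  rw [hypVol_apply hS, lintegral_eq_lintegral_cons h0,
    lintegral_congr fun y => lintegral_cons_horo S y]
  exact lintegral_horo_swap (G := fun n y => S.indicator 1 (horoChart n y))
    (measurable_indicator_horoChart hS) (w := fun n => ENNReal.ofReal (1 / n)) (by fun_prop)

theorem measurable_smul_H4 (g : posLorentz) : Measurable fun x : H4 => g • x := by
  refine Measurable.subtype_mk ?_
  exact (LinearMap.continuous_of_finiteDimensional g.1.toLinearMap).measurable.comp
    measurable_subtype_coe

/-- The isometry `g` preserves the hyperbolic volume. -/
def PreservesVol (g : posLorentz) : Prop :=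
  ∀ S, MeasurableSet S → hypVol ((fun x : H4 => g • x) ⁻¹' S) = hypVol S

theorem PreservesVol.mul {g h : posLorentz} (hg : PreservesVol g) (hh : PreservesVol h) :
    PreservesVol (g * h) := by
  intro S hS
  rw [← hg S hS, ← hh _ (measurable_smul_H4 g hS)]
  simp only [preimage_preimage, mul_smul]

theorem PreservesVol.inv {g : posLorentz} (hg : PreservesVol g) : PreservesVol g⁻¹ := by
  intro S hS
  rw [← hg _ (measurable_smul_H4 g⁻¹ hS)]
  congr 1
  ext x
  simp only [mem_preimage, inv_smul_smul]

/-- A linear endomorphism that preserves the Lorentzian inner product and the future. -/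
def mkLorentzEndo (f : (Fin 5 → ℝ) →ₗ[ℝ] (Fin 5 → ℝ)) (h : ∀ x y, lor (f x) (f y) = lor x y)
    (h4 : 0 < f e5 4) : posLorentz :=
  mkLorentz (LinearEquiv.ofInjectiveEndo f (by
    rw [← LinearMap.ker_eq_bot, LinearMap.ker_eq_bot']
    intro x hx
    apply eq_zero_of_lor_eq_zero
    intro y
    rw [← h, hx, lor_zero_left])) h h4

theorem mkLorentzEndo_apply {f : (Fin 5 → ℝ) →ₗ[ℝ] (Fin 5 → ℝ)}
    (h : ∀ x y, lor (f x) (f y) = lor x y) (h4 : 0 < f e5 4) (x : Fin 5 → ℝ) :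
    (mkLorentzEndo f h h4).1 x = f x := rfl

/-- The similarity `y ↦ y + n c`, `n ↦ a n` in horospherical coordinates, as a linear map. -/
def horoLin (a : ℝ) (c : Fin 3 → ℝ) : (Fin 5 → ℝ) →ₗ[ℝ] (Fin 5 → ℝ) where
  toFun x := ![((x 4 + x 0 + 2 * (c 0 * x 1 + c 1 * x 2 + c 2 * x 3) +
      (c 0 ^ 2 + c 1 ^ 2 + c 2 ^ 2) * (x 4 - x 0)) / a - a * (x 4 - x 0)) / 2,
    x 1 + (x 4 - x 0) * c 0, x 2 + (x 4 - x 0) * c 1, x 3 + (x 4 - x 0) * c 2,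
    ((x 4 + x 0 + 2 * (c 0 * x 1 + c 1 * x 2 + c 2 * x 3) +
      (c 0 ^ 2 + c 1 ^ 2 + c 2 ^ 2) * (x 4 - x 0)) / a + a * (x 4 - x 0)) / 2]
  map_add' x y := by
    ext k
    fin_cases k <;> simp <;> ring
  map_smul' r x := by
    ext k
    fin_cases k <;> simp <;> ring

theorem horoLin_lor {a : ℝ} (ha : 0 < a) (c : Fin 3 → ℝ) (x y : Fin 5 → ℝ) :
    lor (horoLin a c x) (horoLin a c y) = lor x y := by
  simp only [lor, horoLin, LinearMap.coe_mk, AddHom.coe_mk, Matrix.cons_val]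
  field_simp
  ring

theorem horoLin_e5 {a : ℝ} (ha : 0 < a) (c : Fin 3 → ℝ) : 0 < horoLin a c e5 4 := by
  simp only [horoLin, LinearMap.coe_mk, AddHom.coe_mk, Matrix.cons_val, e5]
  simp
  positivity

/-- The isometry given by the similarity `y ↦ y + n c`, `n ↦ a n` in horospherical coordinates. -/
def horoMap {a : ℝ} (ha : 0 < a) (c : Fin 3 → ℝ) : posLorentz :=
  mkLorentzEndo (horoLin a c) (horoLin_lor ha c) (horoLin_e5 ha c)

theorem eq_horoChart (x : H4) : x = horoChart (x.1 4 - x.1 0) ![x.1 1, x.1 2, x.1 3] := by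
  have hn : 0 < x.1 4 - x.1 0 := by
    rw [← neg_lor_vertex_17]
    linarith [x.lor_light_neg (vertex_mem_lightCone 17)]
  have h := mul_eq_of_H4 x
  apply H4.ext
  rw [horoChart_val hn]
  ext k
  fin_cases k <;> simp [Fin.sum_univ_three]
  · rw [eq_div_iff (by positivity)]; nlinarith
  · rw [eq_div_iff (by positivity)]; nlinarith

theorem horoMap_smul {a : ℝ} (ha : 0 < a) (c : Fin 3 → ℝ) {n : ℝ} (hn : 0 < n) (y : Fin 3 → ℝ) :
    horoMap ha c • horoChart n y = horoChart (a * n) (y + n • c) := by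
  rw [eq_horoChart (horoMap ha c • horoChart n y), coe_smul, horoMap, mkLorentzEndo_apply,
    horoChart_val hn]
  have hn2 : (1 + ∑ i, y i ^ 2 + n ^ 2) / (2 * n) - (1 + ∑ i, y i ^ 2 - n ^ 2) / (2 * n) = n := by
    field_simp; ring
  simp only [horoLin, LinearMap.coe_mk, AddHom.coe_mk, Matrix.cons_val, hn2]
  congr 1
  · ring
  · ext i
    fin_cases i <;> simp

/-- At each level the map is a translation in `y`, which preserves Lebesgue measure, and `dn / n` is
invariant under scaling. -/
theorem preservesVol_horoMap {a : ℝ} (ha : 0 < a) (c : Fin 3 → ℝ) :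
    PreservesVol (horoMap ha c) := by
  intro S hS
  rw [hypVol_eq_horo (measurable_smul_H4 _ hS), hypVol_eq_horo hS]
  set h : ℝ → ℝ≥0∞ := fun n => ∫⁻ y : Fin 3 → ℝ, S.indicator 1 (horoChart n y) with hh
  have himg : (fun n : ℝ => a * n) '' Ioi 0 = Ioi 0 := by
    rw [Set.image_mul_left_Ioi ha, mul_zero]
  conv_rhs => rw [← himg, lintegral_image_eq_lintegral_abs_deriv_mul measurableSet_Ioi
    (f' := fun _ => a) (fun n _ => by
      simpa using ((hasDerivAt_id n).const_mul a).hasDerivWithinAt)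
    ((mul_right_injective₀ ha.ne').injOn)]
  refine setLIntegral_congr_fun measurableSet_Ioi fun n hn => ?_
  have hn : 0 < n := hn
  have h1 : ∫⁻ y : Fin 3 → ℝ, ((fun x : H4 => horoMap ha c • x) ⁻¹' S).indicator 1 (horoChart n y) =
      h (a * n) := by
    rw [hh]
    simp only
    rw [← lintegral_add_right_eq_self (fun y : Fin 3 → ℝ => S.indicator (1 : H4 → ℝ≥0∞)
      (horoChart (a * n) y)) (n • c)]
    refine lintegral_congr fun y => ?_
    rw [← horoMap_smul ha c hn]
    rfl
  rw [h1, ← mul_assoc, ← ENNReal.ofReal_mul (abs_nonneg a), abs_of_pos ha]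
  congr 2
  field_simp

/-! ### Rotations about the centre and the invariance of volume under all isometries. -/

/-- The inclusion of the first four coordinates. -/
def spaceIncl (y : Fin 4 → ℝ) : Fin 5 → ℝ := ![y 0, y 1, y 2, y 3, 0]

/-- The linear map induced on the first four coordinates by an isometry that fixes the centre. -/
def spatial (g : posLorentz) : (Fin 4 → ℝ) →ₗ[ℝ] (Fin 4 → ℝ) where
  toFun y i := g.1 (spaceIncl y) i.castSucc
  map_add' y z := by
    have : spaceIncl (y + z) = spaceIncl y + spaceIncl z := by
      ext i
      fin_cases i <;> simp [spaceIncl]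
    ext i
    rw [this, map_add]; rfl
  map_smul' c y := by
    have : spaceIncl (c • y) = c • spaceIncl y := by
      ext i
      fin_cases i <;> simp [spaceIncl]
    ext i
    rw [this, map_smul]; rfl

theorem spatial_apply (g : posLorentz) (y : Fin 4 → ℝ) (i : Fin 4) :
    spatial g y i = g.1 (spaceIncl y) i.castSucc := rfl

theorem spaceIncl_castSucc (y : Fin 4 → ℝ) (i : Fin 4) : spaceIncl y i.castSucc = y i := by
  fin_cases i <;> rfl

theorem spaceIncl_four (y : Fin 4 → ℝ) : spaceIncl y 4 = 0 := rfl

theorem lor_eq_sum (x y : Fin 5 → ℝ) :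
    lor x y = ∑ i : Fin 4, x i.castSucc * y i.castSucc - x 4 * y 4 := by
  rw [Fin.sum_univ_four]; rfl

theorem spatial_four {g : posLorentz} (hg : g.1 e5 = e5) (x : Fin 5 → ℝ) : g.1 x 4 = x 4 := by
  have h := lor_val g x e5
  rw [hg, lor_e5_right, lor_e5_right] at h
  linarith

theorem spatial_dot {g : posLorentz} (hg : g.1 e5 = e5) (y z : Fin 4 → ℝ) :
    ∑ i, spatial g y i * spatial g z i = ∑ i, y i * z i := by
  have h := lor_val g (spaceIncl y) (spaceIncl z)
  rw [lor_eq_sum, lor_eq_sum, spatial_four hg, spatial_four hg] at h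
  simpa only [spaceIncl_castSucc, spaceIncl_four, ← spatial_apply, mul_zero, sub_zero] using h

theorem abs_det_spatial {g : posLorentz} (hg : g.1 e5 = e5) : |LinearMap.det (spatial g)| = 1 := by
  have h : (LinearMap.toMatrix' (spatial g)).transpose * LinearMap.toMatrix' (spatial g) = 1 := by
    ext i j
    rw [Matrix.mul_apply]
    simp only [Matrix.transpose_apply, LinearMap.toMatrix'_apply]
    have := spatial_dot hg (Pi.single i 1) (Pi.single j 1)
    simp only [Pi.single_apply] at this ⊢
    rw [Matrix.one_apply]
    convert this using 1
    · simp [eq_comm]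
  have h2 := congrArg Matrix.det h
  rw [Matrix.det_mul, Matrix.det_transpose, Matrix.det_one, LinearMap.det_toMatrix'] at h2
  rcases mul_self_eq_one_iff.mp h2 with h3 | h3 <;> rw [h3] <;> norm_num

/-- Such an isometry acts orthogonally on the first four coordinates, preserving Lebesgue measure
and the density, which depends only on the norm. -/
theorem preservesVol_of_fixes {g : posLorentz} (hg : g.1 e5 = e5) : PreservesVol g := by
  intro S hS
  have hdet := abs_det_spatial hg
  have hdet0 : LinearMap.det (spatial g) ≠ 0 := by
    intro h
    rw [h, abs_zero] at hdet
    exact zero_ne_one hdet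
  have hmap := Real.map_linearMap_volume_pi_eq_smul_volume_pi hdet0
  rw [abs_inv, hdet, inv_one, ENNReal.ofReal_one, one_smul] at hmap
  have hm : Measurable (spatial g) :=
    (LinearMap.continuous_of_finiteDimensional (spatial g)).measurable
  have hsum : ∀ y, ∑ i, spatial g y i ^ 2 = ∑ i, y i ^ 2 := by
    intro y
    simp only [sq]
    exact spatial_dot hg y y
  have hchart : ∀ y, g • chart y = chart (spatial g y) := by
    intro y
    apply H4.ext
    have hx : (chart y).1 = spaceIncl y + √(1 + ∑ i, y i ^ 2) • e5 := by
      ext k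
      fin_cases k <;> simp [chart, e5, spaceIncl]
    have hx' : (chart (spatial g y)).1 =
        spaceIncl (spatial g y) + √(1 + ∑ i, y i ^ 2) • e5 := by
      rw [← hsum y]
      ext k
      fin_cases k <;> simp [chart, e5, spaceIncl]
    rw [coe_smul, hx, hx', map_add, map_smul, hg]
    congr 1
    ext k
    refine Fin.lastCases ?_ (fun j => ?_) k
    · exact spatial_four hg _
    · rw [spaceIncl_castSucc]; rfl
  rw [hypVol_apply (measurable_smul_H4 g hS), hypVol_apply hS]
  have hmap' := lintegral_map (μ := volume)
    ((measurable_indicator_chart hS).mul measurable_density) hm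
  rw [hmap] at hmap'
  refine Eq.trans ?_ hmap'.symm
  refine lintegral_congr fun y => ?_
  simp only [Pi.mul_apply]
  rw [hsum, ← hchart]
  rfl

/-- The hyperbolic volume is invariant under all isometries. -/
theorem preservesVol (g : posLorentz) : PreservesVol g := by
  obtain ⟨p, hp⟩ : ∃ p, p = g • base := ⟨_, rfl⟩
  have hn : 0 < p.1 4 - p.1 0 := by
    rw [← neg_lor_vertex_17]
    linarith [p.lor_light_neg (vertex_mem_lightCone 17)]
  -- The similarity with `a = 1/n` and translation `-y/n` brings `g • base`, with coordinates `(n,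
  -- y)`, back to the centre `(1, 0)`. It factors `g` through an isometry fixing the centre.
  set c : Fin 3 → ℝ := -(p.1 4 - p.1 0)⁻¹ • ![p.1 1, p.1 2, p.1 3] with hc
  have ha := inv_pos.mpr hn
  have hfix : (horoMap ha c * g) • base = base := by
    have h0 := horoMap_smul ha c hn ![p.1 1, p.1 2, p.1 3]
    rw [← eq_horoChart p] at h0
    rw [mul_smul, ← hp, h0]
    have h1 : (![p.1 1, p.1 2, p.1 3] : Fin 3 → ℝ) + (p.1 4 - p.1 0) • c = 0 := by
      rw [hc, smul_smul, mul_neg, mul_inv_cancel₀ hn.ne', neg_one_smul, add_neg_cancel]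
    rw [h1, inv_mul_cancel₀ hn.ne']
    apply H4.ext
    rw [horoChart_val one_pos]
    ext k
    fin_cases k <;> simp [base, e5]
  have h1 : (horoMap ha c * g).1 e5 = e5 := congrArg Subtype.val hfix
  have h2 : g = (horoMap ha c)⁻¹ * (horoMap ha c * g) := by group
  rw [h2]
  exact (preservesVol_horoMap ha c).inv.mul (preservesVol_of_fixes h1)

theorem hypVol_smul (g : posLorentz) {S : Set H4} (hS : MeasurableSet S) :
    hypVol (g • S) = hypVol S := by
  rw [← preservesVol g⁻¹ S hS]
  congr 1
  ext x
  rw [Set.mem_smul_set_iff_inv_smul_mem]; rfl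

theorem measurableSet_smul (g : posLorentz) {S : Set H4} (hS : MeasurableSet S) :
    MeasurableSet (g • S) := by
  have : g • S = (fun x : H4 => g⁻¹ • x) ⁻¹' S := by
    ext x
    rw [Set.mem_smul_set_iff_inv_smul_mem]; rfl
  rw [this]
  exact measurable_smul_H4 g⁻¹ hS

/-! ### The volume of the maximum cusp -/

/-- The integrand `8 n²` is the volume `(2n)³` of the cube times the density `1/n`. -/
theorem lintegral_cusp :
    ∫⁻ n in Ioi (0 : ℝ), (Iio (1 / 2 : ℝ)).indicator (fun n => ENNReal.ofReal (8 * n ^ 2)) n =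
      3⁻¹ := by
  rw [lintegral_indicator measurableSet_Iio, Measure.restrict_restrict measurableSet_Iio,
    Set.inter_comm, Ioi_inter_Iio, Measure.restrict_congr_set Ioo_ae_eq_Ioc,
    ← ofReal_integral_eq_lintegral_ofReal, ← intervalIntegral.integral_of_le (by norm_num)]
  · rw [intervalIntegral.integral_const_mul, integral_pow]
    rw [show (8 : ℝ) * (((1 / 2) ^ (2 + 1) - 0 ^ (2 + 1)) / ((2 : ℕ) + 1)) = 3⁻¹ by norm_num,
      ENNReal.ofReal_inv_of_pos (by norm_num)]
    norm_num
  · exact (Continuous.integrableOn_Icc (by fun_prop)).mono_set Ioc_subset_Icc_self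
  · exact Filter.Eventually.of_forall fun n => by positivity

theorem hypVol_eq_third {S : Set H4} (hS : MeasurableSet S) (B : ℝ → Set (Fin 3 → ℝ))
    (hB : ∀ n, MeasurableSet (B n)) (hvol : ∀ n, volume (B n) = ENNReal.ofReal (2 * n) ^ 3)
    (h : ∀ n, 0 < n → ∀ y, horoChart n y ∈ S ↔ n < 1 / 2 ∧ y ∈ B n) : hypVol S = 3⁻¹ := by
  rw [hypVol_eq_horo hS, ← lintegral_cusp]
  refine setLIntegral_congr_fun measurableSet_Ioi fun n hn => ?_
  have hn : 0 < n := hn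
  by_cases hn2 : n < 1 / 2
  · have h1 : ∀ y, S.indicator (1 : H4 → ℝ≥0∞) (horoChart n y) = (B n).indicator 1 y := by
      intro y
      by_cases hy : y ∈ B n
      · rw [indicator_of_mem hy, indicator_of_mem ((h n hn y).mpr ⟨hn2, hy⟩)]; rfl
      · rw [indicator_of_notMem hy, indicator_of_notMem fun hc => hy ((h n hn y).mp hc).2]
    rw [lintegral_congr h1, lintegral_indicator_one (hB n), hvol, indicator_of_mem (mem_Iio.mpr hn2),
      ← ENNReal.ofReal_pow (by positivity), ← ENNReal.ofReal_mul (by positivity)]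
    congr 1
    field_simp
    ring
  · have h1 : ∀ y, S.indicator (1 : H4 → ℝ≥0∞) (horoChart n y) = 0 := fun y =>
      indicator_of_notMem (fun hc => hn2 ((h n hn y).mp hc).1) _
    rw [lintegral_congr h1, lintegral_zero, mul_zero, indicator_of_notMem (by simpa using hn2)]

theorem measurable_coord (k : Fin 5) : Measurable fun x : H4 => x.1 k :=
  (measurable_pi_apply k).comp measurable_subtype_coe

theorem measurable_lor (w : Fin 5 → ℝ) : Measurable fun x : H4 => lor x.1 w := by
  have m := fun k => (measurable_coord k).mul_const (w k)
  exact ((((m 0).add (m 1)).add (m 2)).add (m 3)).sub (m 4)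

theorem measurableSet_lor_lt (w : Fin 5 → ℝ) (t : ℝ) : MeasurableSet {x : H4 | lor x.1 w < t} :=
  measurableSet_lt (measurable_lor w) measurable_const

theorem measurableSet_lor_le (w : Fin 5 → ℝ) (t : ℝ) : MeasurableSet {x : H4 | lor x.1 w ≤ t} :=
  measurableSet_le (measurable_lor w) measurable_const

theorem measurableSet_Q : MeasurableSet Q := by
  have : Q = ⋂ i, {x : H4 | lor x.1 (sideNormal i) ≤ 0} := by ext x; simp [Q]
  rw [this]
  exact MeasurableSet.iInter fun i => measurableSet_lor_le _ _

theorem measurableSet_horoball (u : Fin 5 → ℝ) : MeasurableSet (horoball u) :=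
  measurableSet_lt measurable_const (measurable_lor u)

/-- The interior of the 24-cell. -/
def openQ : Set H4 := {x | ∀ i, lor x.1 (sideNormal i) < 0}

theorem openQ_subset : openQ ⊆ Q := fun _ hx i => (hx i).le

theorem measurableSet_openQ : MeasurableSet openQ := by
  have : openQ = ⋂ i, {x : H4 | lor x.1 (sideNormal i) < 0} := by ext x; simp [openQ]
  rw [this]
  exact MeasurableSet.iInter fun i => measurableSet_lor_lt _ _

theorem frame_smul_mem_openQ (d : Fin 24) {x : H4} : frame d • x ∈ openQ ↔ x ∈ openQ := by
  have key : ∀ i, lor (frame d • x).1 (sideNormal (framePerm d i)) = lor x.1 (sideNormal i) := by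
    intro i
    rw [coe_smul, ← frame_side, lor_val]
  constructor
  · intro hx i
    rw [← key]; exact hx _
  · intro hx i
    obtain ⟨j, rfl⟩ := (framePerm_isSym d).bijective.2 i
    rw [key]; exact hx j

/-- The part of the 24-cell inside the horoball of height `1/2` at an ideal vertex. -/
def cuspPart (d : Fin 24) : Set H4 := Q ∩ horoball ((2 : ℝ) • idealVertex d)

/-- The interior of the part of the 24-cell inside a horoball of height `1/2`. -/
def openCuspPart (d : Fin 24) : Set H4 := openQ ∩ horoball ((2 : ℝ) • idealVertex d)

theorem measurableSet_cuspPart (d : Fin 24) : MeasurableSet (cuspPart d) :=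
  measurableSet_Q.inter (measurableSet_horoball _)

theorem measurableSet_openCuspPart (d : Fin 24) : MeasurableSet (openCuspPart d) :=
  measurableSet_openQ.inter (measurableSet_horoball _)

theorem frame_smul_mem_horoball (d : Fin 24) {x : H4} :
    frame d • x ∈ horoball ((2 : ℝ) • idealVertex d) ↔ x ∈ horoball ((2 : ℝ) • idealVertex 17) := by
  rw [SidePairing.mem_horoball_two, SidePairing.mem_horoball_two, coe_smul, ← frame_vertex, lor_val]

theorem frame_smul_cuspPart (d : Fin 24) : frame d • cuspPart 17 = cuspPart d := by
  ext x
  rw [mem_smul_set_iff_inv_smul_mem, cuspPart, cuspPart, mem_inter_iff, mem_inter_iff,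
    ← frame_smul_mem_Q d, ← frame_smul_mem_horoball d, smul_inv_smul]

theorem frame_smul_openCuspPart (d : Fin 24) : frame d • openCuspPart 17 = openCuspPart d := by
  ext x
  rw [mem_smul_set_iff_inv_smul_mem, openCuspPart, openCuspPart, mem_inter_iff, mem_inter_iff,
    ← frame_smul_mem_openQ d, ← frame_smul_mem_horoball d, smul_inv_smul]

theorem horoChart_four_sub_zero {n : ℝ} (hn : 0 < n) (y : Fin 3 → ℝ) :
    (horoChart n y).1 4 - (horoChart n y).1 0 = n := by
  rw [horoChart_val hn]
  simp only [Matrix.cons_val]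
  field_simp
  ring

theorem horoChart_one {n : ℝ} (hn : 0 < n) (y : Fin 3 → ℝ) : (horoChart n y).1 1 = y 0 := by
  rw [horoChart_val hn]; rfl

theorem horoChart_two {n : ℝ} (hn : 0 < n) (y : Fin 3 → ℝ) : (horoChart n y).1 2 = y 1 := by
  rw [horoChart_val hn]; rfl

theorem horoChart_three {n : ℝ} (hn : 0 < n) (y : Fin 3 → ℝ) : (horoChart n y).1 3 = y 2 := by
  rw [horoChart_val hn]; rfl

/-- A symmetry moves the vertex to `e₁ + e₅`, where the levels lie in closed cubes. The matching
lower bound uses open cubes, so the walls of `Q` need not be shown to be null sets. -/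
theorem hypVol_cuspPart_le (d : Fin 24) : hypVol (cuspPart d) ≤ 3⁻¹ := by
  rw [← frame_smul_cuspPart, hypVol_smul _ (measurableSet_cuspPart 17)]
  set A : Set H4 := {x | x.1 4 - x.1 0 < 1 / 2 ∧ |x.1 1| ≤ x.1 4 - x.1 0 ∧
    |x.1 2| ≤ x.1 4 - x.1 0 ∧ |x.1 3| ≤ x.1 4 - x.1 0} with hA
  have hsub : cuspPart 17 ⊆ A := by
    intro x hx
    refine ⟨?_, abs_le_of_sides fun i _ => hx.1 i⟩
    rw [← neg_lor_vertex_17, ← SidePairing.mem_horoball_two]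
    exact hx.2
  refine (measure_mono hsub).trans (le_of_eq ?_)
  have m := fun k => measurable_coord k
  have ma := fun k => (measurable_coord k).abs
  have m40 := (m 4).sub (m 0)
  have hAm : MeasurableSet A :=
    (measurableSet_lt m40 measurable_const).inter ((measurableSet_le (ma 1) m40).inter
      ((measurableSet_le (ma 2) m40).inter (measurableSet_le (ma 3) m40)))
  refine hypVol_eq_third hAm (fun n => Icc (fun _ => -n) fun _ => n)
    (fun n => measurableSet_Icc) (fun n => ?_) fun n hn y => ?_
  · rw [Real.volume_Icc_pi]
    simp only [Finset.prod_const, Finset.card_univ, Fintype.card_fin]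
    congr 2
    ring
  · simp only [hA, mem_ofPred_eq, horoChart_four_sub_zero hn, horoChart_one hn, horoChart_two hn,
      horoChart_three hn, mem_Icc, Pi.le_def, Fin.forall_fin_succ, abs_le]
    simp
    tauto

theorem le_hypVol_openCuspPart (d : Fin 24) : 3⁻¹ ≤ hypVol (openCuspPart d) := by
  rw [← frame_smul_openCuspPart, hypVol_smul _ (measurableSet_openCuspPart 17)]
  set A : Set H4 := {x | x.1 4 - x.1 0 < 1 / 2 ∧ |x.1 1| < x.1 4 - x.1 0 ∧
    |x.1 2| < x.1 4 - x.1 0 ∧ |x.1 3| < x.1 4 - x.1 0} with hA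
  have hsub : A ⊆ openCuspPart 17 := by
    rintro x ⟨h0, h1, h2, h3⟩
    refine ⟨fun i => lor_neg_of_abs_lt h0 h1 h2 h3 i, ?_⟩
    rw [SidePairing.mem_horoball_two, neg_lor_vertex_17]
    exact h0
  refine (le_of_eq ?_).trans (measure_mono hsub)
  have m := fun k => measurable_coord k
  have ma := fun k => (measurable_coord k).abs
  have m40 := (m 4).sub (m 0)
  have hAm : MeasurableSet A :=
    (measurableSet_lt m40 measurable_const).inter ((measurableSet_lt (ma 1) m40).inter
      ((measurableSet_lt (ma 2) m40).inter (measurableSet_lt (ma 3) m40)))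
  refine (hypVol_eq_third hAm (fun n => univ.pi fun _ => Ioo (-n) n)
    (fun n => MeasurableSet.univ_pi fun _ => measurableSet_Ioo) (fun n => ?_)
    fun n hn y => ?_).symm
  · rw [Real.volume_pi_Ioo]
    simp only [Finset.prod_const, Finset.card_univ, Fintype.card_fin]
    congr 2
    ring
  · simp only [hA, mem_ofPred_eq, horoChart_four_sub_zero hn, horoChart_one hn, horoChart_two hn,
      horoChart_three hn, mem_univ_pi, mem_Ioo, Fin.forall_fin_succ, abs_lt]
    simp

theorem hypVol_iUnion_cuspPart_le : hypVol (⋃ d, cuspPart d) ≤ 8 := by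
  refine (measure_iUnion_fintype_le _ _).trans ((Finset.sum_le_sum fun d _ =>
    hypVol_cuspPart_le d).trans (le_of_eq ?_))
  rw [Finset.sum_const, Finset.card_univ, Fintype.card_fin, nsmul_eq_mul, ← div_eq_mul_inv,
    show ((24 : ℕ) : ℝ≥0∞) = 8 * 3 by norm_num]
  exact ENNReal.mul_div_cancel_right (by norm_num) (by norm_num)

theorem le_hypVol_iUnion_openCuspPart : 8 ≤ hypVol (⋃ d, openCuspPart d) := by
  rw [measure_iUnion (fun a b hab => ?_) measurableSet_openCuspPart, tsum_fintype]
  · refine (le_of_eq ?_).trans (Finset.sum_le_sum fun d _ => le_hypVol_openCuspPart d)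
    rw [Finset.sum_const, Finset.card_univ, Fintype.card_fin, nsmul_eq_mul, ← div_eq_mul_inv,
      show ((24 : ℕ) : ℝ≥0∞) = 8 * 3 by norm_num]
    exact (ENNReal.mul_div_cancel_right (by norm_num) (by norm_num)).symm
  · rw [Function.onFun, Set.disjoint_left]
    intro x ha hb
    exact hab (vertex_eq_of_lt ((SidePairing.mem_horoball_two x).mp ha.2) ((SidePairing.mem_horoball_two x).mp hb.2))

namespace SidePairing

variable {Φ : SidePairing}

/-- Each elementary identification has both its points on sides, so an interior point is identified
only with itself. -/
theorem eq_of_eqvGen {x y : H4} (h : Relation.EqvGen Φ.Paired x y) :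
    (x ∈ openQ ∨ y ∈ openQ) → x = y := by
  induction h with
  | rel x y h =>
    obtain ⟨i, hx, rfl⟩ := h
    rintro (h1 | h1)
    · exact absurd hx.2 (h1 i).ne
    · have : Φ.g i • x ∈ side (Φ.partner i) := by
        rw [← Φ.smul_side]
        exact smul_mem_smul_set hx
      exact absurd this.2 (h1 _).ne
  | refl x => exact fun _ => rfl
  | symm x y _ ih => exact fun h1 => (ih h1.symm).symm
  | trans x y z _ _ ih1 ih2 =>
    rintro (h1 | h1)
    · have := ih1 (Or.inl h1)
      exact this.trans (ih2 (Or.inl (this ▸ h1)))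
    · have := ih2 (Or.inr h1)
      exact (ih1 (Or.inr (this ▸ h1))).trans this

/-- The 24 open pieces together inject into the quotient, because interior points of `Q` are
inequivalent; single-cuspedness puts all of them into the image of one horoball. -/
theorem le_quotientVol (hΦ : Φ.YieldsManifold) (h1 : OneCusped Φ.group) :
    8 ≤ quotientVol Φ.group (proj Φ.group '' horoball ((2 : ℝ) • idealVertex 17)) := by
  refine le_hypVol_iUnion_openCuspPart.trans ?_
  refine le_iSup_of_le (⋃ d, openCuspPart d) (le_iSup_of_le
    (MeasurableSet.iUnion measurableSet_openCuspPart) (le_iSup_of_le ?_ (le_iSup_of_le ?_ le_rfl)))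
  · intro x hx y hy h
    rw [mem_iUnion] at hx hy
    obtain ⟨a, hx⟩ := hx
    obtain ⟨b, hy⟩ := hy
    exact eq_of_eqvGen (hΦ.injective x (openQ_subset hx.1) y (openQ_subset hy.1)
      (proj_eq_iff.mp h)) (Or.inl hx.1)
  · intro x hx
    rw [mem_iUnion] at hx
    obtain ⟨a, hx⟩ := hx
    obtain ⟨γ, hγ, h⟩ := exists_map_vertex_vertex hΦ h1 (isVertexImage_vertex Φ.group a)
      (isVertexImage_vertex Φ.group 17)
    refine ⟨γ • x, ?_, proj_smul hγ x⟩
    rw [mem_horoball_two, coe_smul, ← h, lor_val, ← mem_horoball_two]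
    exact hx.2

/-- Cut `E` along the translates of the union `D` of the 24 closed pieces and move each part into
`D`. The moved parts are disjoint because `E` injects into the quotient and the action is free. -/
theorem quotientVol_le (hΦ : Φ.YieldsManifold) :
    quotientVol Φ.group (proj Φ.group '' horoball ((2 : ℝ) • idealVertex 17)) ≤ 8 := by
  refine iSup_le fun E => iSup_le fun hE => iSup_le fun hinj => iSup_le fun hmaps => ?_
  refine le_trans ?_ hypVol_iUnion_cuspPart_le
  set D : Set H4 := ⋃ d, cuspPart d with hD
  have hDm : MeasurableSet D := MeasurableSet.iUnion measurableSet_cuspPart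
  have hc : Countable Φ.group :=
    (countable_of_properlyDiscontinuous Φ.group hΦ.properlyDiscontinuous).to_subtype
  have hcover : E ⊆ ⋃ γ : Φ.group, E ∩ γ.1⁻¹ • D := by
    intro x hx
    obtain ⟨y, hy, hxy⟩ := hmaps hx
    obtain ⟨δ, hδ, rfl⟩ := proj_eq_iff.mp hxy
    obtain ⟨γ, hγ, ⟨a, ha⟩, hQ⟩ := exists_smul_mem_Q_of_vertexImage hΦ.properlyDiscontinuous
      (isVertexImage_vertex Φ.group 17) ((mem_horoball_two y).mp hy)
    have hmem : γ • y ∈ D := by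
      refine mem_iUnion.mpr ⟨a, hQ, ?_⟩
      rw [mem_horoball_two, coe_smul, ← ha, lor_val, ← mem_horoball_two]
      exact hy
    refine mem_iUnion.mpr ⟨⟨γ * δ⁻¹, mul_mem hγ (inv_mem hδ)⟩, hx, ?_⟩
    rw [mem_smul_set_iff_inv_smul_mem, inv_inv, mul_smul, inv_smul_smul]
    exact hmem
  have hpiece : ∀ γ : posLorentz, hypVol (E ∩ γ⁻¹ • D) = hypVol (γ • E ∩ D) := by
    intro γ
    rw [← hypVol_smul γ (hE.inter (measurableSet_smul _ hDm)), smul_set_inter, smul_inv_smul]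
  calc hypVol E ≤ hypVol (⋃ γ : Φ.group, E ∩ γ.1⁻¹ • D) := measure_mono hcover
    _ ≤ ∑' γ : Φ.group, hypVol (E ∩ γ.1⁻¹ • D) := measure_iUnion_le _
    _ = ∑' γ : Φ.group, hypVol (γ.1 • E ∩ D) := tsum_congr fun γ => hpiece γ.1
    _ = hypVol (⋃ γ : Φ.group, γ.1 • E ∩ D) := by
      refine (measure_iUnion ?_ fun γ => (measurableSet_smul _ hE).inter hDm).symm
      intro γ δ hne
      rw [Function.onFun, Set.disjoint_left]
      rintro x ⟨h1, -⟩ ⟨h2, -⟩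
      rw [mem_smul_set_iff_inv_smul_mem] at h1 h2
      have heq : γ.1⁻¹ • x = δ.1⁻¹ • x := hinj h1 h2 (by
        rw [proj_smul (inv_mem γ.2), proj_smul (inv_mem δ.2)])
      have hfix : (γ.1 * δ.1⁻¹) • x = x := by
        rw [mul_smul, ← heq, smul_inv_smul]
      have := hΦ.free _ (mul_mem γ.2 (inv_mem δ.2)) x hfix
      exact hne (Subtype.ext (mul_inv_eq_one.mp this))
    _ ≤ hypVol D := measure_mono (iUnion_subset fun γ => inter_subset_right)

theorem maximumCuspHasVolume (hΦ : Φ.YieldsManifold) (h1 : OneCusped Φ.group) :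
    MaximumCuspHasVolume Φ.group 8 :=
  ⟨_, (isMaximumCusp_iff hΦ h1).mpr rfl, fun _ h => (isMaximumCusp_iff hΦ h1).mp h,
    le_antisymm (quotientVol_le hΦ) (le_quotientVol hΦ h1)⟩

end SidePairing

/-! ### Gluing the 24-cell by symmetries followed by reflections -/

/-- The sides `i` and `j` are orthogonal. -/
def Orth (i j : Fin 24) : Prop := lorZ (sideInt i) (sideInt j) = 0

instance (i j : Fin 24) : Decidable (Orth i j) := by unfold Orth; infer_instance

theorem orth_iff {i j : Fin 24} : Orth i j ↔ lor (sideNormal i) (sideNormal j) = 0 := by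
  rw [lor_side_side, Orth]
  exact Int.cast_eq_zero.symm

theorem Orth.symm {i j : Fin 24} (h : Orth i j) : Orth j i := by
  rw [orth_iff] at h ⊢
  rw [lor_comm, h]

/-- Two sides with a common point, or with a common point beyond them, are equal or orthogonal. -/
theorem eq_or_orth {x : H4} {i j : Fin 24} (hi : 0 ≤ lor x.1 (sideNormal i))
    (hj : 0 ≤ lor x.1 (sideNormal j)) : i = j ∨ Orth i j := by
  by_cases h : i = j
  · exact Or.inl h
  · rcases lor_side_of_ne h with h0 | h0
    · exact Or.inr (orth_iff.mpr h0)
    -- If the product of the normals is at most `-1`, their sum is a future vector that is not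
    -- spacelike, so its product with `x` is negative and `x` cannot be beyond both sides.
    · have := lor_neg_of_future x.timelike x.four_pos (u := sideNormal i + sideNormal j) (by
        simp only [lor_add_left, lor_add_right, lor_side_self, lor_comm (sideNormal j)]
        linarith) (by rw [Pi.add_apply, side_four, side_four]; norm_num)
      rw [lor_add_right] at this
      linarith

/-- Combinatorial data of a gluing: the `i`-th side is moved by the symmetry that permutes the sides
by `κ i`, followed by the reflection in the side `κ i i`. The cycle condition says that the four
copies of the 24-cell around each ridge fit together. -/
structure IsGluing (κ : Fin 24 → Fin 24 → Fin 24) : Prop where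
  isSym : ∀ i, IsSym (κ i)
  ne : ∀ i, κ i i ≠ i
  inv : ∀ i j, κ (κ i i) (κ i j) = j
  ridge : ∀ i j, Orth i j → ∀ l, κ (κ i j) (κ i l) = κ (κ j i) (κ j l)

instance (κ : Fin 24 → Fin 24 → Fin 24) : Decidable (IsGluing κ) :=
  decidable_of_iff ((∀ i, IsSym (κ i)) ∧ (∀ i, κ i i ≠ i) ∧ (∀ i j, κ (κ i i) (κ i j) = j) ∧
    ∀ i j, Orth i j → ∀ l, κ (κ i j) (κ i l) = κ (κ j i) (κ j l))
    ⟨fun h => ⟨h.1, h.2.1, h.2.2.1, h.2.2.2⟩, fun h => ⟨h.1, h.2, h.3, h.4⟩⟩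

theorem posLorentz_ext_side {g h : posLorentz}
    (H : ∀ j, g.1 (sideNormal j) = h.1 (sideNormal j)) : g = h := by
  refine posLorentz_ext fun x => ?_
  have key : (h⁻¹ * g).1 x = x := by
    refine eq_of_lor_side fun j => ?_
    have h1 : (h⁻¹ * g).1 (sideNormal j) = sideNormal j := by
      rw [mul_val_apply, H, inv_val_apply_self]
    calc lor ((h⁻¹ * g).1 x) (sideNormal j)
        = lor ((h⁻¹ * g).1 x) ((h⁻¹ * g).1 (sideNormal j)) := by rw [h1]
      _ = lor x (sideNormal j) := lor_val _ _ _
  calc g.1 x = h.1 ((h⁻¹ * g).1 x) := by rw [mul_val_apply, val_apply_inv_self]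
    _ = h.1 x := by rw [key]

theorem sym_mul_refl {π : Fin 24 → Fin 24} (h : IsSym π) (j : Fin 24) :
    sym π h * refl j = refl (π j) * sym π h := by
  refine posLorentz_ext fun x => ?_
  rw [mul_val_apply, mul_val_apply, refl_apply, refl_apply, map_sub, map_smul, sym_side,
    ← sym_side h, lor_val]

theorem refl_mul_comm {i j : Fin 24} (h : Orth i j) : refl i * refl j = refl j * refl i := by
  refine posLorentz_ext fun x => ?_
  have h1 := orth_iff.mp h
  have h2 := orth_iff.mp h.symm
  rw [mul_val_apply, mul_val_apply]
  simp only [refl_apply, lor_sub_left, lor_smul_left, h1, h2]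
  module

variable {κ : Fin 24 → Fin 24 → Fin 24}

namespace IsGluing

theorem orth_map (h : IsGluing κ) {i j : Fin 24} (k : Fin 24) :
    Orth (κ k i) (κ k j) ↔ Orth i j := by
  rw [orth_iff, orth_iff, ← sym_side (h.isSym k), ← sym_side (h.isSym k), lor_val]

/-- The side-pairing transformations of a gluing. -/
def map (h : IsGluing κ) (i : Fin 24) : posLorentz := refl (κ i i) * sym (κ i) (h.isSym i)

theorem map_side_of_orth (h : IsGluing κ) {i j : Fin 24} (hij : Orth i j) :
    (h.map i).1 (sideNormal j) = sideNormal (κ i j) := by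
  rw [map, mul_val_apply, sym_side, refl_apply_of_orth]
  exact orth_iff.mp ((h.orth_map i).mpr hij.symm)

theorem map_side_self (h : IsGluing κ) (i : Fin 24) :
    (h.map i).1 (sideNormal i) = -sideNormal (κ i i) := by
  rw [map, mul_val_apply, sym_side, refl_side]

theorem lor_map_of_orth (h : IsGluing κ) {i j : Fin 24} (hij : Orth i j) (x : Fin 5 → ℝ) :
    lor ((h.map i).1 x) (sideNormal (κ i j)) = lor x (sideNormal j) := by
  rw [← h.map_side_of_orth hij, lor_val]

theorem lor_map_self (h : IsGluing κ) (i : Fin 24) (x : Fin 5 → ℝ) :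
    lor ((h.map i).1 x) (sideNormal (κ i i)) = -lor x (sideNormal i) := by
  rw [← neg_neg (sideNormal (κ i i)), ← h.map_side_self, lor_neg_right, lor_val]

theorem map_partner (h : IsGluing κ) (i : Fin 24) : h.map (κ i i) = (h.map i)⁻¹ := by
  rw [eq_inv_iff_mul_eq_one]
  have h1 : sym (κ (κ i i)) (h.isSym _) * sym (κ i) (h.isSym i) = 1 := by
    refine posLorentz_ext_side fun j => ?_
    rw [mul_val_apply, sym_side, sym_side, h.inv]; rfl
  rw [map, map, mul_assoc, ← mul_assoc (sym (κ (κ i i)) _), sym_mul_refl, mul_assoc, h1, mul_one,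
    h.inv, refl_mul_self]

/-- A reflection moved past a symmetry becomes the reflection in the image side. Both products then
have the same symmetry part, and their two reflections agree up to order; these commute as the sides
are orthogonal. -/
theorem map_cycle (h : IsGluing κ) {i j : Fin 24} (hij : Orth i j) :
    h.map (κ i j) * h.map i = h.map (κ j i) * h.map j := by
  have h1 : sym (κ (κ i j)) (h.isSym _) * sym (κ i) (h.isSym i) =
      sym (κ (κ j i)) (h.isSym _) * sym (κ j) (h.isSym j) := by
    refine posLorentz_ext_side fun l => ?_
    rw [mul_val_apply, mul_val_apply, sym_side, sym_side, sym_side, sym_side, h.ridge i j hij]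
  have h2 : ∀ a b, h.map (κ a b) * h.map a = refl (κ (κ a b) (κ a b)) * refl (κ (κ a b) (κ a a)) *
      (sym (κ (κ a b)) (h.isSym _) * sym (κ a) (h.isSym a)) := by
    intro a b
    rw [map, map, mul_assoc, ← mul_assoc (sym (κ (κ a b)) _), sym_mul_refl]
    simp only [mul_assoc]
  rw [h2, h2, h1, h.ridge i j hij, h.ridge i j hij, refl_mul_comm]
  exact (h.orth_map _).mpr ((h.orth_map _).mpr hij.symm)

theorem map_smul_mem_side (h : IsGluing κ) {i : Fin 24} {x : H4} (hx : x ∈ side i) :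
    h.map i • x ∈ side (κ i i) := by
  have h1 : lor (sym (κ i) (h.isSym i) • x).1 (sideNormal (κ i i)) = 0 := by
    rw [coe_smul, ← sym_side (h.isSym i), lor_val]
    exact hx.2
  have h2 : h.map i • x = sym (κ i) (h.isSym i) • x := by
    apply H4.ext
    rw [map, mul_smul, coe_smul, refl_apply_of_orth h1]
  rw [h2]
  exact ⟨(sym_smul_mem_Q _).mpr hx.1, h1⟩

/-- The side-pairing of a gluing. -/
def toSidePairing (h : IsGluing κ) : SidePairing where
  partner i := κ i i
  g := h.map
  partner_ne := h.ne
  g_partner := h.map_partner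
  smul_side i := by
    refine Subset.antisymm ?_ fun x hx => ?_
    · rintro _ ⟨x, hx, rfl⟩
      exact h.map_smul_mem_side hx
    · rw [mem_smul_set_iff_inv_smul_mem, ← h.map_partner]
      have := h.map_smul_mem_side hx
      rwa [h.inv i i] at this
  inter i := by
    refine Subset.antisymm ?_ fun x hx => ⟨hx.1, ?_⟩
    · rintro _ ⟨hy, x, hx, rfl⟩
      refine ⟨hy, le_antisymm (hy _) ?_⟩
      have := h.lor_map_self i x.1
      have hx := hx i
      change 0 ≤ lor ((h.map i).1 x.1) _
      linarith
    · rw [mem_smul_set_iff_inv_smul_mem, ← h.map_partner]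
      exact (h.map_smul_mem_side hx).1

/-- The group generated by the side-pairing transformations. -/
def group (h : IsGluing κ) : Subgroup posLorentz := h.toSidePairing.group

theorem map_mem (h : IsGluing κ) (i : Fin 24) : h.map i ∈ h.group := h.toSidePairing.g_mem i

theorem group_induction (h : IsGluing κ) {P : posLorentz → Prop} (one : P 1)
    (mul : ∀ i δ, δ ∈ h.group → P δ → P (h.map i * δ)) {γ : posLorentz} (hγ : γ ∈ h.group) : P γ := by
  refine Subgroup.closure_induction_left (p := fun γ _ => P γ) one ?_ ?_ hγ
  · rintro _ ⟨i, rfl⟩ δ hδ hP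
    exact mul i δ hδ hP
  · rintro _ ⟨i, rfl⟩ δ hδ hP
    have := mul (κ i i) δ hδ hP
    rwa [h.map_partner] at this

theorem map_four (h : IsGluing κ) (i : Fin 24) (y : Fin 5 → ℝ) :
    ((h.map i).1 y) 4 = y 4 - 2 * lor y (sideNormal i) := h.toSidePairing.g_four i y

end IsGluing

/-! ### The invariant lattice and proper discontinuity of a gluing. -/

/-- The lattice that is spanned by the normal vectors of the sides. -/
def sideLattice : AddSubgroup (Fin 5 → ℝ) := AddSubgroup.closure (range sideNormal)

theorem side_mem_lattice (i : Fin 24) : sideNormal i ∈ sideLattice :=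
  AddSubgroup.subset_closure ⟨i, rfl⟩

theorem exists_int_lor {y : Fin 5 → ℝ} (hy : y ∈ sideLattice) (i : Fin 24) :
    ∃ n : ℤ, lor y (sideNormal i) = n := by
  induction hy using AddSubgroup.closure_induction with
  | mem x hx =>
    obtain ⟨j, rfl⟩ := hx
    exact ⟨_, lor_side_side j i⟩
  | zero => exact ⟨0, by rw [lor_zero_left]; norm_num⟩
  | add x y _ _ hx hy =>
    obtain ⟨m, hm⟩ := hx
    obtain ⟨n, hn⟩ := hy
    exact ⟨m + n, by rw [lor_add_left, hm, hn]; push_cast; rfl⟩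
  | neg x _ hx =>
    obtain ⟨m, hm⟩ := hx
    exact ⟨-m, by rw [lor_neg_left, hm]; push_cast; rfl⟩

theorem exists_int_coord {y : Fin 5 → ℝ} (hy : y ∈ sideLattice) (k : Fin 5) :
    ∃ n : ℤ, y k = n := by
  induction hy using AddSubgroup.closure_induction with
  | mem x hx =>
    obtain ⟨j, rfl⟩ := hx
    exact ⟨_, sideNormal_apply j k⟩
  | zero => exact ⟨0, by simp⟩
  | add x y _ _ hx hy =>
    obtain ⟨m, hm⟩ := hx
    obtain ⟨n, hn⟩ := hy
    exact ⟨m + n, by rw [Pi.add_apply, hm, hn]; push_cast; rfl⟩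
  | neg x _ hx =>
    obtain ⟨m, hm⟩ := hx
    exact ⟨-m, by rw [Pi.neg_apply, hm]; push_cast; rfl⟩

theorem lattice_zsmul_int {y : Fin 5 → ℝ} (hy : y ∈ sideLattice) (n : ℤ) :
    (n : ℝ) • y ∈ sideLattice := by
  rw [Int.cast_smul_eq_zsmul]
  exact sideLattice.zsmul_mem hy n

theorem refl_mem_lattice {y : Fin 5 → ℝ} (hy : y ∈ sideLattice) (i : Fin 24) :
    (refl i).1 y ∈ sideLattice := by
  obtain ⟨n, hn⟩ := exists_int_lor hy i
  rw [refl_apply, hn]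
  refine sideLattice.sub_mem hy ?_
  have := lattice_zsmul_int (side_mem_lattice i) (2 * n)
  push_cast at this
  exact this

theorem sym_mem_lattice {π : Fin 24 → Fin 24} (h : IsSym π) {y : Fin 5 → ℝ}
    (hy : y ∈ sideLattice) : (sym π h).1 y ∈ sideLattice := by
  induction hy using AddSubgroup.closure_induction with
  | mem x hx =>
    obtain ⟨j, rfl⟩ := hx
    rw [sym_side]
    exact side_mem_lattice _
  | zero => rw [map_zero]; exact sideLattice.zero_mem
  | add x y _ _ hx hy => rw [map_add]; exact sideLattice.add_mem hx hy
  | neg x _ hx => rw [map_neg]; exact sideLattice.neg_mem hx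

namespace IsGluing

variable (h : IsGluing κ)

theorem map_mem_lattice (i : Fin 24) {y : Fin 5 → ℝ} (hy : y ∈ sideLattice) :
    (h.map i).1 y ∈ sideLattice := refl_mem_lattice (sym_mem_lattice _ hy) _

theorem mem_lattice {γ : posLorentz} (hγ : γ ∈ h.group) {y : Fin 5 → ℝ} (hy : y ∈ sideLattice) :
    γ.1 y ∈ sideLattice := by
  exact h.group_induction (P := fun γ => γ.1 y ∈ sideLattice) hy
    (fun i δ _ ih => h.map_mem_lattice i ih) hγ

/-- A generator sends the centre to itself plus twice a side normal and preserves the lattice, so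
the class of the centre modulo twice the lattice is invariant. -/
theorem exists_smul_e5 {γ : posLorentz} (hγ : γ ∈ h.group) :
    ∃ y ∈ sideLattice, γ.1 e5 = e5 + (2 : ℝ) • y := by
  refine h.group_induction (P := fun γ => ∃ y ∈ sideLattice, γ.1 e5 = e5 + (2 : ℝ) • y)
    ⟨0, sideLattice.zero_mem, by rw [one_val_apply]; module⟩ ?_ hγ
  · rintro i δ _ ⟨y, hy, hδ⟩
    refine ⟨sideNormal (κ i i) + (h.map i).1 y,
      sideLattice.add_mem (side_mem_lattice _) (h.map_mem_lattice i hy), ?_⟩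
    have h1 : (h.map i).1 e5 = e5 + (2 : ℝ) • sideNormal (κ i i) := by
      rw [map, mul_val_apply, sym_e5, refl_apply, lor_e5_left, side_four]; module
    rw [mul_val_apply, hδ, map_add, map_smul, h1]; module

/-- The product is the odd integer `-1 + 2n`: the centre of a tile lies on no wall hyperplane of
`Q`. This makes perturbation towards the centre generic. -/
theorem lor_smul_e5_ne {γ : posLorentz} (hγ : γ ∈ h.group) (i : Fin 24) :
    lor (γ.1 e5) (sideNormal i) ≠ 0 := by
  obtain ⟨y, hy, hγ⟩ := h.exists_smul_e5 hγ
  obtain ⟨n, hn⟩ := exists_int_lor hy i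
  rw [hγ, lor_add_left, lor_smul_left, hn, lor_e5_left, side_four]
  intro h0
  have : (-1 + 2 * n : ℤ) = 0 := by exact_mod_cast h0
  omega

end IsGluing

theorem e5_eq_sides : e5 = (1 / 2 : ℝ) • (sideNormal 1 + sideNormal 4) := by
  ext k
  fin_cases k <;> simp [e5, sideNormal]
  norm_num

/-- The mirror image of the centre of the 24-cell in a side. -/
def mirror (i : Fin 24) : H4 := refl i • base

theorem mirror_val (i : Fin 24) : (mirror i).1 = e5 + (2 : ℝ) • sideNormal i := by
  rw [mirror, coe_smul, refl_apply, base, lor_e5_left, side_four]; module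

theorem mirror_four (i : Fin 24) : (mirror i).1 4 = 3 := by
  rw [mirror_val, Pi.add_apply, Pi.smul_apply, e5_four, side_four]; norm_num

theorem eq_of_mirror {g h : posLorentz} (H : ∀ i, g • mirror i = h • mirror i) : g = h := by
  have H' : ∀ i, g.1 e5 + (2 : ℝ) • g.1 (sideNormal i) = h.1 e5 + (2 : ℝ) • h.1 (sideNormal i) := by
    intro i
    have := congrArg Subtype.val (H i)
    rwa [coe_smul, coe_smul, mirror_val, map_add, map_smul, map_add, map_smul] at this
  have h5 : g.1 e5 = h.1 e5 := by
    have h1 := H' 1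
    have h4 := H' 4
    rw [e5_eq_sides, map_smul, map_smul, map_add, map_add] at *
    ext k
    have h1 := congrFun h1 k
    have h4 := congrFun h4 k
    simp only [Pi.add_apply, Pi.smul_apply, smul_eq_mul] at *
    linarith
  refine posLorentz_ext_side fun j => ?_
  have := H' j
  rw [h5] at this
  exact smul_right_injective _ two_ne_zero (add_left_cancel this)

theorem finite_int_vectors (B : ℝ) :
    {f : Fin 24 → Fin 5 → ℝ | ∀ i k, (∃ n : ℤ, f i k = n) ∧ |f i k| ≤ B}.Finite := by
  have h1 : {t : ℝ | (∃ n : ℤ, t = n) ∧ |t| ≤ B}.Finite := by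
    refine ((finite_Icc (-⌈B⌉) ⌈B⌉).image (fun n : ℤ => (n : ℝ))).subset ?_
    rintro _ ⟨⟨n, rfl⟩, hn⟩
    refine ⟨n, ?_, rfl⟩
    have := (abs_le.mp (hn.trans (Int.le_ceil B)))
    exact ⟨by exact_mod_cast this.1, by exact_mod_cast this.2⟩
  exact Set.Finite.pi' fun i => Set.Finite.pi' fun k => h1

namespace IsGluing

variable (h : IsGluing κ)

theorem exists_int_smul_mirror {γ : posLorentz} (hγ : γ ∈ h.group) (i : Fin 24) (k : Fin 5) :
    ∃ n : ℤ, (γ • mirror i).1 k = n := by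
  obtain ⟨y, hy, h5⟩ := h.exists_smul_e5 hγ
  obtain ⟨a, ha⟩ := exists_int_coord hy k
  obtain ⟨b, hb⟩ := exists_int_coord (h.mem_lattice hγ (side_mem_lattice i)) k
  obtain ⟨c, hc⟩ : ∃ c : ℤ, e5 k = c := ⟨if k = 4 then 1 else 0, by
    fin_cases k <;> simp [e5]⟩
  refine ⟨c + 2 * a + 2 * b, ?_⟩
  rw [coe_smul, mirror_val, map_add, map_smul, h5]
  simp only [Pi.add_apply, Pi.smul_apply, smul_eq_mul, ha, hb, hc]
  push_cast; ring

/-- An element is determined by the images of the 24 mirror points. These are integral vectors, and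
two triangle inequalities bound their heights; the factor 3 is the height of a mirror point. -/
theorem finite_near (R : ℝ) :
    {γ : posLorentz | γ ∈ h.group ∧ ∃ x : H4, x.1 4 ≤ R ∧ (γ • x).1 4 ≤ R}.Finite := by
  refine Set.Finite.of_finite_image (f := fun γ i => (γ • mirror i).1)
    ((finite_int_vectors (2 * (R * (2 * (R * 3))))).subset ?_) ?_
  · rintro _ ⟨γ, ⟨hγ, x, hx, hx'⟩, rfl⟩ i k
    refine ⟨h.exists_int_smul_mirror hγ i k, (abs_le_four _ k).trans ?_⟩
    refine (four_le_of_lor (γ • mirror i) (γ • x)).trans ?_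
    have h1 : -lor (γ • mirror i).1 (γ • x).1 ≤ 2 * (R * 3) := by
      rw [coe_smul, coe_smul, lor_val, lor_comm]
      refine (neg_lor_le x (mirror i)).trans ?_
      rw [mirror_four]
      linarith
    have h2 := (γ • x).four_pos
    have h3 : 0 ≤ R := x.four_pos.le.trans hx
    have h4 := (γ • mirror i).lor_le (γ • x)
    gcongr
    linarith
  · intro γ _ δ _ hγδ
    exact eq_of_mirror fun i => H4.ext (congrFun hγδ i)

theorem properlyDiscontinuous : ProperlyDiscontinuousSMul h.group H4 := by
  refine ⟨fun {K L} hK hL => ?_⟩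
  have hc : Continuous fun y : H4 => y.1 4 := (continuous_apply 4).comp continuous_val
  obtain ⟨R, hR⟩ := (hK.image hc).bddAbove
  obtain ⟨S, hS⟩ := (hL.image hc).bddAbove
  refine Set.Finite.of_finite_image (f := Subtype.val)
    ((h.finite_near (max R S)).subset ?_) Subtype.val_injective.injOn
  rintro _ ⟨γ, ⟨_, ⟨x, hx, rfl⟩, hL'⟩, rfl⟩
  exact ⟨γ.2, x, (hR ⟨x, hx, rfl⟩).trans (le_max_left _ _),
    (hS ⟨_, hL', rfl⟩).trans (le_max_right _ _)⟩

/-- In the lowest image of `x`, being beyond side `i` would let `h.map i` lower it further, by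
`map_four`. -/
theorem exists_smul_mem_Q (x : H4) : ∃ γ ∈ h.group, γ • x ∈ Q := by
  obtain ⟨γ, hγ, hmin⟩ := exists_min_four h.group h.properlyDiscontinuous x
    (S := h.group) subset_rfl ⟨1, h.group.one_mem⟩
  refine ⟨γ, hγ, fun i => ?_⟩
  have h1 := hmin (h.map i * γ) (h.group.mul_mem (h.map_mem i) hγ)
  have h2 := h.map_four i (γ • x).1
  rw [mul_smul] at h1
  change _ ≤ ((h.map i).1 (γ • x).1) 4 at h1
  linarith

end IsGluing

/-! ### The tessellation of a gluing -/

namespace IsGluing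

variable (h : IsGluing κ)

/-- Every point has arbitrarily close generic points, which lie on no wall of the tessellation. -/
theorem exists_generic (x : H4) (R : ℝ) : ∃ z : H4,
    (∀ γ ∈ h.group, ∀ i, lor (γ • z).1 (sideNormal i) ≠ 0) ∧ (x ∈ Q → z ∈ openQ) ∧
    ∀ γ ∈ h.group, (γ • x).1 4 ≤ R → ∀ i, lor (γ • x).1 (sideNormal i) < 0 →
      lor (γ • z).1 (sideNormal i) < 0 := by
  -- Moving `x` to the direction `x + ε e5`, each wall of each tile excludes one value of `ε`,
  -- because `lor_smul_e5_ne` makes the denominators nonzero. Countably many values are excluded.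
  set B : Set ℝ := ⋃ γ ∈ (h.group : Set posLorentz), ⋃ i,
    {-(lor (γ.1 x.1) (sideNormal i) / lor (γ.1 e5) (sideNormal i))} with hB
  have hBc : B.Countable := (countable_of_properlyDiscontinuous _ h.properlyDiscontinuous).biUnion
    fun γ _ => countable_iUnion fun i => countable_singleton _
  -- Only finitely many images of `x` have height at most `R`, so their strict inequalities survive
  -- for all small `ε`.
  have hev : ∀ᶠ ε in nhds (0 : ℝ), ∀ γ ∈ {γ | γ ∈ h.group ∧ (γ • x).1 4 ≤ R}, ∀ i,
      lor (γ • x).1 (sideNormal i) < 0 →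
      lor (γ.1 x.1) (sideNormal i) + ε * lor (γ.1 e5) (sideNormal i) < 0 := by
    rw [Filter.eventually_all_finite (finite_orbit_le _ h.properlyDiscontinuous x R)]
    intro γ _
    rw [Filter.eventually_all]
    intro i
    by_cases hneg : lor (γ • x).1 (sideNormal i) < 0
    · have hc : Continuous fun ε : ℝ =>
          lor (γ.1 x.1) (sideNormal i) + ε * lor (γ.1 e5) (sideNormal i) := by fun_prop
      refine (hc.tendsto 0).eventually (gt_mem_nhds ?_) |>.mono fun ε hε _ => hε
      rw [zero_mul, add_zero]
      exact hneg
    · exact Filter.Eventually.of_forall fun ε hε => absurd hε hneg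
  obtain ⟨r, hr, hball⟩ := Metric.eventually_nhds_iff.mp hev
  obtain ⟨ε, hεB, hε0, hεr⟩ := (hBc.dense_compl ℝ).exists_mem_open isOpen_Ioo
    (nonempty_Ioo.mpr hr)
  have hclose := hball (y := ε) (by rw [Real.dist_eq, sub_zero, abs_of_pos hε0]; exact hεr)
  have hx4 := x.four_pos
  have hz : lor (x.1 + ε • e5) (x.1 + ε • e5) < 0 := by
    simp only [lor_add_left, lor_add_right, lor_smul_left, lor_smul_right, x.lor_self,
      lor_comm e5 x.1, lor_e5_right, e5_four,
      Pi.add_apply, Pi.smul_apply, smul_eq_mul]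
    nlinarith
  have hz4 : 0 < (x.1 + ε • e5) 4 := by
    simp only [Pi.add_apply, Pi.smul_apply, e5_four, smul_eq_mul]; linarith
  have hc := inv_sqrt_pos hz
  have key : ∀ (γ : posLorentz) i, lor (γ • normalize _ hz hz4).1 (sideNormal i) =
      (√(-lor (x.1 + ε • e5) (x.1 + ε • e5)))⁻¹ *
        (lor (γ.1 x.1) (sideNormal i) + ε * lor (γ.1 e5) (sideNormal i)) := by
    intro γ i
    rw [coe_smul, normalize_val, map_smul, lor_smul_left, map_add, map_smul,
      lor_add_left (γ.1 x.1), lor_smul_left]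
  refine ⟨normalize _ hz hz4, fun γ hγ i h0 => ?_, fun hxQ i => ?_, fun γ hγ hR i hneg => ?_⟩
  · rw [key] at h0
    have h1 := (mul_eq_zero.mp h0).resolve_left hc.ne'
    refine hεB (mem_iUnion₂.mpr ⟨γ, hγ, mem_iUnion.mpr ⟨i, ?_⟩⟩)
    have h2 := h.lor_smul_e5_ne hγ i
    rw [mem_singleton_iff]
    field_simp
    linarith
  · have h1 := key 1 i
    rw [one_smul] at h1
    rw [h1, one_val_apply, one_val_apply, lor_e5_left, side_four]
    have := hxQ i
    exact mul_neg_of_pos_of_neg hc (by linarith)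
  · rw [key]
    exact mul_neg_of_pos_of_neg hc (hclose γ ⟨hγ, hR⟩ i hneg)

/-- Two copies of the 24-cell share a side, and `z` lies beyond this side as seen from the first. -/
def Step (z : H4) (γ δ : posLorentz) : Prop :=
  ∃ i, 0 < lor (γ • z).1 (sideNormal i) ∧ δ = h.map i * γ

/-- If a point is beyond two different sides, these are orthogonal. Crossing one keeps it beyond the
image of the other, and the two orders of crossing agree by `map_cycle`. -/
theorem step_diamond {z : H4} {a b c : posLorentz} (hb : h.Step z a b) (hc : h.Step z a c) :
    ∃ d, Relation.ReflGen (h.Step z) b d ∧ Relation.ReflTransGen (h.Step z) c d := by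
  obtain ⟨i, hi, rfl⟩ := hb
  obtain ⟨j, hj, rfl⟩ := hc
  rcases eq_or_orth hi.le hj.le with rfl | hij
  · exact ⟨_, Relation.ReflGen.refl, Relation.ReflTransGen.refl⟩
  · refine ⟨h.map (κ i j) * (h.map i * a), Relation.ReflGen.single ⟨κ i j, ?_, rfl⟩,
      Relation.ReflTransGen.single ⟨κ j i, ?_, ?_⟩⟩
    · rw [mul_smul]
      exact hj.trans_eq (h.lor_map_of_orth hij _).symm
    · rw [mul_smul]
      exact hi.trans_eq (h.lor_map_of_orth hij.symm _).symm
    · rw [← mul_assoc, ← mul_assoc, h.map_cycle hij]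

/-- For generic `z`, multiplication by a generator is a step forwards or backwards, so every element
is joined to 1 by a zigzag. By the diamond property it has a common reduct with 1, and 1 is
irreducible because `z` is interior to `Q`. -/
theorem reflTransGen_step {z : H4} (hz : ∀ γ ∈ h.group, ∀ i, lor (γ • z).1 (sideNormal i) ≠ 0)
    (hzQ : z ∈ openQ) {γ : posLorentz} (hγ : γ ∈ h.group) :
    Relation.ReflTransGen (h.Step z) γ 1 := by
  have heq := Relation.equivalence_join_reflTransGen fun a b c => h.step_diamond (z := z) (a := a)
    (b := b) (c := c)
  have hjoin : Relation.Join (Relation.ReflTransGen (h.Step z)) γ 1 := by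
    refine h.group_induction (P := fun γ => Relation.Join (Relation.ReflTransGen (h.Step z)) γ 1)
      (heq.refl 1) (fun i δ hδ ih => ?_) hγ
    rcases (hz δ hδ i).lt_or_gt with h1 | h1
    · refine heq.trans ?_ ih
      refine ⟨δ, Relation.ReflTransGen.single ⟨κ i i, ?_, ?_⟩, Relation.ReflTransGen.refl⟩
      · rw [mul_smul]
        have := h.lor_map_self i (δ • z).1
        change 0 < lor ((h.map i).1 (δ • z).1) _
        linarith
      · rw [h.map_partner, inv_mul_cancel_left]
    · refine heq.trans (heq.symm ?_) ih
      exact ⟨h.map i * δ, Relation.ReflTransGen.single ⟨i, h1, rfl⟩, Relation.ReflTransGen.refl⟩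
  obtain ⟨d, h1, h2⟩ := hjoin
  rcases Relation.ReflTransGen.cases_head h2 with rfl | ⟨e, ⟨i, hi, -⟩, -⟩
  · exact h1
  · rw [one_smul] at hi
    exact absurd hi (hzQ i).not_gt

/-- `γ x` lies in the 24-cell, at height at most `R`. -/
def Good (x : H4) (R : ℝ) (γ : posLorentz) : Prop := γ ∈ h.group ∧ γ • x ∈ Q ∧ (γ • x).1 4 ≤ R

variable {h} {x z : H4} {R : ℝ} {γ : posLorentz}

/-- A wall crossed on the way to `z` contains the corresponding image of `x`, because `z` was chosen
to keep all strict inequalities of low images of `x`. -/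
theorem Good.lor_eq_zero (hγ : h.Good x R γ)
    (hz : ∀ γ ∈ h.group, (γ • x).1 4 ≤ R → ∀ i, lor (γ • x).1 (sideNormal i) < 0 →
      lor (γ • z).1 (sideNormal i) < 0) {i : Fin 24} (hi : 0 < lor (γ • z).1 (sideNormal i)) :
    lor (γ • x).1 (sideNormal i) = 0 := by
  refine le_antisymm (hγ.2.1 i) (not_lt.mp fun h1 => ?_)
  exact absurd (hz γ hγ.1 hγ.2.2 i h1) hi.le.not_gt

theorem Good.map_mul (hγ : h.Good x R γ) {i : Fin 24}
    (hi : lor (γ • x).1 (sideNormal i) = 0) : h.Good x R (h.map i * γ) := by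
  refine ⟨h.group.mul_mem (h.map_mem i) hγ.1, ?_, ?_⟩
  · rw [mul_smul]
    exact (h.map_smul_mem_side ⟨hγ.2.1, hi⟩).1
  · rw [mul_smul]
    have := h.map_four i (γ • x).1
    rw [hi, mul_zero, sub_zero] at this
    exact this.trans_le hγ.2.2

theorem lor_map_smul_eq_zero (h : IsGluing κ) {y : H4} {i j : Fin 24}
    (hi : lor y.1 (sideNormal i) = 0) (hj : lor y.1 (sideNormal j) = 0) :
    lor (h.map i • y).1 (sideNormal (κ i j)) = 0 := by
  rcases eq_or_orth hi.ge hj.ge with rfl | hij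
  · rw [coe_smul, h.lor_map_self, hi, neg_zero]
  · rw [coe_smul, h.lor_map_of_orth hij, hj]

/-- Reduce `γ` to 1 by steps for a generic point near `x`. Each wall crossed contains the current
image of `x`, so each step is one of the prescribed identifications. -/
theorem eqvGen (h : IsGluing κ) {x y : H4} (hx : x ∈ Q) (hy : y ∈ Q) {γ : posLorentz}
    (hγ : γ ∈ h.group) (hxy : γ • x = y) : Relation.EqvGen h.toSidePairing.Paired x y := by
  obtain ⟨z, hz1, hz2, hz3⟩ := h.exists_generic x (y.1 4)
  have key : ∀ δ, Relation.ReflTransGen (h.Step z) δ 1 → h.Good x (y.1 4) δ →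
      Relation.EqvGen h.toSidePairing.Paired (δ • x) x := by
    intro δ hδ
    induction hδ using Relation.ReflTransGen.head_induction_on with
    | refl => intro _; rw [one_smul]; exact Relation.EqvGen.refl x
    | head hstep _ ih =>
      intro hg
      obtain ⟨i, hi, rfl⟩ := hstep
      have h0 := hg.lor_eq_zero hz3 hi
      refine Relation.EqvGen.trans _ _ _ (Relation.EqvGen.rel _ _ ⟨i, ⟨hg.2.1, h0⟩, ?_⟩)
        (ih (hg.map_mul h0))
      rw [mul_smul]; rfl
  have h1 := key γ (h.reflTransGen_step hz1 (hz2 hx) hγ) ⟨hγ, by rwa [hxy], by rw [hxy]⟩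
  rw [hxy] at h1
  exact h1.symm

/-- After the wall `i` is crossed, the walls still separating the tile from `z` come from walls
orthogonal to `i` that separated it before. Thus a whole path is described by sides of the initial
tile. -/
theorem exists_of_pos_map (hγ : h.Good x R γ)
    (hz : ∀ γ ∈ h.group, (γ • x).1 4 ≤ R → ∀ i, lor (γ • x).1 (sideNormal i) < 0 →
      lor (γ • z).1 (sideNormal i) < 0) {i l : Fin 24} (hi : 0 < lor (γ • z).1 (sideNormal i))
    (hl : 0 < lor ((h.map i * γ) • z).1 (sideNormal l)) :
    ∃ j, 0 < lor (γ • z).1 (sideNormal j) ∧ Orth i j ∧ l = κ i j := by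
  have h0 := hγ.lor_eq_zero hz hi
  have h1 := (hγ.map_mul h0).lor_eq_zero hz hl
  obtain ⟨j, rfl⟩ := (h.isSym i).bijective.2 l
  have h2 : lor ((h.map i * γ) • x).1 (sideNormal (κ i i)) = 0 := by
    rw [mul_smul]; exact lor_map_smul_eq_zero h h0 h0
  rcases eq_or_orth h2.ge h1.ge with heq | horth
  · rw [← heq, mul_smul] at hl
    have h3 := h.lor_map_self i (γ • z).1
    change 0 < lor ((h.map i).1 (γ • z).1) _ at hl
    linarith
  · have hij := (h.orth_map i).mp horth
    refine ⟨j, ?_, hij, rfl⟩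
    rw [mul_smul] at hl
    rwa [← h.lor_map_of_orth hij]

/-! ### Freeness of the action of a gluing. -/

/-- The sides `i` and `j` are equal or orthogonal. -/
def Touch (i j : Fin 24) : Prop := i = j ∨ Orth i j

instance (i j : Fin 24) : Decidable (Touch i j) := by unfold Touch; infer_instance

/-- The condition on the side-pairing cycles that excludes fixed points: the permutation of the sides
along a path from a copy of the 24-cell to a neighbouring copy through at most three walls does not
preserve any set of pairwise orthogonal sides that contains the walls. -/
def IsFree (κ : Fin 24 → Fin 24 → Fin 24) : Prop :=
  (∀ a, ∃ m : Fin 4, ¬Touch a ((κ a)^[m] a)) ∧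
  (∀ a b, Orth a b → ¬∀ p ∈ [a, b], ∀ q ∈ [a, b], Touch p (κ (κ a b) (κ a q))) ∧
  ∀ a b, Orth a b → ∀ c, Orth a c → Orth b c → ¬∀ p ∈ [a, b, c], ∀ q ∈ [a, b, c],
    Touch p (κ (κ (κ a b) (κ a c)) (κ (κ a b) (κ a q)))

set_option synthInstance.maxSize 1000 in
instance (κ : Fin 24 → Fin 24 → Fin 24) : Decidable (IsFree κ) := by
  unfold IsFree; infer_instance

/-- Four mutually orthogonal sides would meet at an ordinary vertex, and all vertices of `Q` are
ideal. -/
theorem not_four_orth : ∀ a b, Orth a b → ∀ c, Orth a c → Orth b c → ∀ d, Orth a d → Orth b d →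
    ¬Orth c d := by
  decide +kernel

/-- A path from `γ` to 1 crosses walls that come from pairwise orthogonal sides through `x`, so it
has at most three steps. As `γ` fixes `x` and the path ends at 1, the accumulated permutation sends
sides through `x` to sides through `x`, and any two of these are equal or orthogonal. `IsFree`
excludes this for paths of one, two or three steps. -/
theorem eq_one_of_fixes (h : IsGluing κ) (hκ : IsFree κ) {x : H4} (hx : x ∈ Q) {γ : posLorentz}
    (hγ : γ ∈ h.group) (hfix : γ • x = x) : γ = 1 := by
  obtain ⟨z, hz1, hz2, hz3⟩ := h.exists_generic x (x.1 4)
  have hgood : h.Good x (x.1 4) γ := ⟨hγ, by rwa [hfix], by rw [hfix]⟩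
  have hO : ∀ {i j}, lor x.1 (sideNormal i) = 0 → lor x.1 (sideNormal j) = 0 → Touch i j := fun hi hj => eq_or_orth hi.ge hj.ge
  have hI : ∀ {j}, 0 < lor (γ • z).1 (sideNormal j) → lor x.1 (sideNormal j) = 0 := by
    intro j hj
    have := hgood.lor_eq_zero hz3 hj
    rwa [hfix] at this
  have hne : ∀ {i j}, 0 < lor (γ • z).1 (sideNormal i) → 0 < lor (γ • z).1 (sideNormal j) →
      i ≠ j → Orth i j := fun hi hj hij => (hO (hI hi) (hI hj)).resolve_left hij
  rcases Relation.ReflTransGen.cases_head (h.reflTransGen_step hz1 (hz2 hx) hγ) with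
    h1 | ⟨_, ⟨a, ha, rfl⟩, hr1⟩
  · exact h1
  have hg1 := hgood.map_mul (hgood.lor_eq_zero hz3 ha)
  have hm1 : ∀ {j}, lor x.1 (sideNormal j) = 0 →
      lor ((h.map a * γ) • x).1 (sideNormal (κ a j)) = 0 := by
    intro j hj
    rw [mul_smul, hfix]
    exact lor_map_smul_eq_zero h (hI ha) hj
  rcases Relation.ReflTransGen.cases_head hr1 with h1 | ⟨_, ⟨s, hs, rfl⟩, hr2⟩
  -- Here `h.map a` is inverse to `γ` and fixes `x`, so every iterate of `κ a` applied to `a` is a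
  -- side through `x`.
  · obtain ⟨m, hm⟩ := hκ.1 a
    refine absurd (hO (hI ha) ?_) hm
    generalize m.val = n
    induction n with
    | zero => exact hI ha
    | succ n ih =>
      rw [Function.iterate_succ_apply']
      have := hm1 ih
      rwa [h1, one_smul] at this
  obtain ⟨b, hb, hab, rfl⟩ := exists_of_pos_map hgood hz3 ha hs
  have hg2 := hg1.map_mul (hg1.lor_eq_zero hz3 hs)
  have hm2 : ∀ {j}, lor x.1 (sideNormal j) = 0 →
      lor ((h.map (κ a b) * (h.map a * γ)) • x).1 (sideNormal (κ (κ a b) (κ a j))) = 0 := by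
    intro j hj
    rw [mul_smul]
    exact lor_map_smul_eq_zero h (hm1 (hI hb)) (hm1 hj)
  rcases Relation.ReflTransGen.cases_head hr2 with h1 | ⟨_, ⟨s, hs2, rfl⟩, hr3⟩
  · have hmem : ∀ q ∈ [a, b], lor x.1 (sideNormal q) = 0 := by
      simp only [List.mem_cons, List.not_mem_nil, or_false]
      rintro q (rfl | rfl) <;> exact hI ‹_›
    refine absurd (fun p hp q hq => hO (hmem p hp) ?_) (hκ.2.1 a b hab)
    have := hm2 (hmem q hq)
    rwa [h1, one_smul] at this
  obtain ⟨t, ht, hst, rfl⟩ := exists_of_pos_map hg1 hz3 hs hs2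
  obtain ⟨c, hc, hac, rfl⟩ := exists_of_pos_map hgood hz3 ha ht
  have hbc := (h.orth_map a).mp hst
  have hg3 := hg2.map_mul (hg2.lor_eq_zero hz3 hs2)
  have hm3 : ∀ {j}, lor x.1 (sideNormal j) = 0 →
      lor ((h.map (κ (κ a b) (κ a c)) * (h.map (κ a b) * (h.map a * γ))) • x).1
        (sideNormal (κ (κ (κ a b) (κ a c)) (κ (κ a b) (κ a j)))) = 0 := by
    intro j hj
    rw [mul_smul]
    exact lor_map_smul_eq_zero h (hm2 (hI hc)) (hm2 hj)
  rcases Relation.ReflTransGen.cases_head hr3 with h1 | ⟨_, ⟨s, hs3, rfl⟩, -⟩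
  · have hmem : ∀ q ∈ [a, b, c], lor x.1 (sideNormal q) = 0 := by
      simp only [List.mem_cons, List.not_mem_nil, or_false]
      rintro q (rfl | rfl | rfl) <;> exact hI ‹_›
    refine absurd (fun p hp q hq => hO (hmem p hp) ?_) (hκ.2.2 a b hab c hac hbc)
    have := hm3 (hmem q hq)
    rwa [h1, one_smul] at this
  obtain ⟨t, ht, h3t, rfl⟩ := exists_of_pos_map hg2 hz3 hs2 hs3
  obtain ⟨u, hu, h2u, rfl⟩ := exists_of_pos_map hg1 hz3 hs ht
  obtain ⟨d, hd, had, rfl⟩ := exists_of_pos_map hgood hz3 ha hu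
  exact absurd ((h.orth_map a).mp ((h.orth_map _).mp h3t))
    (not_four_orth a b hab c hac hbc d had ((h.orth_map a).mp h2u))

theorem yieldsManifold (h : IsGluing κ) (hκ : IsFree κ) : h.toSidePairing.YieldsManifold where
  properlyDiscontinuous := h.properlyDiscontinuous
  free γ hγ x hfix := by
    obtain ⟨δ, hδ, hQ⟩ := h.exists_smul_mem_Q x
    have h1 : δ * γ * δ⁻¹ = 1 := h.eq_one_of_fixes hκ hQ
      (h.group.mul_mem (h.group.mul_mem hδ hγ) (h.group.inv_mem hδ)) (by
        rw [mul_smul, mul_smul, inv_smul_smul, hfix])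
    rwa [mul_inv_eq_one, mul_eq_left] at h1
  surjective := h.exists_smul_mem_Q
  injective x hx y hy := fun ⟨_, hγ, hxy⟩ => h.eqvGen hx hy hγ hxy

end IsGluing

/-! ### The four side-pairings -/

/-- The permutations of the sides that belong to the side-pairings of the four tables. -/
def gluing (k : Fin 4) : Fin 24 → Fin 24 → Fin 24 := permCode (![
  446776194074984372373365645622251064952057871630945598281360469968324022054930198540972724995525788191259992525579269501368728618047207489066533599778179045463274400988145347036152802787471061877731702383138701262087908816244171585968639846473802808022036364169838604505405433688856296632135717284389523218313913230190716354476615668255850996682401385652804269800789148141345955725212323100684020477749647146881097236287717978391026065530030609143439697796774201338074486469850995974970600433456448116965162084206960021533795309267950870934427122473543581478949646671989813133685803549762042471338140873801062652845775570450427989018374455343626012770792769429961786882438437968742656290175037424611450793099095970856170749971558750241849764402341260258984524737157991047260723863890510897574536103513302308645733636159237271619324409758409562542226958348104054196487,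
  390812785701826216261839694483640171582994618786352719641554719389444375092381841434653074044471575246231197847172373417104036469830555585227644609332952631820852160010809268040500718549736405296707301758790777966989796546310352364211452037154200330928671293127521519294380842970626897782949775458730805024551834871839544215483775224151618590719290988887472382413097379226220624026517548954324981913448224579098629483744491606907139333691350002869229566708514190123567063292725340242177598352438700527314270861195435100025265925568690454801797449648730832880554853896146077924826952617800745299415229765070908825515089474236322164505215647715243753317663266365876076339424087018209275800014828122808808668594429078880560079181235485678664624073941921747527312079819921189171547617776597820803609959481774985363940005607938047034583515348838251280806438649157965726949,
  208457966188115298827441491097707313794908915577296966809025425440714906288614666664220125744562671064220313596769184491972109810507155406355997002974727364743920578808790183405678777739182864651300420398689149238861581490651148232331096878839515681306093065870227074533297683801054023424635198430261535066741714620262080822826837137304646700470362431132796627741950397870107141713466025776807550727926930511668700560869919738272652160948362700106404309294068599983992591785331184255420016984488133739628415328946642747430334764106975435112976061239196892156562263133776362541357251516144435907722710884655284762474576454201277136677308305258065064510288154390970916866044801196417355939035412344640676335591851437972913046215181508750703615643900492712553821917551743214902113946049890232597282623470978162882711490302311351366314629928008890158452972332608170275339,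
  152062314767631525953940992750325875606922167817030427100215946034226808013388512589773947342721199118903144719473694670918875540016812749696652888711320277008396184008500780271994637066917294068621303294983590171530904077226065916617631896683745119190131722056424388447184404798881256980287375978560166532449877483103829188343250759750255809408063368127146315902296614113288968604513834431293419617115992595284443725884813839165346745803795154717200896394930619336467100951008183932578357722096497735264643071995247377372272472954253045847582565253895047421907335544066252318344919056357417232637635273115842807830028121115593134677416127877043359437437015173549456684092684610283419412289074836239198977904604943475860420326414252951950908270945915851086191015559097692538797694264378710109464510973318175538328061773109725318751121078351703872085281437059873518987] k)

theorem isGluing (k : Fin 4) : IsGluing (gluing k) := by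
  revert k; decide +kernel

theorem isFree (k : Fin 4) : IsGluing.IsFree (gluing k) := by
  revert k; decide +kernel

/-- The symmetry that induces the permutation `π` of the sides carries the ideal vertex `a` to
the ideal vertex `b`. -/
def MapsVertex (π : Fin 24 → Fin 24) (a b : Fin 24) : Prop :=
  ∀ k, vertexInt a 0 * symCol π 0 k + vertexInt a 1 * symCol π 1 k + vertexInt a 2 * symCol π 2 k +
    vertexInt a 3 * symCol π 3 k + (if k = 4 then 4 else 0) = 2 * vertexInt b k

instance (π : Fin 24 → Fin 24) (a b : Fin 24) : Decidable (MapsVertex π a b) := by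
  unfold MapsVertex; infer_instance

theorem MapsVertex.sym_vertex {π : Fin 24 → Fin 24} {a b : Fin 24} (h : MapsVertex π a b)
    (hπ : IsSym π) : (sym π hπ).1 (idealVertex a) = idealVertex b := by
  ext k
  have h2 : ((vertexInt a 0 * symCol π 0 k + vertexInt a 1 * symCol π 1 k +
      vertexInt a 2 * symCol π 2 k + vertexInt a 3 * symCol π 3 k +
      (if k = 4 then 4 else 0) : ℤ) : ℝ) = ((2 * vertexInt b k : ℤ) : ℝ) := by rw [h k]
  rw [sym_apply, symLin_apply, vertex_four]
  simp only [idealVertex_apply]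
  push_cast at h2
  split_ifs at h2 ⊢ <;> linarith

theorem IsGluing.map_vertex {κ : Fin 24 → Fin 24 → Fin 24} (h : IsGluing κ) {i a b : Fin 24}
    (hia : lorZ (vertexInt a) (sideInt i) = 0) (hab : MapsVertex (κ i) a b) :
    (h.map i).1 (idealVertex a) = idealVertex b := by
  have h1 : lor (idealVertex b) (sideNormal (κ i i)) = 0 := by
    rw [← hab.sym_vertex (h.isSym i), ← sym_side (h.isSym i), lor_val, lor_vertex_side, hia]
    norm_num
  rw [IsGluing.map, mul_val_apply, hab.sym_vertex, refl_apply_of_orth h1]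

theorem table_check (k : Fin 4) : ∀ e ∈ table k, gluing k e.1 e.1 = e.2.1 ∧
    ∀ p ∈ e.2.2, lorZ (vertexInt p.1) (sideInt e.1) = 0 ∧ MapsVertex (gluing k e.1) p.1 p.2 := by
  revert k; decide +kernel

/-- The side-pairings of the four tables. -/
def tableSidePairing (k : Fin 4) : SidePairing := (isGluing k).toSidePairing

theorem hasTable (k : Fin 4) : (tableSidePairing k).HasTable (table k) := fun e he =>
  ⟨(table_check k e he).1, fun p hp => (isGluing k).map_vertex
    ((table_check k e he).2 p hp).1 ((table_check k e he).2 p hp).2⟩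

/-- The distance of an ideal vertex from `e₁ + e₅` in the graph of the identifications of ideal
vertices that are listed in a table, packed in base 16. -/
def vertexDist (k : Fin 4) (b : Fin 24) : ℕ := 
  (![
  10563754393163578271846306322,
  10563754428895436846990959154,
  5612069830770248637028114994,
  5591442497156445118478234401] k : ℕ) >>> (4 * b.val) % 16

theorem exists_closer (k : Fin 4) (b : Fin 24) : b = 17 ∨ ∃ e ∈ table k, ∃ p ∈ e.2.2,
    p.1 = b ∧ vertexDist k p.2 < vertexDist k b ∨ p.2 = b ∧ vertexDist k p.1 < vertexDist k b := by
  revert k b; decide +kernel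

/-- `vertexDist` certifies connectedness: every vertex other than the 17th is paired, in one
direction or the other, with a vertex of smaller value. -/
theorem exists_map_vertex_17 (k : Fin 4) (b : Fin 24) :
    ∃ γ ∈ (tableSidePairing k).group, γ.1 (idealVertex 17) = idealVertex b := by
  induction hn : vertexDist k b using Nat.strong_induction_on generalizing b with
  | _ n ih =>
    rcases exists_closer k b with rfl | ⟨e, he, p, hp, h⟩
    · exact ⟨1, one_mem _, rfl⟩
    · have hg := (tableSidePairing k).g_mem e.1
      have hv := (hasTable k e he).2 p hp
      rcases h with ⟨rfl, h⟩ | ⟨rfl, h⟩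
      · obtain ⟨γ, hγ, hγv⟩ := ih _ (hn ▸ h) p.2 rfl
        exact ⟨((tableSidePairing k).g e.1)⁻¹ * γ, mul_mem (inv_mem hg) hγ, by
          rw [mul_val_apply, hγv, ← hv, inv_val_apply_self]⟩
      · obtain ⟨γ, hγ, hγv⟩ := ih _ (hn ▸ h) p.1 rfl
        exact ⟨(tableSidePairing k).g e.1 * γ, mul_mem hg hγ, by
          rw [mul_val_apply, hγv, hv]⟩

/-- Up to positive scaling each cusp point is an image of an ideal vertex, so transitivity on the
ideal vertices gives a single orbit. -/
theorem SidePairing.oneCusped_of_vertices {Φ : SidePairing} (hΦ : Φ.YieldsManifold)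
    (h : ∀ b, ∃ γ ∈ Φ.group, γ.1 (idealVertex 17) = idealVertex b) : OneCusped Φ.group := by
  refine ⟨⟨_, isCuspPoint_vertex hΦ 17⟩, fun u w hu hw => ?_⟩
  obtain ⟨c, hc, γ, hγ, a, ha⟩ := exists_smul_isVertexImage hΦ hu
  obtain ⟨d, hd, δ, hδ, b, hb⟩ := exists_smul_isVertexImage hΦ hw
  obtain ⟨α, hα, hαa⟩ := h a
  obtain ⟨β, hβ, hβb⟩ := h b
  refine ⟨δ⁻¹ * (β * (α⁻¹ * γ)), mul_mem (inv_mem hδ) (mul_mem hβ (mul_mem (inv_mem hα) hγ)),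
    c⁻¹ * d, ?_⟩
  have h1 : (δ⁻¹ * (β * (α⁻¹ * γ))).1 (c • u) = d • w := by
    rw [mul_val_apply, mul_val_apply, mul_val_apply, ha, ← hαa, inv_val_apply_self, hβb, ← hb,
      inv_val_apply_self]
  rw [mul_smul, ← h1, map_smul, inv_smul_smul₀ hc.ne']

theorem yieldsManifold_table (k : Fin 4) : (tableSidePairing k).YieldsManifold :=
  (isGluing k).yieldsManifold (isFree k)

theorem oneCusped_table (k : Fin 4) : OneCusped (tableSidePairing k).group :=
  SidePairing.oneCusped_of_vertices (yieldsManifold_table k) (exists_map_vertex_17 k)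

end Hyp24Cell

end

/-- The maximum cusp of every hyperbolic 24-cell manifold with exactly one cusp has volume 8; in
particular this holds for the four manifolds 24c1.1, 24c1.2, 24c1.3, 24c1.4, which are such
manifolds. -/
theorem mainTheorem2 :
    (∀ Φ : Hyp24Cell.SidePairing, Φ.YieldsManifold → Hyp24Cell.OneCusped Φ.group →
      Hyp24Cell.MaximumCuspHasVolume Φ.group 8) ∧
    (∀ k : Fin 4, ∃ Φ : Hyp24Cell.SidePairing, Φ.HasTable (Hyp24Cell.table k) ∧
      Φ.YieldsManifold ∧ Hyp24Cell.OneCusped Φ.group ∧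
      Hyp24Cell.MaximumCuspHasVolume Φ.group 8) := by
  have h1 := fun Φ h h1 => Hyp24Cell.SidePairing.maximumCuspHasVolume (Φ := Φ) h h1
  exact ⟨h1, fun k => ⟨Hyp24Cell.tableSidePairing k, Hyp24Cell.hasTable k,
    Hyp24Cell.yieldsManifold_table k, Hyp24Cell.oneCusped_table k,
    h1 _ (Hyp24Cell.yieldsManifold_table k) (Hyp24Cell.oneCusped_table k)⟩⟩
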